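/- Let $F$ be a nonarchimedean local field of residue characteristic $p$, with ring of integers $\mathcal{O}_F$, uniformizer $\pi$ and residue field of $q$ elements. A quadratic lattice is a finite free $\mathcal{O}_F$-module $L$ with a quadratic form $q_L:L\to F$ and bilinear form $(x,y)=q_L(x+y)-q_L(x)-q_L(y)$; it is integral if $q_L(L)\subset\mathcal{O}_F$. For $a\in F$ let $\langle a\rangle$ be the rank one lattice with a generator of norm $a$. For $N\in\mathcal{O}_F$ let $\delta_F(N)$ be the lattice of matrices $\begin{pmatrix}-Na&b\\c&a\end{pmatrix}$ with $a,b,c\in\mathcal{O}_F$ and quadratic form $\det$. Let $\chi_F(x)=(x,\pi)_F$ (Hilbert symbol) if $x\in F^\times$ has even valuation and $\chi_F(x)=0$ otherwise. For $p$ odd and $\varepsilon\in\{\pm1\}$ let $H_k^\varepsilon$ be the self-dual lattice of rank $k$ with $\chi_F\big((-1)^{\binom k2}\det(\tfrac12(x_i,x_j))\big)=\varepsilon$ for a basis $(x_i)$ (unique up to isometry; it exists for $k\ge1$, and for $k=0$ only if $\varepsilon=+1$); for $p=2$ only $\varepsilon=+1$ and $k$ even are considered, and $H_k^+$ is the orthogonal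 sum of $k/2$ copies of $\mathcal{O}_F^2$ with the form $xy$. For an integral lattice $H$ of rank $m$ and a lattice $L$ of rank $n$ let $$\mathrm{Den}(H,L)=\lim_{d\to\infty}\frac{\#\mathrm{Rep}_{H,L}(\mathcal{O}_F/\pi^d)}{q^{d(mn-n(n+1)/2)}},$$ where $\mathrm{Rep}_{H,L}(\mathcal{O}_F/\pi^d)$ is the set of linear maps $L/\pi^dL\to H/\pi^dH$ that preserve the quadratic forms modulo $\pi^d$ (it is empty if $L$ is not integral). For an integer $n\ge 0$ and a sign $s$ let $$\mathrm{Nor}^{s}(X,n)=\Big(1-\tfrac{1+(-1)^{n+1}}2\,s\,q^{-(n+1)/2}X\Big)\prod_{1\le i<(n+1)/2}(1-q^{-2i}X^2).$$ Let $\mathrm{Den}^\varepsilon(X,L)$ be the polynomial with $\mathrm{Den}^\varepsilon(q^{-k},L)=\mathrm{Den}(H^\varepsilon_{2k+n+1},L)/\mathrm{Nor}^\varepsilon(q^{-k},n)$ for all $k\ge0$, where $n$ is the rank of $L$. For a lattice $M$ of rank $r\ge1$ and $N\in\mathcal{O}_F$, let $\mathrm{Den}^\varepsilon_{\Delta(N)}(X,M)$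 be the polynomial whose value at $X=q^{-m}$ is $\mathrm{Den}(\delta_F(N)\perp H^\varepsilon_{2m+r-2},M)$ divided by $\mathrm{Nor}^\varepsilon(q^{-m},r-1)$ if $\pi\mid N$ and by $\mathrm{Nor}^{\varepsilon\chi_F(N)}(q^{-m},r)$ if $\pi\nmid N$, for all $m\ge0$ for which $H^\varepsilon_{2m+r-2}$ exists. Let $\partial\mathrm{Den}^\varepsilon(L)=-\frac{d}{dX}\big|_{X=1}\mathrm{Den}^\varepsilon(X,L)$ and $\partial\mathrm{Den}^\varepsilon_{\Delta(N)}(M)=-\frac{d}{dX}\big|_{X=1}\mathrm{Den}^\varepsilon_{\Delta(N)}(X,M)$. Theorem. Let $M$ be a quadratic $\mathcal{O}_F$-lattice of rank $r\ge1$ with nondegenerate bilinear form, let $N\in\mathcal{O}_F$ be nonzero and let $\varepsilon\in\{\pm1\}$. Assume that $p$ is odd, or that $p=2$, $r$ is even and $\varepsilon=+1$. Then the polynomials $\mathrm{Den}^\varepsilon_{\Delta(N)}(X,M)$, $\mathrm{Den}^\varepsilon(X,M\perp\langle N\rangle)$ and $\mathrm{Den}^\varepsilon(X,M\perp\langle\pi^{-2}N\rangle)$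 exist (and are unique), and $$\mathrm{Den}^\varepsilon_{\Delta(N)}(X,M)=\mathrm{Den}^\varepsilon(X,M\perp\langle N\rangle)-X^2\cdot\mathrm{Den}^\varepsilon(X,M\perp\langle\pi^{-2}N\rangle).$$ Moreover, if $M\perp\langle N\rangle$ does not embed isometrically into the quadratic space $H^\varepsilon_{r+2}\otimes_{\mathcal{O}_F}F$, then $$\partial\mathrm{Den}^\varepsilon_{\Delta(N)}(M)=\partial\mathrm{Den}^\varepsilon(M\perp\langle N\rangle)-\partial\mathrm{Den}^\varepsilon(M\perp\langle\pi^{-2}N\rangle).$$ -/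

import Mathlib

open Filter Topology Polynomial TensorProduct
open scoped ValuativeRel

namespace LocalDensity

noncomputable section

section Symbols

open scoped Classical

variable {O : Type*} [CommRing O] (F : Type*) [Field F] [Algebra O F]

/-- The Hilbert symbol `(a, b)` of a field: it is `1` if `z ^ 2 = a * x ^ 2 + b * y ^ 2` has a
nonzero solution and `-1` otherwise. -/
def hilbertSymbol {F : Type*} [Field F] (a b : F) : ℤ :=
  if ∃ x y z : F, (x, y, z) ≠ 0 ∧ z ^ 2 = a * x ^ 2 + b * y ^ 2 then 1 else -1

/-- The character `χ_F`, formed with the uniformizer `ϖ`: it is `(x, ϖ)` if `x` has even valuation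
(that is, if `x` is a unit times `ϖ ^ (2 * a)`), and `0` otherwise. -/
def chi {F : Type*} [Field F] [Algebra O F] (ϖ : O) (x : F) : ℤ :=
  if ∃ (a : ℤ) (u : Oˣ), x = algebraMap O F u * algebraMap O F ϖ ^ (2 * a)
  then hilbertSymbol x (algebraMap O F ϖ) else 0

/-- The discriminant `(-1) ^ (k choose 2) * det ((x_i, x_j) / 2)` of a quadratic form on `O ^ k`
with values in `O`, computed in the standard basis. -/
def disc {k : ℕ} (H : QuadraticForm O (Fin k → O)) : F :=
  (-1) ^ (k.choose 2) * Matrix.det (Matrix.of fun i j : Fin k =>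
    algebraMap O F (QuadraticMap.polar H (Pi.single i 1) (Pi.single j 1)) / 2)

/-- The quadratic space `H ⊗ F` over `F` attached to an integral quadratic lattice `H = O ^ k`. -/
def genericFiber {k : ℕ} (H : QuadraticForm O (Fin k → O)) :
    QuadraticForm F (F ⊗[O] (Fin k → O)) :=
  LinearMap.BilinMap.toQuadraticMap
    (LinearMap.BilinForm.baseChange F (H.toBilin (Pi.basisFun O (Fin k))))

theorem genericFiber_tmul {k : ℕ} (H : QuadraticForm O (Fin k → O)) (c : F) (h : Fin k → O) :
    genericFiber F H (c ⊗ₜ[O] h) = c ^ 2 * algebraMap O F (H h) := by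
  have h1 : H.toBilin (Pi.basisFun O (Fin k)) h h = H h := by
    conv_rhs => rw [← H.toQuadraticMap_toBilin (Pi.basisFun O (Fin k))]
    rfl
  simp [genericFiber, LinearMap.BilinForm.baseChange_tmul, h1, Algebra.smul_def]
  ring

end Symbols

section Lattices

variable {O : Type*} [CommRing O]

/-- The rank one lattice `⟨N⟩`, for `N` in `F`: the module `O` with the form `x ↦ x ^ 2 N`. -/
def rankOne {F : Type*} [Field F] [Algebra O F] (N : F) : QuadraticMap O O F :=
  (LinearMap.toSpanSingleton O F N).compQuadraticMap QuadraticMap.sq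

theorem rankOne_apply {F : Type*} [Field F] [Algebra O F] (N : F) (x : O) :
    rankOne N x = algebraMap O F x ^ 2 * N := by
  simp only [rankOne, LinearMap.compQuadraticMap_apply, QuadraticMap.sq_apply,
    LinearMap.toSpanSingleton_apply, Algebra.smul_def, map_mul]
  ring

/-- The lattice `δ(N)` of the matrices `[-N a, b; c, a]` with the determinant as quadratic form, in
the coordinates `(a, b, c)`. -/
def delta (N : O) : QuadraticForm O (O × O × O) :=
  -(N • QuadraticMap.linMulLin (LinearMap.fst O O (O × O)) (LinearMap.fst O O (O × O))) -
    QuadraticMap.linMulLin (LinearMap.fst O O O ∘ₗ LinearMap.snd O O (O × O))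
      (LinearMap.snd O O O ∘ₗ LinearMap.snd O O (O × O))

theorem delta_apply (N a b c : O) : delta N (a, b, c) = Matrix.det !![-N * a, b; c, a] := by
  simp [delta, Matrix.det_fin_two]
  ring

/-- The hyperbolic plane: `O ^ 2` with the form `(x, y) ↦ x * y`. -/
def hyperbolicPlane (O : Type*) [CommRing O] : QuadraticForm O (O × O) :=
  QuadraticMap.linMulLin (LinearMap.fst O O O) (LinearMap.snd O O O)

/-- An integral quadratic lattice is self-dual if `x ↦ (x, ·)` identifies it with its dual, where
`(x, y) = q (x + y) - q x - q y`. -/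
def IsSelfDual {H : Type*} [AddCommGroup H] [Module O H] (q : QuadraticForm O H) : Prop :=
  Function.Bijective (QuadraticMap.polarBilin q : H → H →ₗ[O] O)

/-- A quadratic lattice is nondegenerate if its bilinear form has trivial kernel. -/
def IsNondegenerate {F : Type*} [Field F] [Algebra O F] {L : Type*} [AddCommGroup L] [Module O L]
    (q : QuadraticMap O L F) : Prop :=
  ∀ x : L, (∀ y : L, QuadraticMap.polar q x y = 0) → x = 0

/-- `H` is a model of the lattice `H_k^ε` on `O ^ k`. In odd residue characteristic this means that
`H` is self-dual with `χ_F (disc H) = ε`; this determines `H` up to isometry, and for `k = 0` it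
forces `ε = 1`. In residue characteristic two only `ε = 1` is allowed, and `H` is isometric to an
orthogonal sum of hyperbolic planes. -/
def IsStandard [IsLocalRing O] (F : Type*) [Field F] [Algebra O F] (ϖ : O) (ε : ℤˣ) {k : ℕ}
    (H : QuadraticForm O (Fin k → O)) : Prop :=
  (ringChar (IsLocalRing.ResidueField O) ≠ 2 → IsSelfDual H ∧ chi ϖ (disc F H) = (ε : ℤ)) ∧
  (ringChar (IsLocalRing.ResidueField O) = 2 →
    ε = 1 ∧ ∃ j : ℕ, Nonempty (QuadraticMap.IsometryEquiv H
      (QuadraticMap.pi fun _ : Fin j => hyperbolicPlane O)))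

/-- The quadratic lattice `L` embeds isometrically into the quadratic space `H ⊗ F`. -/
def EmbedsInGenericFiber {F : Type*} [Field F] [Algebra O F] {k : ℕ}
    (H : QuadraticForm O (Fin k → O)) {L : Type*} [AddCommGroup L] [Module O L]
    (qL : QuadraticMap O L F) : Prop :=
  ∃ f : L →ₗ[O] F ⊗[O] (Fin k → O), Function.Injective f ∧
    ∀ x : L, genericFiber F H (f x) = qL x

end Lattices

section Densities

variable {O : Type*} [CommRing O] {F : Type*} [Field F] [Algebra O F]
  {H : Type*} [AddCommGroup H] [Module O H] {L : Type*} [AddCommGroup L] [Module O L]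

/-- The set `Rep_{H, L} (O / ϖ ^ d)`. A homomorphism `L / ϖ ^ d → H / ϖ ^ d` is the same as an
`O`-linear map `L → H / ϖ ^ d`; it preserves the quadratic forms if for each `x` in `L` and each
lift `h` in `H` of the image of `x`, the numbers `q_H (h)` and `q_L (x)` differ by an element of
`ϖ ^ d O`. The set is empty if `q_L` takes a value outside `O`. -/
def rep (ϖ : O) (qH : QuadraticForm O H) (qL : QuadraticMap O L F) (d : ℕ) :
    Set (L →ₗ[O] H ⧸ (Ideal.span {ϖ ^ d} • (⊤ : Submodule O H))) :=
  {φ | ∀ (x : L) (h : H), Submodule.Quotient.mk h = φ x →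
    ∃ a : O, algebraMap O F (qH h) - qL x = algebraMap O F (ϖ ^ d * a)}

variable [IsLocalRing O]

variable (O) in
/-- The number of elements of the residue field, as a real number. -/
def residueCard : ℝ := (Nat.card (IsLocalRing.ResidueField O) : ℝ)

/-- `Den (H, L) = ℓ`: the numbers `#Rep_{H, L} (O / ϖ ^ d) / q ^ (d * (m * n - n * (n + 1) / 2))`
converge to `ℓ` as `d` tends to infinity, where `m` and `n` are the ranks of `H` and `L`. -/
def HasDensity (ϖ : O) (qH : QuadraticForm O H) (qL : QuadraticMap O L F) (ℓ : ℝ) : Prop :=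
  Tendsto (fun d : ℕ => (Nat.card (rep ϖ qH qL d) : ℝ) /
    residueCard O ^ ((d : ℤ) * ((Module.finrank O H : ℤ) * (Module.finrank O L : ℤ) -
      ((Module.finrank O L + 1).choose 2 : ℕ)))) atTop (𝓝 ℓ)

variable (O) in
/-- The normalizing factor `Nor^s (X, n)`. -/
def nor (s : ℤ) (n : ℕ) : ℝ[X] :=
  (1 - C (if Odd n then (s : ℝ) * (residueCard O ^ ((n + 1) / 2))⁻¹ else 0) * X) *
    ∏ i ∈ (Finset.Icc 1 n).filter (fun i => 2 * i < n + 1),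
      (1 - C (residueCard O ^ (2 * i))⁻¹ * X ^ 2)

/-- The defining property of the polynomial `Den^ε (X, L)`: for all `k ≥ 0`, its value at `q ^ (-k)`
is `Den (H_{2k+n+1}^ε, L) / Nor^ε (q ^ (-k), n)`, where `n` is the rank of `L`. -/
def IsDen (ϖ : O) (ε : ℤˣ) (qL : QuadraticMap O L F) (P : ℝ[X]) : Prop :=
  ∀ (k : ℕ) (h : QuadraticForm O (Fin (2 * k + Module.finrank O L + 1) → O)),
    IsStandard F ϖ ε h → ∃ ℓ : ℝ, HasDensity ϖ h qL ℓ ∧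
      P.eval (residueCard O ^ k)⁻¹ =
        ℓ / (nor O ε (Module.finrank O L)).eval (residueCard O ^ k)⁻¹

/-- The defining property of the polynomial `Den^ε_{Δ(N)} (X, M)`: for all `m ≥ 0` for which the
lattice `H_{2m+r-2}^ε` exists, where `r ≥ 1` is the rank of `M`, its value at `q ^ (-m)` is
`Den (δ(N) ⟂ H_{2m+r-2}^ε, M)`, divided by `Nor^ε (q ^ (-m), r - 1)` if `ϖ ∣ N` and by
`Nor^(ε χ_F(N)) (q ^ (-m), r)` if `ϖ ∤ N`. -/
def IsDenDelta (ϖ : O) (ε : ℤˣ) (N : O) (qM : QuadraticMap O L F) (P : ℝ[X]) : Prop :=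
  ∀ (m k : ℕ), k + 2 = 2 * m + Module.finrank O L →
    ∀ h : QuadraticForm O (Fin k → O), IsStandard F ϖ ε h →
      ∃ ℓ : ℝ, HasDensity ϖ ((delta N).prod h) qM ℓ ∧
        (ϖ ∣ N → P.eval (residueCard O ^ m)⁻¹ =
          ℓ / (nor O ε (Module.finrank O L - 1)).eval (residueCard O ^ m)⁻¹) ∧
        (¬ ϖ ∣ N → P.eval (residueCard O ^ m)⁻¹ =
          ℓ / (nor O (ε * chi ϖ (algebraMap O F N)) (Module.finrank O L)).eval
            (residueCard O ^ m)⁻¹)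

/-- The local density polynomial `Den^ε (X, L)`. -/
def den (ϖ : O) (ε : ℤˣ) (qL : QuadraticMap O L F) : ℝ[X] :=
  Classical.epsilon fun P => IsDen ϖ ε qL P

/-- The local density polynomial `Den^ε_{Δ(N)} (X, M)` with level `N`. -/
def denDelta (ϖ : O) (ε : ℤˣ) (N : O) (qM : QuadraticMap O L F) : ℝ[X] :=
  Classical.epsilon fun P => IsDenDelta ϖ ε N qM P

/-- The derived local density `∂Den^ε (L) = - d/dX Den^ε (X, L)` at `X = 1`. -/
def derivedDen (ϖ : O) (ε : ℤˣ) (qL : QuadraticMap O L F) : ℝ :=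
  -(derivative (den ϖ ε qL)).eval 1

/-- The derived local density `∂Den^ε_{Δ(N)} (M) = - d/dX Den^ε_{Δ(N)} (X, M)` at `X = 1`. -/
def derivedDenDelta (ϖ : O) (ε : ℤˣ) (N : O) (qM : QuadraticMap O L F) : ℝ :=
  -(derivative (denDelta ϖ ε N qM)).eval 1

end Densities

end

end LocalDensity

/-!
The residue field has `q` elements, and all densities are treated as volumes: `vol` is the Haar
probability measure of a finite free `O`-module, and `Den (H, L)` is, up to a power of `q`, the
eventual value of the volume of the set `repSet` of linear maps `L → H` that preserve the forms
modulo `ϖ ^ d`. When `H` is self-dual and the form on `L` is nonsingular, Hensel's lemma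
(`vol_inter_repSet_eq`) makes this volume scale exactly for large `d`, locally constantly in the form
on `L`; this is the notion `IsDensity`, and `exists_isDensity` gives its existence.

*Existence of the polynomials.* The representations `φ` of `L` by `H` are sorted by the kernel of
their reduction `L / ϖ → H / ϖ`. Those with injective reduction are counted over the residue field
(`vol_primitive_inter_repSet`), and those which vanish on a subspace `K` extend to the overlattice of
`L` inside `ϖ ^ (-1) L` attached to `K` (`IsDensity.vol_range_inter`). Möbius inversion over the
subspaces thus expresses the density of `L` by a count over the residue field and by the densities of
proper overlattices (`IsDensity.primitive_eq`), and as only finitely many indices occur among integral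
overlattices, an induction on the index proves that everything is polynomial in `q ^ (-k)`
(`exists_densityPoly`). The count over the residue field is computed by characters of the space of
quadratic forms: the number of isometric embeddings of `V` into `W` is a combination of Gauss sums of
`W`, and the Gauss sums of a nondegenerate `W` depend on the number of planes and on the sign in a
multiplicative way (`GaussType`), so that the number is, up to a power of `q`, the value at
`± q ^ (-j)` of a polynomial that does not depend on `W` (`card_injective_isometry`). This polynomial
vanishes wherever the dimension of `W` is less than that of `V`, and these zeros make it divisible by
the normalizing factor (`nor_dvd_isoPoly`). In odd characteristic the Gauss sums are found by
diagonalization (`gaussType_diagonal`). In characteristic two only the plane of sign `-1` is wanting,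
which serves to produce the zeros at negative arguments; it is the norm form of the quadratic
extension (`exists_gaussType_neg_two`).

*The identity.* Let `G` be the sum of `h` and two hyperbolic planes, where `h` is the standard
lattice of rank `2 m + r - 2`, so that `G` is standard of rank `2 m + r + 2`. A representation of
`M ⟂ ⟨N⟩` by `G` is a vector `x` of norm `N` with a representation of `M` by the orthogonal
complement of `x`. If `x` is primitive, Eichler transvections move it to the vector `(1, N)` of a
hyperbolic plane (`exists_isometryEquiv_of_primitive`), whose complement is `δ(N) ⟂ h`. The primitive
part of the density of `M ⟂ ⟨N⟩` is therefore the density of `M` in `δ(N) ⟂ h` multiplied by the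
density of the primitive vectors of norm `N` in `G` (`vol_primitive_inter_repSet_prod`), and the
latter is the quotient of the two normalizing factors in question (`card_primitive_norm_mul_nor`).
If `x` is not primitive, the representation extends to `M ⟂ ⟨ϖ ^ (-2) N⟩`, with a factor
`q ^ (-2 m)` that comes from the volume of `ϖ G` and the index `overIndex_scaleSnd`; this is the term
with `X ^ 2`. Together these facts give `hasDensity_delta` and `isDenDelta_sub`.

*The derivative.* Differentiating `X ^ 2 * P'` at `1` gives the additional term `2 * P'.eval 1`. Up to
a nonzero factor, `P'.eval 1` is the density of `M ⟂ ⟨ϖ ^ (-2) N⟩` in a standard lattice of rank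
`r + 2`. By compactness a nonzero density yields an exact representation (`IsDensity.exists_rep`),
hence an isometric embedding of `M ⟂ ⟨N⟩` into the quadratic space; so it vanishes if there is none
(`eval_one_eq_zero`).
-/


open Filter Topology Polynomial TensorProduct
open scoped ValuativeRel

namespace LocalDensity

noncomputable section

set_option linter.unusedSectionVars false

/-! ### Reduction modulo powers of the uniformizer -/

section Reduction

variable {O : Type*} [CommRing O] {X : Type*} [AddCommGroup X] [Module O X]

theorem mem_span_smul_top {a : O} {x : X} :
    x ∈ Ideal.span {a} • (⊤ : Submodule O X) ↔ ∃ y, x = a • y := by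
  rw [Submodule.ideal_span_singleton_smul, Submodule.mem_smul_pointwise_iff_exists]
  simp [eq_comm]

/-- The reduction `X / ϖ ^ d` of a module. -/
abbrev Red (X : Type*) [AddCommGroup X] [Module O X] (ϖ : O) (d : ℕ) : Type _ :=
  X ⧸ (Ideal.span {ϖ ^ d} • (⊤ : Submodule O X))

theorem red_mk_eq_zero {ϖ : O} {d : ℕ} {x : X} :
    (Submodule.Quotient.mk x : Red X ϖ d) = 0 ↔ ∃ y, x = ϖ ^ d • y := by
  rw [Submodule.Quotient.mk_eq_zero, mem_span_smul_top]

theorem red_mk_eq {ϖ : O} {d : ℕ} {x y : X} :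
    (Submodule.Quotient.mk x : Red X ϖ d) = Submodule.Quotient.mk y ↔
      ∃ z, x = y + ϖ ^ d • z := by
  rw [Submodule.Quotient.eq, mem_span_smul_top]
  simp [sub_eq_iff_eq_add']

variable [IsDomain O] [IsDiscreteValuationRing O]

variable (O) in
/-- The order `q` of the residue field, as a natural number. -/
def residueNat : ℕ := Nat.card (IsLocalRing.ResidueField O)

theorem residueCard_eq_cast : residueCard O = (residueNat O : ℝ) := rfl

variable [Finite (IsLocalRing.ResidueField O)]

variable (O) in
theorem one_lt_residueNat : 1 < residueNat O := Finite.one_lt_card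

variable (O) in
theorem one_lt_residueCard : 1 < residueCard O := by
  rw [residueCard_eq_cast]
  exact_mod_cast one_lt_residueNat O

variable (O) in
theorem residueCard_pos : 0 < residueCard O := zero_lt_one.trans (one_lt_residueCard O)

theorem card_quotient_span_pow {ϖ : O} (hϖ : Irreducible ϖ) (d : ℕ) :
    Nat.card (O ⧸ Ideal.span {ϖ ^ d}) = residueNat O ^ d := by
  have h := cardQuot_pow_of_prime (P := IsLocalRing.maximalIdeal O)
    (IsDiscreteValuationRing.not_a_field O) (i := d)
  rw [hϖ.maximalIdeal_eq, Ideal.span_singleton_pow] at h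
  simp only [Submodule.cardQuot_apply] at h
  rw [h, ← hϖ.maximalIdeal_eq]
  rfl

variable [Module.Finite O X] [Module.Free O X]

/-- `X / ϖ ^ d` has the structure of `(O / ϖ ^ d) ^ rank X`. -/
theorem nonempty_red_equiv (ϖ : O) (d : ℕ) :
    Nonempty (Red X ϖ d ≃ (Fin (Module.finrank O X) → O ⧸ Ideal.span {ϖ ^ d})) := by
  let e : X ≃ₗ[O] (Fin (Module.finrank O X) → O) := (Module.finBasis O X).equivFun
  let g : (Fin (Module.finrank O X) → O) →ₗ[O]
      (Fin (Module.finrank O X) → O ⧸ Ideal.span {ϖ ^ d}) :=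
    LinearMap.pi fun i => (Submodule.mkQ _).comp (LinearMap.proj i)
  let f := g.comp e.toLinearMap
  have hf : Function.Surjective f := by
    intro y
    choose z hz using fun i => Submodule.Quotient.mk_surjective _ (y i)
    refine ⟨e.symm z, funext fun i => ?_⟩
    rw [← hz i]
    change (Submodule.Quotient.mk (e (e.symm z) i) : O ⧸ Ideal.span {ϖ ^ d}) = _
    rw [LinearEquiv.apply_symm_apply]
  have hk : LinearMap.ker f = Ideal.span {ϖ ^ d} • (⊤ : Submodule O X) := by
    ext x
    rw [mem_span_smul_top, LinearMap.mem_ker]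
    constructor
    · intro h
      have h' : ∀ i, ∃ a, e x i = ϖ ^ d * a := fun i => by
        have := congrFun h i
        have h2 : (Submodule.Quotient.mk (e x i) : O ⧸ Ideal.span {ϖ ^ d}) = 0 := this
        rw [Submodule.Quotient.mk_eq_zero] at h2
        exact Ideal.mem_span_singleton.1 h2
      choose a ha using h'
      refine ⟨e.symm a, e.injective ?_⟩
      rw [map_smul, LinearEquiv.apply_symm_apply]
      exact funext ha
    · rintro ⟨y, rfl⟩
      funext i
      change (Submodule.Quotient.mk (e (ϖ ^ d • y) i) : O ⧸ Ideal.span {ϖ ^ d}) = 0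
      rw [Submodule.Quotient.mk_eq_zero]
      exact Ideal.mem_span_singleton.2 ⟨e y i, by simp⟩
  exact ⟨((Submodule.quotEquivOfEq _ _ hk.symm).trans
    (f.quotKerEquivOfSurjective hf)).toEquiv⟩

theorem card_red {ϖ : O} (hϖ : Irreducible ϖ) (d : ℕ) :
    Nat.card (Red X ϖ d) = residueNat O ^ (d * Module.finrank O X) := by
  obtain ⟨e⟩ := nonempty_red_equiv (X := X) ϖ d
  rw [Nat.card_congr e, Nat.card_fun, card_quotient_span_pow hϖ]
  simp [pow_mul]

theorem finite_red {ϖ : O} (hϖ : Irreducible ϖ) (d : ℕ) : Finite (Red X ϖ d) := by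
  apply Nat.finite_of_card_ne_zero
  rw [card_red hϖ]
  exact pow_ne_zero _ (one_lt_residueNat O).ne_bot

end Reduction

/-! ### Volumes in finite free modules -/

section Volume

open MeasureTheory

/-- A set is periodic modulo `ϖ ^ d` if it is a union of cosets of `ϖ ^ d X`. -/
def PerMod {O : Type*} [CommRing O] {X : Type*} [AddCommGroup X] [Module O X]
    (ϖ : O) (d : ℕ) (S : Set X) : Prop :=
  ∀ x ∈ S, ∀ y : X, x + ϖ ^ d • y ∈ S

section

variable {O : Type*} [CommRing O] {X : Type*} [AddCommGroup X] [Module O X] {ϖ : O}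

theorem PerMod.mem_iff {d : ℕ} {S : Set X} (h : PerMod ϖ d S) (x y : X) :
    x + ϖ ^ d • y ∈ S ↔ x ∈ S :=
  ⟨fun hx => by simpa using h _ hx (-y), fun hx => h x hx y⟩

theorem PerMod.mono {d e : ℕ} (hde : d ≤ e) {S : Set X} (h : PerMod ϖ d S) : PerMod ϖ e S := by
  intro x hx y
  obtain ⟨k, rfl⟩ := Nat.exists_eq_add_of_le hde
  rw [pow_add, mul_smul]
  exact h x hx _

theorem PerMod.inter {d : ℕ} {S T : Set X} (hS : PerMod ϖ d S) (hT : PerMod ϖ d T) :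
    PerMod ϖ d (S ∩ T) := fun x hx y => ⟨hS x hx.1 y, hT x hx.2 y⟩

theorem PerMod.univ (d : ℕ) : PerMod ϖ d (Set.univ : Set X) := fun _ _ _ => trivial

theorem PerMod.compl {d : ℕ} {S : Set X} (hS : PerMod ϖ d S) : PerMod ϖ d Sᶜ :=
  fun x hx y hxy => hx ((hS.mem_iff x y).1 hxy)

end

variable (O : Type*) [CommRing O] [IsDomain O] [IsDiscreteValuationRing O]
  [TopologicalSpace O] [IsTopologicalRing O] [CompactSpace O] [T2Space O]
  {X : Type*} [AddCommGroup X] [Module O X]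

theorem compactSpace_moduleTopology (X : Type*) [AddCommGroup X] [Module O X]
    [Module.Finite O X] : @CompactSpace X (moduleTopology O X) := by
  let := moduleTopology O X
  have : IsModuleTopology O X := ⟨rfl⟩
  have : ContinuousAdd X := IsModuleTopology.toContinuousAdd O X
  obtain ⟨n, f, hf⟩ := Module.Finite.exists_fin' O X
  have hc : Continuous f := IsModuleTopology.continuous_of_linearMap f
  exact ⟨hf.range_eq ▸ isCompact_range hc⟩

theorem t2Space_moduleTopology (X : Type*) [AddCommGroup X] [Module O X]
    [Module.Finite O X] [Module.Free O X] : @T2Space X (moduleTopology O X) := by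
  let := moduleTopology O X
  have : IsModuleTopology O X := ⟨rfl⟩
  let e : X ≃ₗ[O] (Fin (Module.finrank O X) → O) := (Module.finBasis O X).equivFun
  exact T2Space.of_injective_continuous e.injective
    (IsModuleTopology.continuous_of_linearMap e.toLinearMap)

theorem topologicalAddGroup_moduleTopology (X : Type*) [AddCommGroup X] [Module O X] :
    @IsTopologicalAddGroup X (moduleTopology O X) _ := by
  let := moduleTopology O X
  have : IsModuleTopology O X := ⟨rfl⟩
  exact IsModuleTopology.topologicalAddGroup O X

variable {O} in
/-- Periodic sets are open, hence also closed and measurable. -/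
theorem PerMod.isOpen [Finite (IsLocalRing.ResidueField O)] [Module.Finite O X] [Module.Free O X]
    {ϖ : O} (hϖ : Irreducible ϖ)
    {d : ℕ} {S : Set X} (h : PerMod ϖ d S) : @IsOpen X (moduleTopology O X) S := by
  let := moduleTopology O X
  have : IsModuleTopology O X := ⟨rfl⟩
  have := topologicalAddGroup_moduleTopology O X
  have := compactSpace_moduleTopology O X
  have := t2Space_moduleTopology O X
  let U : AddSubgroup X := (Ideal.span {ϖ ^ d} • (⊤ : Submodule O X)).toAddSubgroup
  have := finite_red (X := X) hϖ d
  have : U.FiniteIndex :=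
    @AddSubgroup.finiteIndex_of_finite_quotient _ _ _ (inferInstanceAs (Finite (Red X ϖ d)))
  have hU : (U : Set X) = Set.range fun x : X => ϖ ^ d • x := by
    ext x
    simp only [U, Submodule.coe_toAddSubgroup, SetLike.mem_coe, mem_span_smul_top, Set.mem_range]
    simp [eq_comm]
  have hc : IsClosed (U : Set X) := by
    rw [hU]
    exact (isCompact_range (continuous_const_smul (ϖ ^ d))).isClosed
  have hUo : IsOpen (U : Set X) := AddSubgroup.isOpen_of_isClosed_of_finiteIndex U hc
  rw [isOpen_iff_mem_nhds]
  intro x hx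
  have : (fun y => x + y) '' (U : Set X) ∈ 𝓝 x :=
    ((isOpenMap_add_left x) _ hUo).mem_nhds ⟨0, U.zero_mem, by simp⟩
  refine Filter.mem_of_superset this ?_
  rintro _ ⟨y, hy, rfl⟩
  rw [hU] at hy
  obtain ⟨z, rfl⟩ := hy
  exact h x hx z

/-- The Haar probability measure of a finite free module over a compact discrete valuation ring, for
the module topology and its Borel sets. -/
def haarProb (X : Type*) [AddCommGroup X] [Module O X] [Module.Finite O X] :
    @Measure X (@borel X (moduleTopology O X)) :=
  let := moduleTopology O X
  let := borel X
  have : BorelSpace X := ⟨rfl⟩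
  have := topologicalAddGroup_moduleTopology O X
  have := compactSpace_moduleTopology O X
  Measure.addHaarMeasure ⊤

/-- The volume of a subset of a finite free module, normalized so that the module has
volume one. -/
def vol [Module.Finite O X] (S : Set X) : ℝ :=
  @Measure.real X (@borel X (moduleTopology O X)) (haarProb O X) S

variable [Module.Finite O X]

theorem haarProb_univ : haarProb O X Set.univ = 1 := by
  let := moduleTopology O X
  let := borel X
  have : BorelSpace X := ⟨rfl⟩
  have := topologicalAddGroup_moduleTopology O X
  have := compactSpace_moduleTopology O X
  exact Measure.addHaarMeasure_self (G := X) (K₀ := ⊤)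

instance : @IsFiniteMeasure X (@borel X (moduleTopology O X)) (haarProb O X) := by
  let := moduleTopology O X
  let := borel X
  exact ⟨by rw [haarProb_univ]; exact ENNReal.one_lt_top⟩

theorem vol_univ : vol O (Set.univ : Set X) = 1 := by
  simp [vol, Measure.real, haarProb_univ]

theorem vol_empty : vol O (∅ : Set X) = 0 := by
  simp [vol, Measure.real]

theorem vol_nonneg (S : Set X) : 0 ≤ vol O S := by
  simp [vol]

theorem vol_mono {S T : Set X} (h : S ⊆ T) : vol O S ≤ vol O T := by
  let := moduleTopology O X
  let := borel X
  exact measureReal_mono h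

/-- Volumes are invariant under translation. -/
theorem vol_translate (S : Set X) (x : X) : vol O ((fun y => x + y) ⁻¹' S) = vol O S := by
  let := moduleTopology O X
  let := borel X
  have : BorelSpace X := ⟨rfl⟩
  have := topologicalAddGroup_moduleTopology O X
  have := compactSpace_moduleTopology O X
  have : (haarProb O X) ((fun y => x + y) ⁻¹' S) = (haarProb O X) S :=
    measure_preimage_add (Measure.addHaarMeasure (⊤ : TopologicalSpace.PositiveCompacts X)) x S
  simp only [vol, Measure.real, this]

variable {O}
variable [Finite (IsLocalRing.ResidueField O)] [Module.Free O X] {ϖ : O} (hϖ : Irreducible ϖ)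

include hϖ

theorem PerMod.measurableSet {d : ℕ} {S : Set X} (h : PerMod ϖ d S) :
    @MeasurableSet X (@borel X (moduleTopology O X)) S := by
  let := moduleTopology O X
  let := borel X
  have : BorelSpace X := ⟨rfl⟩
  exact (h.isOpen hϖ).measurableSet

theorem vol_iUnion {ι : Type*} [Fintype ι] (S : ι → Set X) (hd : Pairwise (Function.onFun Disjoint S))
    (d : ι → ℕ) (h : ∀ i, PerMod ϖ (d i) (S i)) : vol O (⋃ i, S i) = ∑ i, vol O (S i) := by
  let := moduleTopology O X
  let := borel X
  have : BorelSpace X := ⟨rfl⟩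
  exact measureReal_iUnion_fintype hd fun i => (h i).measurableSet hϖ

/-- The volume is additive along the fibres of a map to a finite set. -/
theorem vol_eq_sum_fiber {Γ : Type*} [Fintype Γ] (f : X → Γ) {d : ℕ}
    (hf : ∀ x y, f (x + ϖ ^ d • y) = f x) {e : ℕ} {S : Set X} (hS : PerMod ϖ e S) :
    vol O S = ∑ y, vol O (S ∩ f ⁻¹' {y}) := by
  have h1 : S = ⋃ y, S ∩ f ⁻¹' {y} := by ext x; simp
  conv_lhs => rw [h1]
  refine vol_iUnion hϖ _ ?_ (fun _ => max d e) fun y => ?_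
  · intro y z hyz
    refine Set.disjoint_left.2 fun x hx hx' => hyz ?_
    exact hx.2.symm.trans hx'.2
  · refine (hS.mono (le_max_right _ _)).inter (PerMod.mono (le_max_left d e) ?_)
    intro x hx z
    simpa [hf] using hx

/-- The volume of a preimage under a surjection onto a finite group is computed by counting. -/
theorem vol_preimage {Γ : Type*} [AddCommGroup Γ] [Finite Γ] (f : X →+ Γ)
    (hf : Function.Surjective f) {d : ℕ} (hfd : ∀ x, f (ϖ ^ d • x) = 0) (B : Set Γ) :
    vol O (f ⁻¹' B) = (Nat.card B : ℝ) / Nat.card Γ := by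
  classical
  have := Fintype.ofFinite Γ
  have hper : ∀ x y, f (x + ϖ ^ d • y) = f x := fun x y => by rw [map_add, hfd, add_zero]
  have hpt : ∀ y, vol O (f ⁻¹' {y}) = vol O (f ⁻¹' {0}) := by
    intro y
    obtain ⟨x, rfl⟩ := hf y
    rw [← vol_translate O (f ⁻¹' {f x}) x]
    congr 1
    ext z
    simp
  have h1 := vol_eq_sum_fiber hϖ f hper (PerMod.univ (ϖ := ϖ) (X := X) 0)
  simp only [Set.univ_inter, hpt, vol_univ, Finset.sum_const, Finset.card_univ, nsmul_eq_mul] at h1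
  have hB : PerMod ϖ d (f ⁻¹' B) := fun x hx y => by
    simpa [hfd] using hx
  rw [vol_eq_sum_fiber hϖ f hper hB]
  have h2 : ∀ y, vol O (f ⁻¹' B ∩ f ⁻¹' {y}) = if y ∈ B then vol O (f ⁻¹' {0}) else 0 := by
    intro y
    split_ifs with hy
    · rw [← hpt y]
      congr 1
      ext x
      simp only [Set.mem_inter_iff, Set.mem_preimage, Set.mem_singleton_iff, and_iff_right_iff_imp]
      rintro rfl
      exact hy
    · rw [← vol_empty O (X := X)]
      congr 1
      ext x
      simp only [Set.mem_inter_iff, Set.mem_preimage, Set.mem_singleton_iff, Set.mem_empty_iff_false,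
        iff_false, not_and]
      rintro hx rfl
      exact hy hx
  simp only [h2]
  rw [Finset.sum_ite, Finset.sum_const_zero, add_zero, Finset.sum_const, nsmul_eq_mul]
  have h3 : (Nat.card B) = (Finset.univ.filter fun y => y ∈ B).card := by
    rw [Nat.card_eq_fintype_card, Fintype.card_subtype]
  rw [h3, Nat.card_eq_fintype_card, eq_div_iff, mul_assoc, mul_comm (vol O _), ← h1, mul_one]
  exact_mod_cast Fintype.card_ne_zero

/-- Volumes of periodic sets count residue classes. -/
theorem vol_eq_card_div {d : ℕ} {S : Set X} (hS : PerMod ϖ d S) :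
    vol O S = (Nat.card ((fun x => (Submodule.Quotient.mk x : Red X ϖ d)) '' S) : ℝ) /
      residueCard O ^ (d * Module.finrank O X) := by
  have := finite_red (X := X) hϖ d
  have h := vol_preimage hϖ (Γ := Red X ϖ d)
    (Submodule.mkQ (Ideal.span {ϖ ^ d} • (⊤ : Submodule O X))).toAddMonoidHom
    (Submodule.mkQ_surjective _) (d := d) (fun x => red_mk_eq_zero.2 ⟨x, rfl⟩)
    ((fun x => (Submodule.Quotient.mk x : Red X ϖ d)) '' S)
  rw [card_red hϖ, Nat.cast_pow, ← residueCard_eq_cast] at h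
  rw [← h]
  congr 1
  ext x
  constructor
  · exact fun hx => ⟨x, hx, rfl⟩
  · rintro ⟨y, hy, hxy⟩
    obtain ⟨z, rfl⟩ := red_mk_eq.1 hxy.symm
    exact hS y hy z

/-- Volumes of images under injective linear maps with open image. -/
theorem vol_image {X' : Type*} [AddCommGroup X'] [Module O X'] [Module.Finite O X']
    [Module.Free O X'] (A : X →ₗ[O] X') (hA : Function.Injective A) {c : ℕ}
    (hc : ∀ y, ∃ x, A x = ϖ ^ c • y) {d : ℕ} {S : Set X} (hS : PerMod ϖ d S) :
    vol O (A '' S) = vol O S * vol O (Set.range A) := by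
  classical
  have := finite_red (X := X) hϖ d
  have := Fintype.ofFinite (Red X ϖ d)
  let Z : Set X := {x | ∃ y, x = ϖ ^ d • y}
  have hper : ∀ T : Set X, PerMod ϖ d T → PerMod ϖ (d + c) (A '' T) := by
    rintro T hT _ ⟨x, hx, rfl⟩ y
    obtain ⟨z, hz⟩ := hc y
    exact ⟨x + ϖ ^ d • z, hT x hx z, by rw [map_add, map_smul, hz, pow_add, mul_smul]⟩
  have hZ : PerMod ϖ d Z := by
    rintro x ⟨y, rfl⟩ z
    exact ⟨y + z, by rw [smul_add]⟩
  have key : ∀ T : Set X, PerMod ϖ d T → vol O (A '' T) =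
      Nat.card ((fun x => (Submodule.Quotient.mk x : Red X ϖ d)) '' T) * vol O (A '' Z) := by
    intro T hT
    let J := ((fun x => (Submodule.Quotient.mk x : Red X ϖ d)) '' T)
    have hmem : ∀ x, (Submodule.Quotient.mk x : Red X ϖ d) ∈ J ↔ x ∈ T := by
      intro x
      constructor
      · rintro ⟨y, hy, hxy⟩
        obtain ⟨z, rfl⟩ := red_mk_eq.1 hxy.symm
        exact hT y hy z
      · exact fun hx => ⟨x, hx, rfl⟩
    let C : J → Set X := fun j => {x | (Submodule.Quotient.mk x : Red X ϖ d) = j}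
    have hC : ∀ j, PerMod ϖ d (C j) := by
      intro j x hx y
      exact (red_mk_eq.2 ⟨y, rfl⟩).trans hx
    have h1 : A '' T = ⋃ j, A '' C j := by
      rw [← Set.image_iUnion]
      congr 1
      ext x
      simp [C, hmem]
    rw [h1, vol_iUnion hϖ _ ?_ (fun _ => d + c) fun j => hper _ (hC j)]
    · have h2 : ∀ j, vol O (A '' C j) = vol O (A '' Z) := by
        rintro ⟨j, x, hx, rfl⟩
        rw [← vol_translate O _ (A x)]
        congr 1
        ext y
        constructor
        · rintro ⟨x', hx', h⟩
          obtain ⟨z, rfl⟩ := red_mk_eq.1 hx'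
          rw [map_add] at h
          exact ⟨_, ⟨z, rfl⟩, add_left_cancel h⟩
        · rintro ⟨_, ⟨z, rfl⟩, rfl⟩
          exact ⟨x + ϖ ^ d • z, red_mk_eq.2 ⟨z, rfl⟩, by rw [map_add]⟩
      simp only [h2, Finset.sum_const, Finset.card_univ, nsmul_eq_mul]
      rw [Nat.card_eq_fintype_card]
    · intro j k hjk
      refine (Set.disjoint_image_iff hA).2 (Set.disjoint_left.2 fun x hx hx' => hjk ?_)
      exact Subtype.ext (hx.symm.trans hx')
  have hu := key Set.univ (PerMod.univ d)
  have hne : (Nat.card ((fun x => (Submodule.Quotient.mk x : Red X ϖ d)) '' Set.univ) : ℝ) =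
      residueCard O ^ (d * Module.finrank O X) := by
    rw [Set.image_univ, (Submodule.Quotient.mk_surjective _).range_eq, Nat.card_univ, card_red hϖ,
      Nat.cast_pow, residueCard_eq_cast]
  rw [hne, Set.image_univ] at hu
  rw [key S hS, hu, vol_eq_card_div hϖ hS]
  have := residueCard_pos O
  field_simp

/-- Volumes are invariant under linear isomorphisms. -/
theorem vol_preimage_equiv {X' : Type*} [AddCommGroup X'] [Module O X'] [Module.Finite O X']
    [Module.Free O X'] (e : X ≃ₗ[O] X') {d : ℕ} {S : Set X'} (hS : PerMod ϖ d S) :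
    vol O (e ⁻¹' S) = vol O S := by
  have h := vol_image hϖ (X := X') (X' := X) e.symm.toLinearMap e.symm.injective (c := 0)
    (fun y => ⟨e y, by simp⟩) hS
  have h2 : Set.range e.symm.toLinearMap = Set.univ := e.symm.surjective.range_eq
  rw [h2, vol_univ, mul_one] at h
  rw [← h]
  congr 1
  exact (LinearEquiv.image_symm_eq_preimage e S).symm

/-- Fubini's theorem for a periodic set whose nonempty fibres all have the same volume. -/
theorem vol_prod {X' : Type*} [AddCommGroup X'] [Module O X'] [Module.Finite O X']
    [Module.Free O X'] {d : ℕ} {S : Set (X × X')} (hS : PerMod ϖ d S) {T : Set X'}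
    (hT : PerMod ϖ d T) (hST : ∀ x, x ∈ S → x.2 ∈ T) {v : ℝ}
    (hv : ∀ y ∈ T, vol O {x | (x, y) ∈ S} = v) : vol O S = v * vol O T := by
  classical
  have := finite_red (X := X) hϖ d
  have := finite_red (X := X') hϖ d
  let f : X × X' →+ Red X ϖ d × Red X' ϖ d :=
    ((Submodule.mkQ (Ideal.span {ϖ ^ d} • (⊤ : Submodule O X))).prodMap
      (Submodule.mkQ (Ideal.span {ϖ ^ d} • (⊤ : Submodule O X')))).toAddMonoidHom
  have hf : Function.Surjective f := by
    rintro ⟨a, b⟩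
    obtain ⟨x, rfl⟩ := Submodule.Quotient.mk_surjective _ a
    obtain ⟨y, rfl⟩ := Submodule.Quotient.mk_surjective _ b
    exact ⟨(x, y), rfl⟩
  have hfd : ∀ x, f (ϖ ^ d • x) = 0 := fun x =>
    Prod.ext (red_mk_eq_zero.2 ⟨_, rfl⟩) (red_mk_eq_zero.2 ⟨_, rfl⟩)
  let B : Set (Red X ϖ d × Red X' ϖ d) := f '' S
  let B' : Set (Red X' ϖ d) := (fun x => (Submodule.Quotient.mk x : Red X' ϖ d)) '' T
  have hB : f ⁻¹' B = S := by
    ext x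
    constructor
    · rintro ⟨y, hy, hxy⟩
      obtain ⟨z, hz⟩ := red_mk_eq.1 (Prod.ext_iff.1 hxy).1.symm
      obtain ⟨z', hz'⟩ := red_mk_eq.1 (Prod.ext_iff.1 hxy).2.symm
      have : x = y + ϖ ^ d • (z, z') := Prod.ext hz hz'
      rw [this]
      exact hS y hy _
    · exact fun hx => ⟨x, hx, rfl⟩
  have hSv := vol_preimage hϖ f hf hfd B
  rw [hB, Nat.card_prod, card_red hϖ, card_red hϖ] at hSv
  have hfib : ∀ y ∈ T, (Nat.card {a : Red X ϖ d | (a, Submodule.Quotient.mk y) ∈ B} : ℝ) =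
      v * residueCard O ^ (d * Module.finrank O X) := by
    intro y hy
    have hp : PerMod ϖ d {x | (x, y) ∈ S} := by
      intro x hx z
      have := hS _ hx (z, 0)
      simpa using this
    have h := vol_eq_card_div hϖ hp
    rw [hv y hy] at h
    rw [h, div_mul_cancel₀ _ (pow_ne_zero _ (residueCard_pos O).ne')]
    suffices h : {a : Red X ϖ d | (a, Submodule.Quotient.mk y) ∈ B} =
        (fun x => (Submodule.Quotient.mk x : Red X ϖ d)) '' {x | (x, y) ∈ S} by rw [h]
    ext a
    obtain ⟨x, rfl⟩ := Submodule.Quotient.mk_surjective _ a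
    constructor
    · intro hx
      refine ⟨x, ?_, rfl⟩
      change (x, y) ∈ S
      rw [← hB]
      exact hx
    · rintro ⟨x', hx', h⟩
      have h' : (Submodule.Quotient.mk x' : Red X ϖ d) = Submodule.Quotient.mk x := h
      rw [← h']
      exact ⟨(x', y), hx', rfl⟩
  have := Fintype.ofFinite (Red X ϖ d)
  have := Fintype.ofFinite (Red X' ϖ d)
  have hcard : (Nat.card B : ℝ) = Nat.card B' * (v * residueCard O ^ (d * Module.finrank O X)) := by
    have e : B ≃ Σ b : B', {a : Red X ϖ d | (a, (b : Red X' ϖ d)) ∈ B} :=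
      { toFun := fun x => ⟨⟨x.1.2, by
          obtain ⟨x, y, hy, rfl⟩ := x
          exact ⟨y.2, hST y hy, rfl⟩⟩, ⟨x.1.1, x.2⟩⟩
        invFun := fun x => ⟨(x.2.1, x.1.1), x.2.2⟩
        left_inv := fun x => rfl
        right_inv := fun x => rfl }
    rw [Nat.card_congr e, Nat.card_sigma, Nat.cast_sum]
    have : ∀ b : B', (Nat.card {a : Red X ϖ d | (a, (b : Red X' ϖ d)) ∈ B} : ℝ) =
        v * residueCard O ^ (d * Module.finrank O X) := by
      rintro ⟨_, y, hy, rfl⟩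
      exact hfib y hy
    simp only [this, Finset.sum_const, Finset.card_univ, nsmul_eq_mul]
    rw [Nat.card_eq_fintype_card]
  rw [hSv, hcard, vol_eq_card_div hϖ hT]
  simp only [Nat.cast_mul, Nat.cast_pow, ← residueCard_eq_cast]
  have := residueCard_pos O
  field_simp
  exact mul_comm _ _

end Volume


/-! ### Quadratic forms on free modules -/

section Forms

variable {R : Type*} [CommRing R] {L : Type*} [AddCommGroup L] [Module R L]
  {N : Type*} [AddCommGroup N] [Module R N]

/-- The upper triangular coefficients of a quadratic map with respect to an ordered basis. -/
def formCoeff {n : ℕ} (b : Fin n → L) :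
    QuadraticMap R L N →ₗ[R] ({p : Fin n × Fin n // p.1 ≤ p.2} → N) where
  toFun Q p := if p.1.1 = p.1.2 then Q (b p.1.1) else QuadraticMap.polar Q (b p.1.1) (b p.1.2)
  map_add' Q Q' := by
    funext p
    by_cases h : p.1.1 = p.1.2 <;> simp [h, QuadraticMap.polar_add]
  map_smul' a Q := by
    funext p
    by_cases h : p.1.1 = p.1.2 <;> simp [h, QuadraticMap.polar_smul]

theorem formCoeff_bijective {n : ℕ} (b : Module.Basis (Fin n) R L) :
    Function.Bijective (formCoeff (R := R) (N := N) b) := by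
  constructor
  · rw [← LinearMap.ker_eq_bot, LinearMap.ker_eq_bot']
    intro Q hQ
    have hz : Q.toBilin b = 0 := by
      refine b.ext fun i => b.ext fun j => ?_
      rw [QuadraticMap.toBilin_apply, LinearMap.zero_apply, LinearMap.zero_apply]
      rcases lt_trichotomy i j with h | rfl | h
      · have := congrFun hQ ⟨(i, j), h.le⟩
        simpa [formCoeff, h.ne, h] using this
      · have := congrFun hQ ⟨(i, i), le_rfl⟩
        simpa [formCoeff] using this
      · simp [h.ne', h.not_gt]
    rw [← Q.toQuadraticMap_toBilin b, hz, LinearMap.BilinMap.toQuadraticMap_zero]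
  · intro r
    let β : LinearMap.BilinMap R L N :=
      b.constr R fun i => b.constr R fun j => if h : i ≤ j then r ⟨(i, j), h⟩ else 0
    have hβ : ∀ i j, β (b i) (b j) = if h : i ≤ j then r ⟨(i, j), h⟩ else 0 := by
      intro i j
      simp only [β, Module.Basis.constr_basis]
    refine ⟨β.toQuadraticMap, funext fun ⟨⟨i, j⟩, hij⟩ => ?_⟩
    change (if i = j then _ else _) = _
    split_ifs with h
    · subst h
      rw [LinearMap.BilinMap.toQuadraticMap_apply, hβ, dif_pos hij]
    · change QuadraticMap.polar β.toQuadraticMap (b i) (b j) = _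
      rw [LinearMap.BilinMap.polar_toQuadraticMap, hβ, hβ, dif_pos hij,
        dif_neg (not_le.2 (lt_of_le_of_ne hij h)), add_zero]

/-- A quadratic map on a free module with ordered basis is given by its upper triangular
coefficients. -/
def formEquiv {n : ℕ} (b : Module.Basis (Fin n) R L) :
    QuadraticMap R L N ≃ₗ[R] ({p : Fin n × Fin n // p.1 ≤ p.2} → N) :=
  LinearEquiv.ofBijective (formCoeff b) (formCoeff_bijective b)

theorem formEquiv_apply {n : ℕ} (b : Module.Basis (Fin n) R L) (Q : QuadraticMap R L N) (p) :
    formEquiv b Q p =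
      if p.1.1 = p.1.2 then Q (b p.1.1) else QuadraticMap.polar Q (b p.1.1) (b p.1.2) := rfl

theorem card_upper_triangular (n : ℕ) :
    Fintype.card {p : Fin n × Fin n // p.1 ≤ p.2} = (n + 1).choose 2 := by
  rw [← Fintype.card_congr (Sym2.sortEquiv (α := Fin n)), Sym2.card, Fintype.card_fin]

variable [Module.Free R L] [Module.Finite R L] [Nontrivial R]

instance : Module.Free R (QuadraticForm R L) :=
  Module.Free.of_equiv (formEquiv (N := R) (Module.finBasis R L)).symm

instance : Module.Finite R (QuadraticForm R L) :=
  Module.Finite.equiv (formEquiv (N := R) (Module.finBasis R L)).symm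

theorem finrank_form :
    Module.finrank R (QuadraticForm R L) = (Module.finrank R L + 1).choose 2 := by
  rw [(formEquiv (N := R) (Module.finBasis R L)).finrank_eq, Module.finrank_fintype_fun_eq_card,
    card_upper_triangular]

end Forms

/-! ### Representations modulo powers of the uniformizer -/

section Rep

variable {O : Type*} [CommRing O] {F : Type*} [Field F] [Algebra O F]
  {H : Type*} [AddCommGroup H] [Module O H] {L : Type*} [AddCommGroup L] [Module O L]

/-- The linear maps `L → H` that preserve the quadratic forms modulo `ϖ ^ d`. -/
def repSet (ϖ : O) (qH : QuadraticForm O H) (qL : QuadraticMap O L F) (d : ℕ) : Set (L →ₗ[O] H) :=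
  {φ | ∀ x, ∃ a : O, algebraMap O F (qH (φ x)) - qL x = algebraMap O F (ϖ ^ d * a)}

/-- A form with values in `O`, as a form with values in the fraction field. -/
def toF (F : Type*) [Field F] [Algebra O F] (R : QuadraticForm O L) : QuadraticMap O L F :=
  (Algebra.linearMap O F).compQuadraticMap R

@[simp]
theorem toF_apply (R : QuadraticForm O L) (x : L) : toF F R x = algebraMap O F (R x) := rfl

theorem toF_add (R S : QuadraticForm O L) : toF F (R + S) = toF F R + toF F S := by
  ext x; simp

theorem toF_neg (R : QuadraticForm O L) : toF F (-R) = -toF F R := by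
  ext x; simp

theorem toF_smul (a : O) (R : QuadraticForm O L) : toF F (a • R) = a • toF F R := by
  ext x; simp [Algebra.smul_def]

theorem polar_toF (R : QuadraticForm O L) (x y : L) :
    QuadraticMap.polar (toF F R) x y = algebraMap O F (QuadraticMap.polar R x y) := by
  simp [QuadraticMap.polar]

variable [FaithfulSMul O F]

theorem toF_injective : Function.Injective (toF F : QuadraticForm O L → QuadraticMap O L F) := by
  intro R S h
  ext x
  have := congrArg (fun Q : QuadraticMap O L F => Q x) h
  exact FaithfulSMul.algebraMap_injective O F this

/-- A quadratic map with integral values comes from an integral form. -/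
theorem exists_toF_eq (Q : QuadraticMap O L F) (h : ∀ x, ∃ a : O, Q x = algebraMap O F a) :
    ∃ R : QuadraticForm O L, toF F R = Q := by
  have hinj := FaithfulSMul.algebraMap_injective O F
  choose f hf using h
  have hp : ∀ x y, algebraMap O F (QuadraticMap.polar f x y) = QuadraticMap.polar Q x y := by
    intro x y
    simp [QuadraticMap.polar, hf]
  refine ⟨QuadraticMap.ofPolar f ?_ ?_ ?_, ?_⟩
  · intro a x
    apply hinj
    rw [← hf, QuadraticMap.map_smul, hf, smul_eq_mul, map_mul, Algebra.smul_def]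
  · intro x x' y
    apply hinj
    rw [map_add, hp, hp, hp, QuadraticMap.polar_add_left]
  · intro a x y
    apply hinj
    rw [hp, QuadraticMap.polar_smul_left, smul_eq_mul, map_mul, hp, Algebra.smul_def]
  · ext x
    exact (hf x).symm

variable [IsDomain O]

/-- A quadratic map with values in `ϖ ^ d O` is `ϖ ^ d` times an integral form. -/
theorem exists_toF_eq_smul {ϖ : O} (Q : QuadraticMap O L F) (d : ℕ)
    (h : ∀ x, ∃ a : O, Q x = algebraMap O F (ϖ ^ d * a)) :
    ∃ R : QuadraticForm O L, toF F (ϖ ^ d • R) = Q := by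
  have hinj := FaithfulSMul.algebraMap_injective O F
  by_cases hd : ϖ ^ d = 0
  · refine ⟨0, ?_⟩
    ext x
    obtain ⟨a, ha⟩ := h x
    simp [ha, hd]
  have hd' : algebraMap O F (ϖ ^ d) ≠ 0 := fun h0 => hd (hinj (by rw [h0, map_zero]))
  obtain ⟨R, hR⟩ := exists_toF_eq ((algebraMap O F (ϖ ^ d))⁻¹ • Q) (fun x => by
    obtain ⟨a, ha⟩ := h x
    refine ⟨a, ?_⟩
    rw [smul_apply, ha, map_mul, smul_eq_mul, inv_mul_cancel_left₀ hd'])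
  refine ⟨R, ?_⟩
  ext x
  rw [toF_smul, hR, smul_apply, smul_apply, Algebra.smul_def, smul_eq_mul,
    mul_inv_cancel_left₀ hd']

theorem mem_repSet_iff {ϖ : O} {qH : QuadraticForm O H} {qL : QuadraticMap O L F} {d : ℕ}
    {φ : L →ₗ[O] H} : φ ∈ repSet ϖ qH qL d ↔
      ∃ R : QuadraticForm O L, toF F (qH.comp φ) = qL + toF F (ϖ ^ d • R) := by
  constructor
  · intro h
    obtain ⟨R, hR⟩ := exists_toF_eq_smul (toF F (qH.comp φ) - qL) d h
    exact ⟨R, by rw [hR]; abel⟩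
  · rintro ⟨R, hR⟩ x
    refine ⟨R x, ?_⟩
    have := congrArg (fun Q : QuadraticMap O L F => Q x) hR
    simp only [toF_apply, QuadraticMap.comp_apply, add_apply, smul_apply,
      smul_eq_mul] at this
    rw [this]
    ring

theorem map_add_smul_form (qH : QuadraticForm O H) (x y : H) (a : O) :
    qH (x + a • y) = qH x + a * (a * qH y + QuadraticMap.polar qH x y) := by
  rw [QuadraticMap.map_add qH, QuadraticMap.map_smul, QuadraticMap.polar_smul_right, smul_eq_mul,
    smul_eq_mul]
  ring

theorem perMod_repSet (ϖ : O) (qH : QuadraticForm O H) (qL : QuadraticMap O L F) (d : ℕ) :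
    PerMod ϖ d (repSet ϖ qH qL d) := by
  intro φ hφ ψ x
  obtain ⟨a, ha⟩ := hφ x
  refine ⟨a + (ϖ ^ d * qH (ψ x) + QuadraticMap.polar qH (φ x) (ψ x)), ?_⟩
  rw [LinearMap.add_apply, LinearMap.smul_apply, map_add_smul_form, map_add, add_sub_right_comm, ha,
    ← map_add]
  congr 1
  ring

theorem repSet_anti {ϖ : O} {qH : QuadraticForm O H} {qL : QuadraticMap O L F} {d e : ℕ}
    (h : d ≤ e) : repSet ϖ qH qL e ⊆ repSet ϖ qH qL d := by
  intro φ hφ x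
  obtain ⟨a, ha⟩ := hφ x
  obtain ⟨k, rfl⟩ := Nat.exists_eq_add_of_le h
  exact ⟨ϖ ^ k * a, by rw [ha, pow_add, mul_assoc]⟩

theorem repSet_add_smul {ϖ : O} {qH : QuadraticForm O H} {qL : QuadraticMap O L F} {d e : ℕ}
    (h : d ≤ e) (R : QuadraticForm O L) :
    repSet ϖ qH (qL + toF F (ϖ ^ e • R)) d = repSet ϖ qH qL d := by
  obtain ⟨k, rfl⟩ := Nat.exists_eq_add_of_le h
  ext φ
  rw [mem_repSet_iff, mem_repSet_iff]
  constructor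
  · rintro ⟨S, hS⟩
    exact ⟨S + ϖ ^ k • R, by rw [hS, smul_add, smul_smul, ← pow_add, add_assoc, ← toF_add,
      add_comm (ϖ ^ d • S)]⟩
  · rintro ⟨S, hS⟩
    exact ⟨S - ϖ ^ k • R, by rw [hS, smul_sub, smul_smul, ← pow_add, add_assoc, ← toF_add,
      add_sub_cancel]⟩

variable [IsDiscreteValuationRing O] [Finite (IsLocalRing.ResidueField O)]
  [TopologicalSpace O] [IsTopologicalRing O] [CompactSpace O] [T2Space O]
  [Module.Finite O L] [Module.Free O L] [Module.Finite O H] [Module.Free O H]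

theorem card_rep {ϖ : O} (hϖ : Irreducible ϖ) (qH : QuadraticForm O H) (qL : QuadraticMap O L F)
    (d : ℕ) : (Nat.card (rep ϖ qH qL d) : ℝ) = vol O (repSet ϖ qH qL d) *
      residueCard O ^ (d * (Module.finrank O H * Module.finrank O L)) := by
  let f : (L →ₗ[O] H) →+ (L →ₗ[O] Red H ϖ d) :=
    (LinearMap.compRight O (Submodule.mkQ (Ideal.span {ϖ ^ d} • (⊤ : Submodule O H)))).toAddMonoidHom
  have hf : Function.Surjective f := by
    intro g
    obtain ⟨φ, hφ⟩ := Module.projective_lifting_property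
      (Submodule.mkQ (Ideal.span {ϖ ^ d} • (⊤ : Submodule O H))) g (Submodule.mkQ_surjective _)
    exact ⟨φ, hφ⟩
  have hfd : ∀ φ, f (ϖ ^ d • φ) = 0 := fun φ => LinearMap.ext fun x => red_mk_eq_zero.2 ⟨φ x, rfl⟩
  have := finite_red (X := H) hϖ d
  let b := Module.finBasis O L
  have e : (L →ₗ[O] Red H ϖ d) ≃ (Fin (Module.finrank O L) → Red H ϖ d) :=
    (b.constr (S := O)).toEquiv.symm
  have : Finite (L →ₗ[O] Red H ϖ d) := Finite.of_equiv _ e.symm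
  have hcard : Nat.card (L →ₗ[O] Red H ϖ d) =
      residueNat O ^ (d * (Module.finrank O H * Module.finrank O L)) := by
    rw [Nat.card_congr e, Nat.card_fun, card_red hϖ, Nat.card_fin, ← pow_mul, mul_assoc]
  have h := vol_preimage hϖ f hf hfd (rep ϖ qH qL d)
  have hpre : f ⁻¹' (rep ϖ qH qL d) = repSet ϖ qH qL d := by
    ext φ
    constructor
    · intro hφ x
      exact hφ x (φ x) rfl
    · intro hφ x y hy
      obtain ⟨z, rfl⟩ := red_mk_eq.1 (show (Submodule.Quotient.mk y : Red H ϖ d) =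
        Submodule.Quotient.mk (φ x) from hy)
      obtain ⟨a, ha⟩ := hφ x
      refine ⟨a + (ϖ ^ d * qH z + QuadraticMap.polar qH (φ x) z), ?_⟩
      rw [map_add_smul_form, map_add, add_sub_right_comm, ha, ← map_add]
      congr 1
      ring
  rw [hpre, hcard, Nat.cast_pow, ← residueCard_eq_cast] at h
  rw [h, div_mul_cancel₀ _ (pow_ne_zero _ (residueCard_pos O).ne')]

end Rep

/-! ### Hensel's lemma for representations -/

section Hensel

variable {O : Type*} [CommRing O] [IsDomain O] [IsDiscreteValuationRing O]
  [Finite (IsLocalRing.ResidueField O)]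
  [TopologicalSpace O] [IsTopologicalRing O] [CompactSpace O] [T2Space O]
  {F : Type*} [Field F] [Algebra O F] [FaithfulSMul O F]
  {H : Type*} [AddCommGroup H] [Module O H] [Module.Finite O H] [Module.Free O H]
  {L : Type*} [AddCommGroup L] [Module O L] [Module.Finite O L] [Module.Free O L]

/-- If `φ` has a left inverse up to `a` and the form on `H` is self-dual, then the derivative of
`φ ↦ qH ∘ φ` at `φ` reaches `a` times every quadratic form. -/
theorem exists_polar_eq {qH : QuadraticForm O H} (hH : IsSelfDual qH) {φ : L →ₗ[O] H} {a : O}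
    {ρ : H →ₗ[O] L} (hρ : ∀ x, ρ (φ x) = a • x) (R : QuadraticForm O L) :
    ∃ ψ : L →ₗ[O] H, ∀ x, QuadraticMap.polar qH (φ x) (ψ x) = a * R x := by
  obtain ⟨β, rfl⟩ := LinearMap.BilinMap.toQuadraticMap_surjective R
  let e : H ≃ₗ[O] (H →ₗ[O] O) := LinearEquiv.ofBijective (QuadraticMap.polarBilin qH) hH
  refine ⟨e.symm.toLinearMap ∘ₗ (β.comp ρ).flip, fun x => ?_⟩
  have h : e (e.symm ((β.comp ρ).flip x)) (φ x) = (β.comp ρ).flip x (φ x) := by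
    rw [LinearEquiv.apply_symm_apply]
  rw [LinearMap.flip_apply, LinearMap.comp_apply, hρ, map_smul, LinearMap.smul_apply,
    smul_eq_mul] at h
  rw [QuadraticMap.polar_comm, LinearMap.BilinMap.toQuadraticMap_apply, ← h]
  rfl

variable {ϖ : O} (hϖ : Irreducible ϖ) {qH : QuadraticForm O H} (hH : IsSelfDual qH)

include hϖ hH

/-- Half of the comparison of the fibres of `φ ↦ qH ∘ φ` over congruent forms: a solution of the
linearized equation, given by `exists_polar_eq`, is a translation that carries one fibre into the
other. -/
theorem vol_inter_repSet_le {D : Set (L →ₗ[O] H)} {e c : ℕ} (hD : PerMod ϖ e D)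
    (hgood : ∀ φ ∈ D, ∃ ρ : H →ₗ[O] L, ∀ x, ρ (φ x) = ϖ ^ c • x) {d : ℕ} (h1 : 2 * c + 1 ≤ d)
    (h2 : c + e ≤ d) (Q : QuadraticMap O L F) (R : QuadraticForm O L) :
    vol O (D ∩ repSet ϖ qH Q (d + 1)) ≤ vol O (D ∩ repSet ϖ qH (Q + toF F (ϖ ^ d • R)) (d + 1)) := by
  classical
  obtain ⟨g, hg⟩ : ∃ g, g = max (c + 1) e := ⟨_, rfl⟩
  have hgc : c + 1 ≤ g := hg ▸ le_max_left _ _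
  have hge : e ≤ g := hg ▸ le_max_right _ _
  have hgd : c + g ≤ d := by
    rcases max_choice (c + 1) e with h | h <;> rw [hg, h] <;> omega
  have := finite_red (X := L →ₗ[O] H) hϖ g
  have := Fintype.ofFinite (Red (L →ₗ[O] H) ϖ g)
  let f : (L →ₗ[O] H) → Red (L →ₗ[O] H) ϖ g := Submodule.Quotient.mk
  have hf : ∀ x y, f (x + ϖ ^ g • y) = f x := fun x y => red_mk_eq.2 ⟨y, rfl⟩
  have hed : e ≤ d + 1 := by omega
  have hper : ∀ Q' : QuadraticMap O L F, PerMod ϖ (d + 1) (D ∩ repSet ϖ qH Q' (d + 1)) :=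
    fun Q' => (hD.mono hed).inter (perMod_repSet _ _ _ _)
  rw [vol_eq_sum_fiber hϖ f hf (hper Q), vol_eq_sum_fiber hϖ f hf (hper _)]
  refine Finset.sum_le_sum fun y _ => ?_
  rcases (D ∩ repSet ϖ qH Q (d + 1) ∩ f ⁻¹' {y}).eq_empty_or_nonempty with h0 | ⟨φ₀, hφ₀, hy⟩
  · rw [h0, vol_empty]
    exact vol_nonneg O _
  obtain ⟨ρ, hρ⟩ := hgood φ₀ hφ₀.1
  obtain ⟨ψ, hψ⟩ := exists_polar_eq hH hρ R
  obtain ⟨k, rfl⟩ := Nat.exists_eq_add_of_le hgd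
  obtain ⟨l, rfl⟩ := Nat.exists_eq_add_of_le hge
  obtain ⟨j, hj⟩ := Nat.exists_eq_add_of_le hgc
  -- translation by `ϖ ^ (d - c) ψ` carries the first set into the second
  refine (vol_mono O ?_).trans (vol_translate O _ (ϖ ^ (e + l + k) • ψ)).le
  rintro φ ⟨⟨hφD, hφ⟩, hφy⟩
  obtain ⟨ζ, hζ⟩ := red_mk_eq.1 (show (Submodule.Quotient.mk φ : Red (L →ₗ[O] H) ϖ (e + l)) =
    Submodule.Quotient.mk φ₀ from hφy.trans hy.symm)
  refine ⟨⟨?_, ?_⟩, ?_⟩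
  · change ϖ ^ (e + l + k) • ψ + φ ∈ D
    rw [add_comm, add_assoc e, pow_add, mul_smul]
    exact hD φ hφD _
  · intro x
    obtain ⟨a, ha⟩ := hφ x
    have hpol : QuadraticMap.polar qH (φ x) (ψ x) =
        ϖ ^ c * R x + ϖ ^ (e + l) * QuadraticMap.polar qH (ζ x) (ψ x) := by
      rw [hζ, LinearMap.add_apply, LinearMap.smul_apply, QuadraticMap.polar_add_left, hψ,
        QuadraticMap.polar_smul_left, smul_eq_mul]
    refine ⟨a + ϖ ^ j * QuadraticMap.polar qH (ζ x) (ψ x) +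
      ϖ ^ j * ϖ ^ k * qH (ψ x), ?_⟩
    rw [LinearMap.add_apply, LinearMap.smul_apply, add_comm, map_add_smul_form, hpol,
      add_apply, toF_apply, smul_apply, map_add, add_sub_add_comm, ha,
      ← map_sub, ← map_add]
    congr 1
    rw [hj, smul_eq_mul]
    ring
  · change f (ϖ ^ (e + l + k) • ψ + φ) = y
    have h3 : ϖ ^ (e + l + k) • ψ + φ = φ + ϖ ^ (e + l) • ϖ ^ k • ψ := by
      rw [add_comm, pow_add, mul_smul]
    rw [h3, hf]
    exact hφy

/-- The fibres of `φ ↦ qH ∘ φ` modulo `ϖ ^ d` have locally constant volume in the smooth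
locus. -/
theorem vol_inter_repSet_eq {D : Set (L →ₗ[O] H)} {e c : ℕ} (hD : PerMod ϖ e D)
    (hgood : ∀ φ ∈ D, ∃ ρ : H →ₗ[O] L, ∀ x, ρ (φ x) = ϖ ^ c • x) {d : ℕ} (h1 : 2 * c + 1 ≤ d)
    (h2 : c + e ≤ d) (Q : QuadraticMap O L F) :
    vol O (D ∩ repSet ϖ qH Q d) = residueCard O ^ (Module.finrank O L + 1).choose 2 *
      vol O (D ∩ repSet ϖ qH Q (d + 1)) := by
  classical
  have heq : ∀ R : QuadraticForm O L, vol O (D ∩ repSet ϖ qH (Q + toF F (ϖ ^ d • R)) (d + 1)) =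
      vol O (D ∩ repSet ϖ qH Q (d + 1)) := by
    intro R
    refine le_antisymm ?_ (vol_inter_repSet_le hϖ hH hD hgood h1 h2 Q R)
    have := vol_inter_repSet_le hϖ hH hD hgood h1 h2 (Q + toF F (ϖ ^ d • R)) (-R)
    rwa [smul_neg, toF_neg, add_neg_cancel_right] at this
  have := finite_red (X := QuadraticForm O L) hϖ 1
  have := Fintype.ofFinite (Red (QuadraticForm O L) ϖ 1)
  let s : Red (QuadraticForm O L) ϖ 1 → QuadraticForm O L := fun y => Quotient.out y
  have hs : ∀ y, (Submodule.Quotient.mk (s y) : Red (QuadraticForm O L) ϖ 1) = y :=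
    fun y => Quotient.out_eq y
  have hun : D ∩ repSet ϖ qH Q d =
      ⋃ y, D ∩ repSet ϖ qH (Q + toF F (ϖ ^ d • s y)) (d + 1) := by
    ext φ
    simp only [Set.mem_inter_iff, Set.mem_iUnion]
    constructor
    · rintro ⟨hφD, hφ⟩
      obtain ⟨R, hR⟩ := mem_repSet_iff.1 hφ
      refine ⟨Submodule.Quotient.mk R, hφD, mem_repSet_iff.2 ?_⟩
      obtain ⟨T, hT⟩ := red_mk_eq.1 (hs (Submodule.Quotient.mk R)).symm
      refine ⟨T, ?_⟩
      rw [hR, add_assoc, ← toF_add]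
      conv_lhs => rw [hT]
      rw [smul_add, smul_smul, ← pow_add]
    · rintro ⟨y, hφD, hφ⟩
      have h3 := repSet_anti (Nat.le_succ d) hφ
      rw [repSet_add_smul le_rfl] at h3
      exact ⟨hφD, h3⟩
  rw [hun, vol_iUnion hϖ _ ?_ (fun _ => d + 1)]
  · simp only [heq, Finset.sum_const, Finset.card_univ, nsmul_eq_mul]
    rw [← Nat.card_eq_fintype_card, card_red hϖ, finrank_form, one_mul, Nat.cast_pow,
      residueCard_eq_cast]
  · intro y
    exact (hD.mono (by omega)).inter (perMod_repSet _ _ _ _)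
  · intro y z hyz
    refine Set.disjoint_left.2 fun φ hφ hφ' => hyz ?_
    obtain ⟨S, hS⟩ := mem_repSet_iff.1 hφ.2
    obtain ⟨T, hT⟩ := mem_repSet_iff.1 hφ'.2
    rw [← hs y, ← hs z]
    refine red_mk_eq.2 ⟨T - S, ?_⟩
    rw [hS, add_assoc, add_assoc, add_right_inj, ← toF_add, ← toF_add] at hT
    have h4 := toF_injective hT
    ext x
    have h5 := congrArg (fun Q : QuadraticForm O L => Q x) h4
    simp only [add_apply, smul_apply, smul_eq_mul,
      sub_apply, pow_one] at h5 ⊢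
    apply mul_left_cancel₀ (pow_ne_zero d hϖ.ne_zero)
    linear_combination h5

end Hensel


/-! ### Existence of local densities -/

section Divisibility

variable {O : Type*} [CommRing O] [IsDomain O] [IsDiscreteValuationRing O] {ϖ : O}
  (hϖ : Irreducible ϖ)
  {H : Type*} [AddCommGroup H] [Module O H] [Module.Finite O H] [Module.Free O H]
  {L : Type*} [AddCommGroup L] [Module O L] [Module.Finite O L] [Module.Free O L]

include hϖ

theorem eq_zero_of_forall_pow_dvd {a : O} (h : ∀ d : ℕ, ϖ ^ d ∣ a) : a = 0 := by
  by_contra ha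
  obtain ⟨n, hn⟩ := FiniteMultiplicity.of_prime_left hϖ.prime ha
  exact hn (h _)

/-- A linear map that carries no primitive vector into `ϖ ^ (c + 1) H` has a left inverse up to
`ϖ ^ c`. -/
theorem exists_leftInverse_up_to {φ : L →ₗ[O] H} {c : ℕ}
    (h : ∀ x, (∃ y, φ x = ϖ ^ (c + 1) • y) → ∃ z, x = ϖ • z) :
    ∃ ρ : H →ₗ[O] L, ∀ x, ρ (φ x) = ϖ ^ c • x := by
  classical
  have hinj : Function.Injective φ := by
    rw [← LinearMap.ker_eq_bot]
    refine Submodule.eq_bot_of_le_smul_of_le_jacobson_bot (IsLocalRing.maximalIdeal O) _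
      (IsNoetherian.noetherian _) ?_ (IsLocalRing.maximalIdeal_le_jacobson _)
    intro x hx
    obtain ⟨z, rfl⟩ := h x ⟨0, by rw [LinearMap.mem_ker.1 hx, smul_zero]⟩
    refine Submodule.smul_mem_smul ((IsLocalRing.mem_maximalIdeal _).2 hϖ.not_isUnit) ?_
    rw [LinearMap.mem_ker, map_smul] at hx
    exact LinearMap.mem_ker.2 ((smul_eq_zero_iff_right hϖ.ne_zero).1 hx)
  obtain ⟨n, bM, bN, f, a, snf⟩ :=
    Submodule.smithNormalForm (Module.finBasis O H) (LinearMap.range φ)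
  choose y hy using fun i => LinearMap.mem_range.1 (bN i).2
  have hspan : ∀ x, x = ∑ i, bN.repr ⟨φ x, LinearMap.mem_range_self φ x⟩ i • y i := by
    intro x
    apply hinj
    have h1 := congrArg (LinearMap.range φ).subtype
      (bN.sum_repr ⟨φ x, LinearMap.mem_range_self φ x⟩)
    rw [map_sum] at h1
    rw [map_sum]
    simp only [map_smul, hy]
    exact h1.symm
  have ha : ∀ i, ∃ b, ϖ ^ c = b * a i := by
    intro i
    have hnd : ¬ ϖ ^ (c + 1) ∣ a i := by
      rintro ⟨t, ht⟩
      obtain ⟨z, hz⟩ := h (y i) ⟨t • bM (f i), by rw [hy, snf, ht, mul_smul]⟩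
      have h1 : bN i = ϖ • (⟨φ z, LinearMap.mem_range_self φ z⟩ : LinearMap.range φ) := by
        apply Subtype.ext
        rw [← hy, hz, map_smul]
        rfl
      have h2 := congrArg (fun w => bN.repr w i) h1
      simp only [Module.Basis.repr_self, Finsupp.single_eq_same, map_smul, Finsupp.smul_apply,
        smul_eq_mul] at h2
      exact hϖ.not_isUnit (IsUnit.of_mul_eq_one _ h2.symm)
    rcases ValuationRing.dvd_total (ϖ ^ (c + 1)) (a i) with h1 | h1
    · exact absurd h1 hnd
    · obtain ⟨k, hk, hak⟩ := (dvd_prime_pow hϖ.prime (c + 1)).1 h1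
      have hkc : k ≤ c := by
        by_contra hkc
        have : k = c + 1 := by omega
        subst this
        exact hnd hak.symm.dvd
      obtain ⟨b, hb⟩ := hak.dvd.trans (pow_dvd_pow ϖ hkc)
      exact ⟨b, by rw [hb, mul_comm]⟩
  choose b hb using ha
  let ρ : H →ₗ[O] L := bM.constr O fun j => if hj : ∃ i, f i = j then b hj.choose • y hj.choose else 0
  have hρ : ∀ i, ρ (bM (f i)) = b i • y i := by
    intro i
    simp only [ρ, Module.Basis.constr_basis]
    have hj : ∃ i', f i' = f i := ⟨i, rfl⟩
    rw [dif_pos hj, f.injective hj.choose_spec]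
  refine ⟨ρ, fun x => ?_⟩
  have hy' : ∀ i, ρ (φ (y i)) = ϖ ^ c • y i := by
    intro i
    rw [hy, snf, map_smul, hρ, smul_smul, mul_comm, ← hb]
  rw [hspan x]
  simp only [map_sum, map_smul, hy', Finset.smul_sum]
  exact Finset.sum_congr rfl fun i _ => smul_comm _ _ _

end Divisibility

section Density

variable {O : Type*} [CommRing O] [IsDomain O] [IsDiscreteValuationRing O]
  [Finite (IsLocalRing.ResidueField O)]
  [TopologicalSpace O] [IsTopologicalRing O] [CompactSpace O] [T2Space O]
  {F : Type*} [Field F] [Algebra O F]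
  {H : Type*} [AddCommGroup H] [Module O H] [Module.Finite O H] [Module.Free O H]
  {L : Type*} [AddCommGroup L] [Module O L] [Module.Finite O L] [Module.Free O L]

/-- A decreasing sequence of nonempty periodic sets has a common element. -/
theorem nonempty_iInter_of_perMod {ϖ : O} (hϖ : Irreducible ϖ) (S : ℕ → Set L) (k : ℕ → ℕ)
    (hS : ∀ d, PerMod ϖ (k d) (S d)) (hanti : ∀ d, S (d + 1) ⊆ S d) (hne : ∀ d, (S d).Nonempty) :
    (⋂ d, S d).Nonempty := by
  let := moduleTopology O L
  have := compactSpace_moduleTopology O L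
  have hcl : ∀ d, IsClosed (S d) := fun d => ⟨(hS d).compl.isOpen hϖ⟩
  exact IsCompact.nonempty_iInter_of_sequence_nonempty_isCompact_isClosed S hanti hne
    (hcl 0).isCompact hcl

/-- A quadratic map is nonsingular over the fraction field if no nonzero vector of the kernel of its
bilinear form is isotropic. In characteristic two this is weaker than nondegeneracy of the bilinear
form. -/
def IsNonsingular (Q : QuadraticMap O L F) : Prop :=
  ∀ x, (∀ y, QuadraticMap.polar Q x y = 0) → Q x = 0 → x = 0

variable [IsFractionRing O F]

/-- Every quadratic map becomes integral after multiplication by a power of `ϖ`. -/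
theorem exists_smul_eq_toF {ϖ : O} (hϖ : Irreducible ϖ) (Q : QuadraticMap O L F) :
    ∃ (e : ℕ) (R : QuadraticForm O L), toF F R = ϖ ^ e • Q := by
  let b := Module.finBasis O L
  obtain ⟨⟨a, ha⟩, hint⟩ := IsLocalization.exist_integer_multiples_of_finite (nonZeroDivisors O)
    (formEquiv b Q)
  have ha0 : a ≠ 0 := nonZeroDivisors.ne_zero ha
  obtain ⟨e, u, rfl⟩ := IsDiscreteValuationRing.eq_unit_mul_pow_irreducible ha0 hϖ
  choose r hr using hint
  refine ⟨e, (formEquiv b).symm fun p => (↑u⁻¹ : O) * r p, ?_⟩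
  apply (formEquiv b).injective
  funext p
  have h1 : formEquiv b (toF F ((formEquiv b).symm fun p => (↑u⁻¹ : O) * r p)) p =
      algebraMap O F ((↑u⁻¹ : O) * r p) := by
    have h2 := congrFun ((formEquiv b).apply_symm_apply fun p => (↑u⁻¹ : O) * r p) p
    rw [formEquiv_apply] at h2 ⊢
    rw [← h2]
    split_ifs
    · rfl
    · rw [polar_toF]
  rw [h1, map_mul, hr, map_smul, Pi.smul_apply, Algebra.smul_def, Algebra.smul_def, ← mul_assoc,
    ← map_mul]
  congr 2
  change (↑u⁻¹ : O) * (↑u * ϖ ^ e) = ϖ ^ e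
  rw [Units.inv_mul_cancel_left]

/-- For a nonsingular form, primitive vectors are not nearly in the singular part of the kernel. -/
theorem IsNonsingular.exists_bound {ϖ : O} (hϖ : Irreducible ϖ) {Q : QuadraticMap O L F}
    (hQ : IsNonsingular Q) : ∃ c : ℕ, ∀ x,
      (∀ y, ∃ a : O, QuadraticMap.polar Q x y = algebraMap O F (ϖ ^ c * a)) →
      (∃ a : O, Q x = algebraMap O F (ϖ ^ c * a)) → ∃ z, x = ϖ • z := by
  obtain ⟨e, R, hR⟩ := exists_smul_eq_toF hϖ Q
  have hinj := FaithfulSMul.algebraMap_injective O F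
  have hR1 : ∀ x, algebraMap O F (R x) = algebraMap O F (ϖ ^ e) * Q x := fun x => by
    rw [← toF_apply (F := F), hR, smul_apply, Algebra.smul_def]
  have hR2 : ∀ x y, algebraMap O F (QuadraticMap.polar R x y) =
      algebraMap O F (ϖ ^ e) * QuadraticMap.polar Q x y := fun x y => by
    simp only [QuadraticMap.polar, map_sub, hR1]
    ring
  have he : algebraMap O F (ϖ ^ e) ≠ 0 := fun h0 =>
    pow_ne_zero e hϖ.ne_zero (hinj (by rw [h0, map_zero]))
  by_contra! hcon
  let S : ℕ → Set L := fun c =>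
    {x | (∀ z, x ≠ ϖ • z) ∧ (∀ y, ϖ ^ c ∣ QuadraticMap.polar R x y) ∧ ϖ ^ c ∣ R x}
  have hper : ∀ c, PerMod ϖ (c + 1) (S c) := by
    rintro c x ⟨h1, h2, h3⟩ w
    refine ⟨fun z hz => h1 (z - ϖ ^ c • w) ?_, fun y => ?_, ?_⟩
    · rw [smul_sub, ← hz, smul_smul, ← pow_succ', add_sub_cancel_right]
    · rw [QuadraticMap.polar_add_left, QuadraticMap.polar_smul_left, smul_eq_mul]
      exact dvd_add (h2 y) ((pow_dvd_pow ϖ (Nat.le_succ c)).mul_right _)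
    · rw [map_add_smul_form]
      exact dvd_add h3 ((pow_dvd_pow ϖ (Nat.le_succ c)).mul_right _)
  obtain ⟨x, hx⟩ := nonempty_iInter_of_perMod hϖ S (· + 1) hper
    (fun c x hx => ⟨hx.1, fun y => (pow_dvd_pow ϖ (Nat.le_succ c)).trans (hx.2.1 y),
      (pow_dvd_pow ϖ (Nat.le_succ c)).trans hx.2.2⟩)
    (fun c => by
      obtain ⟨x, h1, ⟨a, h2⟩, h3⟩ := hcon c
      refine ⟨x, h3, fun y => ?_, ?_⟩
      · obtain ⟨b, hb⟩ := h1 y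
        have := hR2 x y
        rw [hb, ← map_mul] at this
        exact ⟨ϖ ^ e * b, by rw [hinj this]; ring⟩
      · have := hR1 x
        rw [h2, ← map_mul] at this
        exact ⟨ϖ ^ e * a, by rw [hinj this]; ring⟩)
  rw [Set.mem_iInter] at hx
  have h0 : x = 0 := by
    refine hQ x (fun y => ?_) ?_
    · have h1 := hR2 x y
      rw [eq_zero_of_forall_pow_dvd hϖ fun d => (hx d).2.1 y, map_zero] at h1
      exact (mul_eq_zero.1 h1.symm).resolve_left he
    · have h1 := hR1 x
      rw [eq_zero_of_forall_pow_dvd hϖ fun d => (hx d).2.2, map_zero] at h1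
      exact (mul_eq_zero.1 h1.symm).resolve_left he
  exact (hx 0).1 0 (by rw [h0, smul_zero])

/-- The local density `v` of representations of `Q` by `qH`, together with its local constancy in
`Q`: the volume of the set of representations modulo `ϖ ^ d` of each form congruent to `Q` modulo
`ϖ ^ d₀` is `v` times the volume of a congruence class of forms. -/
def IsDensity (ϖ : O) (qH : QuadraticForm O H) (Q : QuadraticMap O L F) (v : ℝ) : Prop :=
  ∃ d₀ : ℕ, ∀ d, d₀ ≤ d → ∀ R : QuadraticForm O L,
    vol O (repSet ϖ qH (Q + toF F (ϖ ^ d₀ • R)) d) =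
      v * (residueCard O ^ (d * (Module.finrank O L + 1).choose 2))⁻¹

variable {ϖ : O} (hϖ : Irreducible ϖ) {qH : QuadraticForm O H}

theorem IsDensity.unique {Q : QuadraticMap O L F} {v w : ℝ} (hv : IsDensity ϖ qH Q v)
    (hw : IsDensity ϖ qH Q w) : v = w := by
  obtain ⟨d, hd⟩ := hv
  obtain ⟨e, he⟩ := hw
  have h1 := hd (max d e) (le_max_left _ _) 0
  have h2 := he (max d e) (le_max_right _ _) 0
  rw [smul_zero, show toF F (0 : QuadraticForm O L) = 0 by ext; simp, add_zero] at h1 h2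
  rw [h1] at h2
  exact mul_right_cancel₀ (inv_ne_zero (pow_ne_zero _ (residueCard_pos O).ne')) h2

include hϖ

/-- The terms of the sequence that defines the local density, as volumes. -/
theorem density_term_eq (Q : QuadraticMap O L F) (d : ℕ) :
    (Nat.card (rep ϖ qH Q d) : ℝ) /
      residueCard O ^ ((d : ℤ) * ((Module.finrank O H : ℤ) * (Module.finrank O L : ℤ) -
        ((Module.finrank O L + 1).choose 2 : ℕ))) =
      vol O (repSet ϖ qH Q d) * residueCard O ^ (d * (Module.finrank O L + 1).choose 2) := by
  have hq := residueCard_pos O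
  rw [card_rep hϖ, mul_sub, zpow_sub₀ hq.ne', div_div_eq_mul_div]
  have h1 : ((d : ℤ) * ((Module.finrank O H : ℤ) * (Module.finrank O L : ℤ))) =
    ((d * (Module.finrank O H * Module.finrank O L) : ℕ) : ℤ) := by push_cast; ring
  have h2 : ((d : ℤ) * ((Module.finrank O L + 1).choose 2 : ℕ)) =
    ((d * (Module.finrank O L + 1).choose 2 : ℕ) : ℤ) := by push_cast; ring
  rw [h1, h2, zpow_natCast, zpow_natCast]
  field_simp

theorem IsDensity.hasDensity {Q : QuadraticMap O L F} {v : ℝ} (hv : IsDensity ϖ qH Q v) :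
    HasDensity ϖ qH Q v := by
  obtain ⟨d₀, hd⟩ := hv
  refine tendsto_const_nhds.congr' ?_
  filter_upwards [eventually_ge_atTop d₀] with d hd'
  have h := hd d hd' 0
  rw [smul_zero, show toF F (0 : QuadraticForm O L) = 0 by ext; simp, add_zero] at h
  rw [density_term_eq hϖ, h, inv_mul_cancel_right₀ (pow_ne_zero _ (residueCard_pos O).ne')]

/-- A form that is not integral has no representations even modulo `ϖ ^ d`. -/
theorem isDensity_zero {Q : QuadraticMap O L F} (h : ¬ ∀ x, ∃ a : O, Q x = algebraMap O F a) :
    IsDensity ϖ qH Q 0 := by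
  refine ⟨0, fun d _ R => ?_⟩
  rw [zero_mul, ← vol_empty O (X := L →ₗ[O] H)]
  congr 1
  rw [Set.eq_empty_iff_forall_notMem]
  intro φ hφ
  apply h
  intro x
  obtain ⟨a, ha⟩ := hφ x
  refine ⟨qH (φ x) - ϖ ^ d * a - ϖ ^ 0 * R x, ?_⟩
  rw [map_sub, map_sub, ← ha, add_apply, toF_apply, smul_apply, smul_eq_mul]
  ring

/-- Local densities of nonsingular forms exist. -/
theorem exists_isDensity (hH : IsSelfDual qH) {Q : QuadraticMap O L F} (hQ : IsNonsingular Q) :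
    ∃ v, IsDensity ϖ qH Q v := by
  obtain ⟨c, hc⟩ := hQ.exists_bound hϖ
  have hgood : ∀ φ ∈ repSet ϖ qH Q (c + 1), ∃ ρ : H →ₗ[O] L, ∀ x, ρ (φ x) = ϖ ^ c • x := by
    intro φ hφ
    obtain ⟨R, hR⟩ := mem_repSet_iff.1 hφ
    refine exists_leftInverse_up_to hϖ ?_
    rintro x ⟨w, hw⟩
    have hQeq : Q = toF F (qH.comp φ) - toF F (ϖ ^ (c + 1) • R) := by rw [hR]; abel
    refine hc x (fun y => ⟨ϖ * (QuadraticMap.polar qH w (φ y) - QuadraticMap.polar R x y), ?_⟩)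
      ⟨ϖ * (ϖ ^ (c + 1) * qH w - R x), ?_⟩
    · have h1 : QuadraticMap.polar Q x y = algebraMap O F (QuadraticMap.polar qH (φ x) (φ y)) -
          algebraMap O F (ϖ ^ (c + 1) * QuadraticMap.polar R x y) := by
        rw [hQeq]
        simp only [QuadraticMap.polar, sub_apply, toF_apply, QuadraticMap.comp_apply, smul_apply,
          smul_eq_mul, map_add, map_sub, map_mul]
        ring
      rw [h1, hw, QuadraticMap.polar_smul_left, smul_eq_mul, ← map_sub]
      congr 1
      ring
    · rw [hQeq, sub_apply, toF_apply, toF_apply, QuadraticMap.comp_apply, hw,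
        QuadraticMap.map_smul, smul_apply, smul_eq_mul, smul_eq_mul, ← map_sub]
      congr 1
      ring
  obtain ⟨d₀, hd₀⟩ : ∃ d₀, d₀ = 2 * c + 1 := ⟨_, rfl⟩
  refine ⟨vol O (repSet ϖ qH Q d₀) * residueCard O ^ (d₀ * (Module.finrank O L + 1).choose 2),
    d₀, fun d hd R => ?_⟩
  have hq := residueCard_pos O
  have hsub : ∀ d, d₀ ≤ d → repSet ϖ qH Q (c + 1) ∩ repSet ϖ qH (Q + toF F (ϖ ^ d₀ • R)) d =
      repSet ϖ qH (Q + toF F (ϖ ^ d₀ • R)) d := by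
    intro d hd
    refine Set.inter_eq_right.2 ((repSet_anti hd).trans ?_)
    rw [repSet_add_smul le_rfl]
    exact repSet_anti (by omega)
  induction d, hd using Nat.le_induction with
  | base =>
    rw [repSet_add_smul le_rfl, mul_inv_cancel_right₀ (pow_ne_zero _ hq.ne')]
  | succ d hd ih =>
    have h := vol_inter_repSet_eq hϖ hH (perMod_repSet ϖ qH Q (c + 1)) hgood (d := d)
      (by omega) (by omega) (Q + toF F (ϖ ^ d₀ • R))
    rw [hsub d hd, hsub (d + 1) (by omega), ih] at h
    rw [← mul_right_inj' (pow_ne_zero ((Module.finrank O L + 1).choose 2) hq.ne'), ← h, add_mul,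
      pow_add, one_mul]
    field_simp

/-- If the local density is nonzero, the form is represented over `O`. -/
theorem IsDensity.exists_rep {Q : QuadraticMap O L F} {v : ℝ} (hv : IsDensity ϖ qH Q v)
    (h0 : v ≠ 0) : ∃ φ : L →ₗ[O] H, ∀ x, algebraMap O F (qH (φ x)) = Q x := by
  have hinj := FaithfulSMul.algebraMap_injective O F
  obtain ⟨d₀, hd⟩ := hv
  have hne : ∀ d, (repSet ϖ qH Q d).Nonempty := by
    intro d
    have h := hd (max d d₀) (le_max_right _ _) 0
    rw [smul_zero, show toF F (0 : QuadraticForm O L) = 0 by ext; simp, add_zero] at h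
    have h1 : (repSet ϖ qH Q (max d d₀)).Nonempty := by
      rw [Set.nonempty_iff_ne_empty]
      intro h2
      rw [h2, vol_empty] at h
      exact mul_ne_zero h0 (inv_ne_zero (pow_ne_zero _ (residueCard_pos O).ne')) h.symm
    exact h1.mono (repSet_anti (le_max_left _ _))
  obtain ⟨φ, hφ⟩ := nonempty_iInter_of_perMod hϖ (fun d => repSet ϖ qH Q d) id
    (fun d => perMod_repSet _ _ _ _) (fun d => repSet_anti (Nat.le_succ d)) hne
  rw [Set.mem_iInter] at hφ
  refine ⟨φ, fun x => ?_⟩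
  obtain ⟨a, ha⟩ := hφ 0 x
  have ha0 : ϖ ^ 0 * a = 0 := by
    refine eq_zero_of_forall_pow_dvd hϖ fun d => ?_
    obtain ⟨b, hb⟩ := hφ d x
    exact ⟨b, hinj (ha.symm.trans hb)⟩
  rw [ha0, map_zero] at ha
  exact sub_eq_zero.1 ha

end Density

/-! ### Densities of overlattices -/

section Scaling

variable {O : Type*} [CommRing O] [IsDomain O] {F : Type*} [Field F] [Algebra O F]
  {H : Type*} [AddCommGroup H] [Module O H] {L : Type*} [AddCommGroup L] [Module O L]

variable (O L F) in
/-- The integral quadratic maps, as a subgroup of all quadratic maps to the fraction field. -/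
def intForms : AddSubgroup (QuadraticMap O L F) where
  carrier := {Q | ∃ R : QuadraticForm O L, toF F R = Q}
  add_mem' := by
    rintro _ _ ⟨R, rfl⟩ ⟨S, rfl⟩
    exact ⟨R + S, toF_add R S⟩
  zero_mem' := ⟨0, by ext; simp⟩
  neg_mem' := by
    rintro _ ⟨R, rfl⟩
    exact ⟨-R, toF_neg R⟩

/-- The quadratic maps whose composition with `A` is integral. -/
def overForms (F : Type*) [Field F] [Algebra O F] (A : L →ₗ[O] L) :
    AddSubgroup (QuadraticMap O L F) where
  carrier := {Q | Q.comp A ∈ intForms O F L}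
  add_mem' := fun h h' => (intForms O F L).add_mem h h'
  zero_mem' := (intForms O F L).zero_mem
  neg_mem' := fun h => (intForms O F L).neg_mem h

/-- The index of the integral forms in the group of forms whose composition with `A` is integral.
The maps of the second kind are the forms that take integral values on the image of `A`. -/
def overIndex (F : Type*) [Field F] [Algebra O F] (A : L →ₗ[O] L) : ℕ :=
  Nat.card (overForms F A ⧸ (intForms O F L).addSubgroupOf (overForms F A))

variable [IsDiscreteValuationRing O] [Finite (IsLocalRing.ResidueField O)]
  [TopologicalSpace O] [IsTopologicalRing O] [CompactSpace O] [T2Space O]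
  [Module.Finite O H] [Module.Free O H] [Module.Finite O L] [Module.Free O L]
  [FaithfulSMul O F] {ϖ : O} (hϖ : Irreducible ϖ) {qH : QuadraticForm O H}

theorem smul_mem_intForms_of_overForms {A B : L →ₗ[O] L} {c : ℕ}
    (hAB : ∀ x, A (B x) = ϖ ^ c • x) {Q : QuadraticMap O L F} (hQ : Q ∈ overForms F A) :
    ∃ S : QuadraticForm O L, toF F S = ϖ ^ (2 * c) • Q := by
  obtain ⟨S, hS⟩ := hQ
  refine ⟨S.comp B, ?_⟩
  ext x
  have := congrArg (fun Q : QuadraticMap O L F => Q (B x)) hS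
  simp only [toF_apply, QuadraticMap.comp_apply, hAB, QuadraticMap.map_smul, ← pow_add,
    ← two_mul] at this
  simpa using this

include hϖ

theorem toF_smul_injective (c : ℕ) {Q Q' : QuadraticMap O L F} (h : ϖ ^ c • Q = ϖ ^ c • Q') :
    Q = Q' := by
  have hinj := FaithfulSMul.algebraMap_injective O F
  have he : algebraMap O F (ϖ ^ c) ≠ 0 := fun h0 =>
    pow_ne_zero c hϖ.ne_zero (hinj (by rw [h0, map_zero]))
  ext x
  have := congrArg (fun Q : QuadraticMap O L F => Q x) h
  simp only [smul_apply, Algebra.smul_def] at this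
  exact mul_left_cancel₀ he this

/-- Forms that become integral on the image of `A` have bounded denominators. -/
theorem finite_overForms_quotient {A B : L →ₗ[O] L} {c : ℕ} (hAB : ∀ x, A (B x) = ϖ ^ c • x) :
    Finite (overForms F A ⧸ (intForms O F L).addSubgroupOf (overForms F A)) := by
  have := finite_red (X := QuadraticForm O L) hϖ (2 * c)
  let s : (overForms F A ⧸ (intForms O F L).addSubgroupOf (overForms F A)) → overForms F A :=
    fun t => Quotient.out t
  have hs : ∀ t, QuotientAddGroup.mk (s t) = t := fun t => Quotient.out_eq t
  choose g hg using fun t => smul_mem_intForms_of_overForms (ϖ := ϖ) hAB (s t).2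
  refine Finite.of_injective (fun t => (Submodule.Quotient.mk (g t) : Red _ ϖ (2 * c))) ?_
  intro t t' h
  obtain ⟨W, hW⟩ := red_mk_eq.1 h
  rw [← hs t, ← hs t']
  refine QuotientAddGroup.eq.2 ⟨-W, toF_smul_injective hϖ (2 * c) ?_⟩
  have h1 : toF F (g t) = toF F (g t') + ϖ ^ (2 * c) • toF F W := by
    rw [← toF_smul, ← toF_add, ← hW]
  rw [hg, hg] at h1
  change ϖ ^ (2 * c) • toF F (-W) = ϖ ^ (2 * c) • (-(s t : QuadraticMap O L F) + (s t' : QuadraticMap O L F))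
  rw [toF_neg, smul_neg, smul_add, smul_neg, h1]
  abel

/-- The contribution to the density of `Q` of the maps that extend to an overlattice, in which `L`
is the image of `A`, is a multiple of the density of the overlattice. -/
theorem IsDensity.vol_range_inter {A B : L →ₗ[O] L} {c : ℕ} (hAB : ∀ x, A (B x) = ϖ ^ c • x)
    (hBA : ∀ x, B (A x) = ϖ ^ c • x) {Q : QuadraticMap O L F} {v : ℝ} (hv : IsDensity ϖ qH Q v) :
    ∃ d₀ : ℕ, ∀ d, d₀ ≤ d →
      vol O ({φ : L →ₗ[O] H | ∃ φ' : L →ₗ[O] H, φ'.comp A = φ} ∩ repSet ϖ qH (Q.comp A) d) =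
        vol O {φ : L →ₗ[O] H | ∃ φ' : L →ₗ[O] H, φ'.comp A = φ} * overIndex F A * v *
          (residueCard O ^ (d * (Module.finrank O L + 1).choose 2))⁻¹ := by
  classical
  obtain ⟨d₀, hd₀⟩ := hv
  refine ⟨d₀ + 2 * c, fun d hd => ?_⟩
  have hfin := finite_overForms_quotient (F := F) hϖ hAB
  have := Fintype.ofFinite (overForms F A ⧸ (intForms O F L).addSubgroupOf (overForms F A))
  let s : (overForms F A ⧸ (intForms O F L).addSubgroupOf (overForms F A)) → overForms F A :=
    fun t => Quotient.out t
  have hs : ∀ t, QuotientAddGroup.mk (s t) = t := fun t => Quotient.out_eq t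
  let S : Set (L →ₗ[O] H) := {φ | φ.comp A ∈ repSet ϖ qH (Q.comp A) d}
  have hS : S = ⋃ t, repSet ϖ qH (Q + ϖ ^ d • (s t : QuadraticMap O L F)) d := by
    ext φ
    rw [Set.mem_iUnion]
    constructor
    · intro h
      obtain ⟨R, hR⟩ := mem_repSet_iff.1 h
      have hinj := FaithfulSMul.algebraMap_injective O F
      have he : algebraMap O F (ϖ ^ d) ≠ 0 := fun h0 =>
        pow_ne_zero d hϖ.ne_zero (hinj (by rw [h0, map_zero]))
      let T : QuadraticMap O L F := (algebraMap O F (ϖ ^ d))⁻¹ • (toF F (qH.comp φ) - Q)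
      have hT : T ∈ overForms F A := by
        refine ⟨R, ?_⟩
        ext x
        have h1 := congrArg (fun Q : QuadraticMap O L F => Q x) hR
        simp only [toF_apply, QuadraticMap.comp_apply, add_apply, LinearMap.comp_apply, smul_apply,
          smul_eq_mul, map_mul] at h1
        rw [toF_apply, QuadraticMap.comp_apply, smul_apply, sub_apply, toF_apply,
          QuadraticMap.comp_apply, h1, add_sub_cancel_left, smul_eq_mul, inv_mul_cancel_left₀ he]
      have hT' : ϖ ^ d • T = toF F (qH.comp φ) - Q := by
        ext x
        rw [smul_apply, smul_apply, Algebra.smul_def, smul_eq_mul, mul_inv_cancel_left₀ he]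
      obtain ⟨W, hW⟩ := QuotientAddGroup.eq.1 (hs (QuotientAddGroup.mk ⟨T, hT⟩))
      refine ⟨QuotientAddGroup.mk ⟨T, hT⟩, mem_repSet_iff.2 ⟨W, ?_⟩⟩
      have hW' : toF F W = -(s (QuotientAddGroup.mk ⟨T, hT⟩) : QuadraticMap O L F) + T := hW
      rw [toF_smul, hW', smul_add, smul_neg, hT']
      abel
    · rintro ⟨t, ht⟩ x
      obtain ⟨R, hR⟩ := (s t).2
      obtain ⟨a, ha⟩ := ht (A x)
      refine ⟨R x + a, ?_⟩
      have h1 := congrArg (fun Q : QuadraticMap O L F => Q x) hR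
      simp only [toF_apply, QuadraticMap.comp_apply] at h1
      rw [add_apply, smul_apply, ← h1, ← sub_sub, Algebra.smul_def, ← map_mul,
        sub_eq_iff_eq_add, ← map_add] at ha
      rw [LinearMap.comp_apply, QuadraticMap.comp_apply, ha]
      congr 1
      ring
  have hvol : ∀ t, vol O (repSet ϖ qH (Q + ϖ ^ d • (s t : QuadraticMap O L F)) d) =
      v * (residueCard O ^ (d * (Module.finrank O L + 1).choose 2))⁻¹ := by
    intro t
    obtain ⟨W, hW⟩ := smul_mem_intForms_of_overForms (ϖ := ϖ) hAB (s t).2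
    obtain ⟨k, rfl⟩ := Nat.exists_eq_add_of_le hd
    have h1 : ϖ ^ (d₀ + 2 * c + k) • (s t : QuadraticMap O L F) = toF F (ϖ ^ d₀ • (ϖ ^ k • W)) := by
      rw [toF_smul, toF_smul, hW, smul_smul, smul_smul]
      congr 1
      ring
    rw [h1]
    exact hd₀ _ (by omega) _
  have hper : PerMod ϖ d S := by
    intro φ hφ ψ
    exact perMod_repSet ϖ qH (Q.comp A) d _ hφ (ψ.comp A)
  have hSvol : vol O S = overIndex F A *
      (v * (residueCard O ^ (d * (Module.finrank O L + 1).choose 2))⁻¹) := by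
    rw [hS, vol_iUnion hϖ _ ?_ (fun _ => d) fun t => perMod_repSet _ _ _ _]
    · simp only [hvol, Finset.sum_const, Finset.card_univ, nsmul_eq_mul]
      rw [overIndex, Nat.card_eq_fintype_card]
    · intro t t' htt'
      refine Set.disjoint_left.2 fun φ hφ hφ' => htt' ?_
      obtain ⟨R, hR⟩ := mem_repSet_iff.1 hφ
      obtain ⟨R', hR'⟩ := mem_repSet_iff.1 hφ'
      rw [← hs t, ← hs t']
      refine QuotientAddGroup.eq.2 ⟨R - R', toF_smul_injective hϖ d ?_⟩
      change _ = ϖ ^ d • (-(s t : QuadraticMap O L F) + (s t' : QuadraticMap O L F))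
      rw [hR, add_assoc, add_assoc, add_right_inj, toF_smul, toF_smul] at hR'
      rw [sub_eq_add_neg, toF_add, toF_neg, smul_add, smul_add, smul_neg, smul_neg,
        add_comm (-_), ← sub_eq_add_neg, ← sub_eq_add_neg, sub_eq_sub_iff_add_eq_add, add_comm, hR',
        add_comm]
  let Ast : (L →ₗ[O] H) →ₗ[O] (L →ₗ[O] H) := LinearMap.lcomp O H A
  have hAst : Function.Injective Ast := by
    intro φ ψ h
    ext x
    have h1 : φ (A (B x)) = ψ (A (B x)) := congrArg (fun f : L →ₗ[O] H => f (B x)) h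
    rw [hAB, map_smul, map_smul] at h1
    exact smul_right_injective H (pow_ne_zero c hϖ.ne_zero) h1
  have himg := vol_image hϖ Ast hAst (c := c) (fun φ => ⟨φ.comp B, LinearMap.ext fun x => by
    change φ (B (A x)) = ϖ ^ c • φ x
    rw [hBA, map_smul]⟩) hper
  have hset : {φ : L →ₗ[O] H | ∃ φ' : L →ₗ[O] H, φ'.comp A = φ} ∩ repSet ϖ qH (Q.comp A) d =
      Ast '' S := by
    ext φ
    constructor
    · rintro ⟨⟨φ', rfl⟩, h⟩
      exact ⟨φ', h, rfl⟩
    · rintro ⟨φ', h, rfl⟩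
      exact ⟨⟨φ', rfl⟩, h⟩
  have hrange : {φ : L →ₗ[O] H | ∃ φ' : L →ₗ[O] H, φ'.comp A = φ} = Set.range Ast := rfl
  rw [hset, himg, hSvol, hrange]
  ring

end Scaling


/-! ### Gauss sums of quadratic spaces over a finite field -/

section GaussSums

variable {κ : Type*} [Field κ] [Finite κ] {ψ : AddChar κ ℂ}
  {V W W' : Type*} [AddCommGroup V] [Module κ V] [Module.Finite κ V]
  [AddCommGroup W] [Module κ W] [Module.Finite κ W]
  [AddCommGroup W'] [Module κ W'] [Module.Finite κ W']

theorem finite_of_module (κ : Type*) [Field κ] [Finite κ] (V : Type*) [AddCommGroup V]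
    [Module κ V] [Module.Finite κ V] : Finite V :=
  Module.finite_of_finite κ

theorem finite_linearMap (κ : Type*) [Field κ] [Finite κ] (V W : Type*) [AddCommGroup V]
    [Module κ V] [Module.Finite κ V] [AddCommGroup W] [Module κ W] [Module.Finite κ W] :
    Finite (V →ₗ[κ] W) :=
  Module.finite_of_finite κ

/-- Orthogonality of characters. -/
theorem finsum_addChar_linear (hψ : ψ.IsPrimitive) (l : V →ₗ[κ] κ) [Decidable (l = 0)] :
    ∑ᶠ x, ψ (l x) = if l = 0 then (Nat.card κ : ℂ) ^ Module.finrank κ V else 0 := by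
  have := finite_of_module κ V
  cases nonempty_fintype V
  rw [finsum_eq_sum_of_fintype]
  have h := AddChar.sum_eq_ite (ψ.compAddMonoidHom l.toAddMonoidHom)
  have h2 : ψ.compAddMonoidHom l.toAddMonoidHom = 0 ↔ l = 0 := by
    refine ⟨fun h0 => ?_, fun h0 => ?_⟩
    · by_contra hl
      obtain ⟨x, hx⟩ : ∃ x, l x ≠ 0 := by
        by_contra! hh
        exact hl (LinearMap.ext hh)
      refine hψ hx ?_
      ext a
      have := DFunLike.congr_fun h0 (a • x)
      simpa [AddChar.mulShift_apply, mul_comm] using this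
    · subst h0
      ext
      simp
  classical
  rw [show (∑ i, ψ (l i)) = ∑ i, (ψ.compAddMonoidHom l.toAddMonoidHom) i from rfl, h]
  simp only [h2, ← Nat.card_eq_fintype_card, Module.natCard_eq_pow_finrank (K := κ) (V := V)]
  split_ifs <;> simp

theorem finsum_addChar_bilin (hψ : ψ.IsPrimitive) (B : LinearMap.BilinForm κ V) :
    ∑ᶠ x : V × V, ψ (B x.1 x.2) =
      (Nat.card κ : ℂ) ^ (Module.finrank κ V + Module.finrank κ (LinearMap.ker B)) := by
  classical
  have := finite_of_module κ V
  cases nonempty_fintype V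
  rw [finsum_eq_sum_of_fintype, Fintype.sum_prod_type]
  have h1 : ∀ x : V, ∑ y, ψ (B x y) = if B x = 0 then (Nat.card κ : ℂ) ^ Module.finrank κ V
      else 0 := fun x => by
    rw [← finsum_addChar_linear hψ (B x), finsum_eq_sum_of_fintype]
  simp only [h1, ← Finset.sum_filter, Finset.sum_const, nsmul_eq_mul]
  have h2 : (Finset.univ.filter fun x => B x = 0).card = Nat.card (LinearMap.ker B) := by
    rw [← Fintype.card_subtype, ← Nat.card_eq_fintype_card]
    rfl
  rw [h2, Module.natCard_eq_pow_finrank (K := κ), pow_add]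
  push_cast
  ring

/-- The symmetric bilinear form on the dual of `V` defined by a linear functional `τ` on the space
of quadratic forms on `V`: its value at `(l, l')` is the value of `τ` at the form `l l'`. -/
def dualBilin (τ : Module.Dual κ (QuadraticForm κ V)) :
    LinearMap.BilinForm κ (Module.Dual κ V) :=
  LinearMap.mk₂ κ (fun l l' => τ (QuadraticMap.linMulLin l l'))
    (fun a b c => by rw [QuadraticMap.add_linMulLin, map_add])
    (fun c a b => by
      rw [← map_smul]; congr 1; ext x; simp [mul_assoc])
    (fun a b c => by rw [QuadraticMap.linMulLin_add, map_add])
    (fun c a b => by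
      rw [← map_smul]; congr 1; ext x; simp [mul_left_comm])

theorem dualBilin_apply (τ : Module.Dual κ (QuadraticForm κ V)) (l l' : Module.Dual κ V) :
    dualBilin τ l l' = τ (QuadraticMap.linMulLin l l') := rfl

theorem dualBilin_comm (τ : Module.Dual κ (QuadraticForm κ V)) (l l' : Module.Dual κ V) :
    dualBilin τ l l' = dualBilin τ l' l := by
  rw [dualBilin_apply, dualBilin_apply]
  congr 1
  ext x
  simp [mul_comm]

/-- The Gauss sum of a quadratic space `W`, indexed by a linear functional `τ` on the quadratic
forms on `V`: the sum of `ψ (τ (w ∘ φ))` over all linear maps `φ` from `V` to `W`. -/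
def formGauss (ψ : AddChar κ ℂ) (w : QuadraticForm κ W)
    (τ : Module.Dual κ (QuadraticForm κ V)) : ℂ :=
  ∑ᶠ φ : V →ₗ[κ] W, ψ (τ (w.comp φ))

/-- The sum of the dimension of `V` and that of the radical of the bilinear form of `τ`. -/
def gaussExp (τ : Module.Dual κ (QuadraticForm κ V)) : ℕ :=
  Module.finrank κ V + Module.finrank κ (LinearMap.ker (dualBilin τ))

theorem gaussExp_le (τ : Module.Dual κ (QuadraticForm κ V)) :
    gaussExp τ ≤ 2 * Module.finrank κ V := by
  have h := Submodule.finrank_le (LinearMap.ker (dualBilin τ))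
  rw [Subspace.dual_finrank_eq] at h
  unfold gaussExp
  lia

theorem formGauss_congr {w : QuadraticForm κ W} {w' : QuadraticForm κ W'} (e : w.IsometryEquiv w')
    (τ : Module.Dual κ (QuadraticForm κ V)) : formGauss ψ w τ = formGauss ψ w' τ := by
  unfold formGauss
  refine finsum_eq_of_bijective (fun φ => e.toLinearEquiv.toLinearMap ∘ₗ φ)
    (LinearEquiv.congrRight e.toLinearEquiv).bijective fun φ => ?_
  congr 2
  ext x
  exact (e.map_app _).symm

theorem formGauss_prod (w : QuadraticForm κ W) (w' : QuadraticForm κ W')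
    (τ : Module.Dual κ (QuadraticForm κ V)) :
    formGauss ψ (w.prod w') τ = formGauss ψ w τ * formGauss ψ w' τ := by
  have := finite_linearMap κ V W
  have := finite_linearMap κ V W'
  have := finite_linearMap κ V (W × W')
  cases nonempty_fintype (V →ₗ[κ] W)
  cases nonempty_fintype (V →ₗ[κ] W')
  cases nonempty_fintype (V →ₗ[κ] W × W')
  unfold formGauss
  simp only [finsum_eq_sum_of_fintype]
  rw [Fintype.sum_mul_sum, ← Fintype.sum_prod_type']
  symm
  refine Fintype.sum_equiv (LinearMap.prodEquiv κ).toEquiv _ _ fun φ => ?_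
  rw [← AddChar.map_add_eq_mul, ← map_add]
  congr 2

theorem formGauss_hyperbolicPlane (hψ : ψ.IsPrimitive) (τ : Module.Dual κ (QuadraticForm κ V)) :
    formGauss ψ (hyperbolicPlane κ) τ = (Nat.card κ : ℂ) ^ gaussExp τ := by
  have h := finsum_addChar_bilin hψ (dualBilin τ)
  rw [Subspace.dual_finrank_eq] at h
  rw [gaussExp, ← h, formGauss]
  symm
  refine finsum_eq_of_bijective (LinearMap.prodEquiv κ).toEquiv
    (Equiv.bijective _) fun φ => ?_
  congr 1

/-- A quadratic space is of Gauss type `(b, j, η)` if its Gauss sums are those of the orthogonal sum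
of `b` lines `⟨1⟩` and `j` planes, which are hyperbolic up to the sign `η`. -/
def GaussType {κ : Type u} [Field κ] [Finite κ] (ψ : AddChar κ ℂ) {W : Type*} [AddCommGroup W]
    [Module κ W] (w : QuadraticForm κ W) (b j : ℕ) (η : ℤˣ) : Prop :=
  Module.finrank κ W = 2 * j + b ∧
    ∀ (V : Type u) [AddCommGroup V] [Module κ V] [Module.Finite κ V]
      (τ : Module.Dual κ (QuadraticForm κ V)),
      formGauss ψ w τ = ((η : ℤ) : ℂ) ^ gaussExp τ * ((Nat.card κ : ℂ) ^ gaussExp τ) ^ j *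
        formGauss ψ (QuadraticMap.sq : QuadraticForm κ κ) τ ^ b

end GaussSums

section GaussType

universe u

variable {κ : Type u} [Field κ] [Finite κ] {ψ : AddChar κ ℂ}
  {W W' : Type*} [AddCommGroup W] [Module κ W] [Module.Finite κ W]
  [AddCommGroup W'] [Module κ W'] [Module.Finite κ W']

theorem GaussType.congr {w : QuadraticForm κ W} {w' : QuadraticForm κ W'} {b j : ℕ} {η : ℤˣ}
    (h : GaussType ψ w b j η) (e : w.IsometryEquiv w') : GaussType ψ w' b j η :=
  ⟨e.toLinearEquiv.finrank_eq ▸ h.1, fun V _ _ _ τ => by rw [← formGauss_congr e, h.2]⟩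

theorem gaussType_hyperbolicPlane (hψ : ψ.IsPrimitive) :
    GaussType ψ (hyperbolicPlane κ) 0 1 1 :=
  ⟨by simp, fun V _ _ _ τ => by simp [formGauss_hyperbolicPlane hψ]⟩

theorem GaussType.prod {w : QuadraticForm κ W} {w' : QuadraticForm κ W'} {b j j' : ℕ} {η η' : ℤˣ}
    (h : GaussType ψ w 0 j η) (h' : GaussType ψ w' b j' η') :
    GaussType ψ (w.prod w') b (j + j') (η * η') :=
  ⟨by rw [Module.finrank_prod, h.1, h'.1]; ring, fun V _ _ _ τ => by
    rw [formGauss_prod, h.2, h'.2, Units.val_mul, Int.cast_mul, mul_pow, pow_add]; ring⟩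

theorem gaussType_of_subsingleton [Subsingleton W] (w : QuadraticForm κ W) :
    GaussType ψ w 0 0 1 := by
  refine ⟨by simp [Module.finrank_zero_of_subsingleton], fun V _ _ _ τ => ?_⟩
  have h : ∀ φ : V →ₗ[κ] W, w.comp φ = 0 := fun φ => by
    ext x
    rw [QuadraticMap.comp_apply, Subsingleton.elim (φ x) 0]
    simp
  simp only [formGauss, h, map_zero, AddChar.map_zero_eq_one]
  have : Unique (V →ₗ[κ] W) := ⟨⟨0⟩, fun φ => LinearMap.ext fun x => Subsingleton.elim _ _⟩
  simp [finsum_unique]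


theorem GaussType.exists_fin {w : QuadraticForm κ W} {b j : ℕ} {η : ℤˣ}
    (h : GaussType ψ w b j η) :
    ∃ w' : QuadraticForm κ (Fin (2 * j + b) → κ), GaussType ψ w' b j η := by
  let e := (Module.finBasisOfFinrankEq κ W h.1).equivFun
  exact ⟨w.comp e.symm.toLinearMap, h.congr ⟨e, fun x => by simp⟩⟩

/-- Hyperbolic planes may be added to a space of given Gauss type. -/
theorem exists_gaussType_add (hψ : ψ.IsPrimitive) {b j : ℕ} {η : ℤˣ}
    (h : ∃ w : QuadraticForm κ (Fin (2 * j + b) → κ), GaussType ψ w b j η) (i : ℕ) :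
    ∃ w : QuadraticForm κ (Fin (2 * (j + i) + b) → κ), GaussType ψ w b (j + i) η := by
  induction i with
  | zero => exact h
  | succ i ih =>
    obtain ⟨w, hw⟩ := ih
    have := ((gaussType_hyperbolicPlane hψ).prod hw).exists_fin
    rwa [one_mul, show 1 + (j + i) = j + (i + 1) by ring] at this

end GaussType

section OddCharacteristic

variable {κ : Type*} [Field κ] [Finite κ] {ψ : AddChar κ ℂ}
  {V : Type*} [AddCommGroup V] [Module κ V] [Module.Finite κ V]

/-- The quadratic character of a finite field. -/
def quadChar (a : κ) : ℤ :=
  open scoped Classical in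
  have := Fintype.ofFinite κ
  quadraticChar κ a

theorem quadChar_eq [Fintype κ] [DecidableEq κ] (a : κ) : quadChar a = quadraticChar κ a := by
  unfold quadChar
  congr!

theorem finsum_sq_mul (hp : ringChar κ ≠ 2) (hψ : ψ.IsPrimitive) {a c : κ} (ha : a ≠ 0)
    (hc : c ≠ 0) :
    ∑ᶠ x : κ, ψ (a * (c * x ^ 2)) = (quadChar a : ℂ) * ∑ᶠ x : κ, ψ (c * x ^ 2) := by
  classical
  cases nonempty_fintype κ
  have key : ∀ c : κ, c ≠ 0 → ∑ x : κ, ψ (c * x ^ 2) =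
      ∑ y : κ, (quadraticChar κ y : ℂ) * ψ (c * y) := by
    intro c hc
    have h1 : ∑ x : κ, ψ (c * x ^ 2) =
        ∑ y : κ, ((quadraticChar κ y : ℂ) + 1) * ψ (c * y) := by
      rw [← Finset.sum_fiberwise_of_maps_to (s := Finset.univ) (t := Finset.univ)
        (g := fun x : κ => x ^ 2) (fun _ _ => Finset.mem_univ _)]
      refine Finset.sum_congr rfl fun y _ => ?_
      have h2 : ∀ x ∈ Finset.univ.filter (fun x : κ => x ^ 2 = y), ψ (c * x ^ 2) = ψ (c * y) := by
        intro x hx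
        rw [(Finset.mem_filter.1 hx).2]
      rw [Finset.sum_congr rfl h2, Finset.sum_const, nsmul_eq_mul]
      congr 1
      have h3 := quadraticChar_card_sqrts hp y
      have h4 : ({x : κ | x ^ 2 = y} : Set κ).toFinset = Finset.univ.filter (fun x : κ => x ^ 2 = y) := by
        ext; simp
      rw [h4] at h3
      exact_mod_cast h3
    rw [h1]
    simp only [add_mul, one_mul, Finset.sum_add_distrib]
    have h5 : ∑ y : κ, ψ (c * y) = 0 := by
      have := AddChar.sum_mulShift (ψ := ψ) c hψ
      simpa [hc, mul_comm] using this
    rw [h5, add_zero]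
  simp only [finsum_eq_sum_of_fintype, quadChar_eq, ← mul_assoc]
  rw [key c hc, key (a * c) (mul_ne_zero ha hc), Finset.mul_sum]
  refine Fintype.sum_equiv (Equiv.mulLeft₀ a ha) _ _ fun y => ?_
  have h6 : (quadraticChar κ a : ℂ) * quadraticChar κ a = 1 := by
    have := quadraticChar_sq_one ha
    rw [sq] at this
    exact_mod_cast this
  simp only [Equiv.mulLeft₀_apply, map_mul, Int.cast_mul]
  rw [← mul_assoc, ← mul_assoc, h6, one_mul]
  congr 2
  ring

theorem finsum_prod_pi {ι κ R : Type*} [Fintype ι] [Finite κ] [CommRing R] (f : ι → κ → R) :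
    ∑ᶠ x : ι → κ, ∏ i, f i (x i) = ∏ i, ∑ᶠ x : κ, f i x := by
  classical
  cases nonempty_fintype κ
  simp only [finsum_eq_sum_of_fintype]
  rw [Finset.prod_univ_sum, Fintype.piFinset_univ]

theorem formGauss_smul_sq_eq_prod {n : ℕ} (v : Module.Basis (Fin n) κ (Module.Dual κ V))
    (τ : Module.Dual κ (QuadraticForm κ V)) (hv : (dualBilin τ).IsOrthoᵢ v) (a : κ) :
    formGauss ψ (a • QuadraticMap.sq : QuadraticForm κ κ) τ =
      ∏ i, ∑ᶠ x : κ, ψ (a * (dualBilin τ (v i) (v i) * x ^ 2)) := by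
  rw [← finsum_prod_pi, formGauss]
  refine finsum_eq_of_bijective v.equivFun v.equivFun.bijective fun φ => ?_
  have h0 : ∀ f : Fin n → κ, ψ (∑ i, f i) = ∏ i, ψ (f i) := fun f => by
    have := map_prod ψ.toMonoidHom (fun i => Multiplicative.ofAdd (f i)) Finset.univ
    rwa [← ofAdd_sum] at this
  rw [← h0, ← Finset.mul_sum]
  congr 1
  have h1 : (a • QuadraticMap.sq : QuadraticForm κ κ).comp φ =
      a • QuadraticMap.linMulLin φ φ := by
    ext x
    simp
  rw [h1, map_smul, smul_eq_mul, ← dualBilin_apply]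
  congr 1
  conv_lhs => rw [← v.sum_equivFun φ]
  rw [map_sum]
  refine Finset.sum_congr rfl fun i _ => ?_
  rw [map_sum, LinearMap.sum_apply, Finset.sum_eq_single i]
  · simp
    ring
  · intro j _ hj
    have : dualBilin τ (v j) (v i) = 0 := hv hj
    simp [this]
  · simp

theorem finrank_ker_of_isOrtho {n : ℕ} (v : Module.Basis (Fin n) κ V)
    (B : LinearMap.BilinForm κ V) (hv : B.IsOrthoᵢ v) [DecidablePred fun i => B (v i) (v i) = 0] :
    Module.finrank κ (LinearMap.ker B) = Fintype.card {i // B (v i) (v i) = 0} := by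
  have h0 : ∀ x i, B x (v i) = v.repr x i * B (v i) (v i) := fun x i => by
    conv_lhs => rw [← v.sum_repr x]
    rw [map_sum, LinearMap.sum_apply, Finset.sum_eq_single i]
    · simp
    · intro j _ hj
      have : B (v j) (v i) = 0 := hv hj
      simp [this]
    · simp
  have h1 : LinearMap.ker B =
      Submodule.span κ (Set.range fun i : {i // B (v i) (v i) = 0} => v i) := by
    apply le_antisymm
    · intro x hx
      rw [← v.sum_repr x]
      refine Submodule.sum_mem _ fun i _ => ?_
      by_cases hi : B (v i) (v i) = 0
      · exact Submodule.smul_mem _ _ (Submodule.subset_span ⟨⟨i, hi⟩, rfl⟩)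
      · have h2 := h0 x i
        rw [LinearMap.mem_ker.1 hx, LinearMap.zero_apply] at h2
        rw [(mul_eq_zero.1 h2.symm).resolve_right hi, zero_smul]
        exact Submodule.zero_mem _
    · rw [Submodule.span_le]
      rintro _ ⟨⟨i, hi⟩, rfl⟩
      refine LinearMap.mem_ker.2 (v.ext fun j => ?_)
      rw [h0]
      by_cases hij : j = i
      · subst hij; simp [hi]
      · simp [Ne.symm hij]
  rw [h1, finrank_span_eq_card]
  exact v.linearIndependent.comp _ Subtype.val_injective

theorem quadChar_sq {a : κ} (ha : a ≠ 0) : quadChar a ^ 2 = 1 := by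
  classical
  cases nonempty_fintype κ
  rw [quadChar_eq]
  exact quadraticChar_sq_one ha

theorem formGauss_smul_sq (hp : ringChar κ ≠ 2) (hψ : ψ.IsPrimitive) {a : κ} (ha : a ≠ 0)
    (τ : Module.Dual κ (QuadraticForm κ V)) :
    formGauss ψ (a • QuadraticMap.sq : QuadraticForm κ κ) τ =
      (quadChar a : ℂ) ^ gaussExp τ * formGauss ψ (QuadraticMap.sq : QuadraticForm κ κ) τ := by
  classical
  have : Invertible (2 : κ) := invertibleOfNonzero (Ring.two_ne_zero hp)
  obtain ⟨v, hv⟩ := LinearMap.BilinForm.exists_orthogonal_basis (B := dualBilin τ)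
    ⟨fun x y => by simpa using dualBilin_comm τ x y⟩
  have h1 := formGauss_smul_sq_eq_prod (ψ := ψ) v τ hv 1
  rw [one_smul] at h1
  rw [formGauss_smul_sq_eq_prod v τ hv a, h1]
  simp only [one_mul]
  have h2 : ∀ i, ∑ᶠ x : κ, ψ (a * (dualBilin τ (v i) (v i) * x ^ 2)) =
      (if dualBilin τ (v i) (v i) = 0 then 1 else (quadChar a : ℂ)) *
        ∑ᶠ x : κ, ψ (dualBilin τ (v i) (v i) * x ^ 2) := by
    intro i
    split_ifs with hi
    · simp [hi]
    · exact finsum_sq_mul hp hψ ha hi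
  rw [Finset.prod_congr rfl fun i _ => h2 i, Finset.prod_mul_distrib]
  congr 1
  rw [Finset.prod_ite, Finset.prod_const_one, one_mul, Finset.prod_const, gaussExp,
    finrank_ker_of_isOrtho v _ hv, Fintype.card_subtype]
  have h3 := Finset.card_filter_add_card_filter_not (s := Finset.univ)
    (fun i => dualBilin τ (v i) (v i) = 0)
  have h5 := Subspace.dual_finrank_eq (K := κ) (V := V)
  rw [Finset.card_univ, Fintype.card_fin] at h3
  rw [h5.symm.trans h3.symm]
  have h4 : (quadChar a : ℂ) ^ 2 = 1 := by exact_mod_cast quadChar_sq ha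
  generalize (Finset.univ.filter fun i => dualBilin τ (v i) (v i) = 0).card = s
  rw [show ∀ t : ℕ, s + t + s = 2 * s + t by intro t; ring, pow_add, pow_mul, h4, one_pow, one_mul]

/-- The form `⟨1⟩ ⟂ ⟨-1⟩` is a hyperbolic plane. -/
theorem formGauss_sq_mul_neg_sq (hp : ringChar κ ≠ 2) (hψ : ψ.IsPrimitive)
    (τ : Module.Dual κ (QuadraticForm κ V)) :
    formGauss ψ (QuadraticMap.sq : QuadraticForm κ κ) τ *
      formGauss ψ ((-1 : κ) • QuadraticMap.sq : QuadraticForm κ κ) τ =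
      (Nat.card κ : ℂ) ^ gaussExp τ := by
  rw [← formGauss_prod, ← formGauss_hyperbolicPlane hψ]
  have h2 : (2 : κ) ≠ 0 := Ring.two_ne_zero hp
  refine formGauss_congr
    ⟨{ toFun := fun x : κ × κ => ((x.1 + x.2, x.1 - x.2) : κ × κ)
       invFun := fun x => ((x.1 + x.2) / 2, (x.1 - x.2) / 2)
       map_add' := fun x y => ?_
       map_smul' := fun c x => ?_
       left_inv := fun x => ?_
       right_inv := fun x => ?_ }, fun x => ?_⟩ τ
  · ext <;> simp <;> ring
  · ext <;> simp <;> ring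
  · ext <;> simp <;> field_simp <;> ring
  · ext <;> simp <;> field_simp <;> ring
  · simp [hyperbolicPlane]
    ring

theorem formGauss_sq_sq (hp : ringChar κ ≠ 2) (hψ : ψ.IsPrimitive)
    (τ : Module.Dual κ (QuadraticForm κ V)) :
    formGauss ψ (QuadraticMap.sq : QuadraticForm κ κ) τ ^ 2 =
      (quadChar (-1 : κ) : ℂ) ^ gaussExp τ * (Nat.card κ : ℂ) ^ gaussExp τ := by
  have h := formGauss_sq_mul_neg_sq hp hψ τ
  rw [formGauss_smul_sq hp hψ (neg_ne_zero.2 one_ne_zero)] at h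
  rw [← h]
  have h4 : (quadChar (-1 : κ) : ℂ) ^ 2 = 1 := by
    exact_mod_cast quadChar_sq (κ := κ) (neg_ne_zero.2 one_ne_zero)
  have h5 : ((quadChar (-1 : κ) : ℂ) ^ gaussExp τ) ^ 2 = 1 := by
    rw [← pow_mul, mul_comm, pow_mul, h4, one_pow]
  linear_combination (-formGauss ψ QuadraticMap.sq τ ^ 2) * h5

theorem formGauss_diagonal {m : ℕ} (a : Fin m → κ) (τ : Module.Dual κ (QuadraticForm κ V)) :
    formGauss ψ (QuadraticMap.weightedSumSquares κ a) τ =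
      ∏ i, formGauss ψ (a i • QuadraticMap.sq : QuadraticForm κ κ) τ := by
  have := finite_linearMap κ V κ
  unfold formGauss
  rw [← finsum_prod_pi]
  symm
  refine finsum_eq_of_bijective LinearMap.pi
    ⟨fun φ φ' h => ?_, fun φ => ⟨fun i => LinearMap.proj i ∘ₗ φ, rfl⟩⟩ fun φ => ?_
  · ext i x
    exact congrFun (LinearMap.congr_fun h x) i
  have h0 : ∀ f : Fin m → κ, ψ (∑ i, f i) = ∏ i, ψ (f i) := fun f => by
    have := map_prod ψ.toMonoidHom (fun i => Multiplicative.ofAdd (f i)) Finset.univ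
    rwa [← ofAdd_sum] at this
  rw [← h0, ← map_sum]
  congr 2
  ext x
  simp [QuadraticMap.weightedSumSquares_apply]

theorem quadChar_mul (a b : κ) : quadChar (a * b) = quadChar a * quadChar b := by
  classical
  cases nonempty_fintype κ
  simp only [quadChar_eq, map_mul]

theorem quadChar_one : quadChar (1 : κ) = 1 := by
  classical
  cases nonempty_fintype κ
  simp only [quadChar_eq, map_one]

theorem quadChar_pow (a : κ) (n : ℕ) : quadChar (a ^ n) = quadChar a ^ n := by
  classical
  cases nonempty_fintype κ
  simp only [quadChar_eq, map_pow]

theorem quadChar_prod {ι : Type*} (s : Finset ι) (a : ι → κ) :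
    quadChar (∏ i ∈ s, a i) = ∏ i ∈ s, quadChar (a i) := by
  classical
  cases nonempty_fintype κ
  simp only [quadChar_eq, map_prod]

/-- In odd characteristic, the sign of a nondegenerate quadratic space of dimension `m` is the
quadratic character of its discriminant `(-1) ^ (m choose 2) * det`. -/
theorem gaussType_diagonal {κ : Type u} [Field κ] [Finite κ] {ψ : AddChar κ ℂ}
    (hp : ringChar κ ≠ 2) (hψ : ψ.IsPrimitive) {m b j : ℕ} (hm : m = 2 * j + b)
    (a : Fin m → κ) (ha : ∀ i, a i ≠ 0) (hb : b ≤ 1) {η : ℤˣ}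
    (hη : quadChar ((-1) ^ (m.choose 2) * ∏ i, a i) = η) :
    GaussType ψ (QuadraticMap.weightedSumSquares κ a) b j η := by
  refine ⟨by simp [hm], fun V _ _ _ τ => ?_⟩
  rw [formGauss_diagonal]
  simp only [formGauss_smul_sq hp hψ (ha _)]
  rw [Finset.prod_mul_distrib, Finset.prod_const, Finset.card_univ, Fintype.card_fin]
  have h1 : (η : ℤ) = quadChar (-1 : κ) ^ j * ∏ i, quadChar (a i) := by
    rw [← hη, quadChar_mul, quadChar_prod, quadChar_pow]
    congr 1
    have h2 : quadChar (-1 : κ) ^ 2 = 1 := quadChar_sq (neg_ne_zero.2 one_ne_zero)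
    have h3 : ∃ t, m.choose 2 = 2 * t + j := by
      have h4 := Nat.triangle_succ
      rw [Nat.choose_two_right, hm]
      interval_cases b
      · obtain _ | i := j
        · exact ⟨0, rfl⟩
        · refine ⟨(i + 1) * i, ?_⟩
          rw [Nat.div_eq_of_eq_mul_left two_pos]
          rw [show 2 * (i + 1) + 0 - 1 = 2 * i + 1 by lia]
          ring
      · refine ⟨j * j, ?_⟩
        rw [Nat.div_eq_of_eq_mul_left two_pos]
        rw [show 2 * j + 1 - 1 = 2 * j by lia]
        ring
    obtain ⟨t, ht⟩ := h3
    rw [ht, pow_add, pow_mul, h2, one_pow, one_mul]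
  have h5 := formGauss_sq_sq hp hψ τ
  rw [h1, show formGauss ψ QuadraticMap.sq τ ^ m = _ by rw [hm, pow_add, pow_mul, h5]]
  push_cast
  rw [Finset.prod_pow]
  ring

end OddCharacteristic


/-! ### Norm forms in characteristic two -/

section FreeAction

/-- A sum that is invariant under a free action is divisible by the order of the group. -/
theorem card_dvd_sum_of_free {G X : Type*} [Group G] [Finite G] [Fintype X] [MulAction G X]
    (h : ∀ x : X, MulAction.stabilizer G x = ⊥) (f : X → ℤ) (hf : ∀ (g : G) x, f (g • x) = f x) :
    (Nat.card G : ℤ) ∣ ∑ x, f x := by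
  classical
  have := Fintype.ofFinite G
  let e := MulAction.selfEquivOrbitsQuotientProd h
  have h1 : ∀ x, f x = f (e x).1.out := fun x => by
    have h2 : (e x).1 = Quotient.mk'' x := rfl
    rw [h2]
    obtain ⟨g, hg⟩ : (Quotient.mk'' x : Quotient (MulAction.orbitRel G X)).out ∈
      MulAction.orbit G x := Quotient.mk_out (s := MulAction.orbitRel G X) x
    rw [← hg, hf]
  have h2 : ∑ x, f x = ∑ y : Quotient (MulAction.orbitRel G X) × G, f y.1.out :=
    Fintype.sum_equiv e _ _ h1
  rw [h2, Fintype.sum_prod_type, Nat.card_eq_fintype_card]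
  simp only [Finset.sum_const, Finset.card_univ, nsmul_eq_mul, ← Finset.mul_sum]
  exact dvd_mul_right _ _

end FreeAction

section CharacteristicTwo

variable {κ : Type*} [Field κ] [Finite κ] {ψ : AddChar κ ℂ}
  {V : Type*} [AddCommGroup V] [Module κ V] [Module.Finite κ V]

/-- In characteristic two an additive character takes the values `1` and `-1`. -/
theorem exists_int_addChar [CharP κ 2] (ψ : AddChar κ ℂ) :
    ∃ f : κ → ℤ, ∀ x, ψ x = f x := by
  have h : ∀ x, ∃ n : ℤ, ψ x = n := fun x => by
    have h1 : ψ x * ψ x = 1 := by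
      rw [← AddChar.map_add_eq_mul, CharTwo.add_self_eq_zero, AddChar.map_zero_eq_one]
    obtain h1 | h1 := mul_self_eq_one_iff.1 h1
    · exact ⟨1, by simp [h1]⟩
    · exact ⟨-1, by simp [h1]⟩
  choose f hf using h
  exact ⟨f, hf⟩

/-- The binary quadratic form `a x ^ 2 + b x y + c y ^ 2`. -/
def binaryForm (a b c : κ) : QuadraticForm κ (κ × κ) :=
  a • QuadraticMap.linMulLin (LinearMap.fst κ κ κ) (LinearMap.fst κ κ κ) +
    b • QuadraticMap.linMulLin (LinearMap.fst κ κ κ) (LinearMap.snd κ κ κ) +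
    c • QuadraticMap.linMulLin (LinearMap.snd κ κ κ) (LinearMap.snd κ κ κ)

theorem formGauss_binaryForm (a b c : κ) (τ : Module.Dual κ (QuadraticForm κ V)) :
    formGauss ψ (binaryForm a b c) τ =
      ∑ᶠ z : Module.Dual κ V × Module.Dual κ V, ψ (a * dualBilin τ z.1 z.1 +
        b * dualBilin τ z.1 z.2 + c * dualBilin τ z.2 z.2) := by
  symm
  refine finsum_eq_of_bijective (LinearMap.prodEquiv κ).toEquiv (Equiv.bijective _) fun z => ?_
  congr 1
  have h : (binaryForm a b c).comp (z.1.prod z.2) =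
      a • QuadraticMap.linMulLin z.1 z.1 + b • QuadraticMap.linMulLin z.1 z.2 +
        c • QuadraticMap.linMulLin z.2 z.2 := by
    ext x
    simp [binaryForm]
  rw [show (LinearMap.prodEquiv κ).toEquiv z = z.1.prod z.2 from rfl, h]
  simp only [map_add, map_smul, smul_eq_mul, dualBilin_apply]

/-- In characteristic two the square of the Gauss sum of a nondegenerate binary form `Φ` is the
autocorrelation `∑ s, ∑ z, ψ (Φ z + Φ (z + s))`, in which `Φ z + Φ (z + s)` equals `Φ s` plus a linear
function of `z`. -/
theorem formGauss_binaryForm_sq [CharP κ 2] (hψ : ψ.IsPrimitive) (a : κ) {b : κ} (hb : b ≠ 0)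
    (c : κ) (τ : Module.Dual κ (QuadraticForm κ V)) :
    formGauss ψ (binaryForm a b c) τ ^ 2 = ((Nat.card κ : ℂ) ^ gaussExp τ) ^ 2 := by
  classical
  have := finite_linearMap κ V κ
  cases nonempty_fintype (V →ₗ[κ] κ)
  have : Fintype (Module.Dual κ V) := ‹Fintype (V →ₗ[κ] κ)›
  rw [formGauss_binaryForm, finsum_eq_sum_of_fintype]
  set B := dualBilin τ with hB
  set Φ : Module.Dual κ V × Module.Dual κ V → κ := fun z =>
    a * B z.1 z.1 + b * B z.1 z.2 + c * B z.2 z.2 with hΦ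
  let l : Module.Dual κ V × Module.Dual κ V → (Module.Dual κ V × Module.Dual κ V →ₗ[κ] κ) :=
    fun s => (b • B s.1) ∘ₗ LinearMap.snd _ _ _ + (b • B s.2) ∘ₗ LinearMap.fst _ _ _
  have h2 : (2 : κ) = 0 := CharTwo.two_eq_zero
  have h1 : ∀ z s, Φ z + Φ (z + s) = Φ s + l s z := by
    intro z s
    simp only [hΦ, l, Prod.fst_add, Prod.snd_add, map_add, LinearMap.add_apply,
      LinearMap.comp_apply, LinearMap.smul_apply, LinearMap.fst_apply, LinearMap.snd_apply,
      smul_eq_mul]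
    rw [dualBilin_comm τ z.1 s.1, dualBilin_comm τ z.2 s.2, dualBilin_comm τ z.1 s.2]
    linear_combination (a * B z.1 z.1 + b * B z.1 z.2 + c * B z.2 z.2 + a * B s.1 z.1 +
      c * B s.2 z.2) * h2
  have h3 : ∀ s, l s = 0 ↔ B s.1 = 0 ∧ B s.2 = 0 := by
    intro s
    refine ⟨fun h => ⟨?_, ?_⟩, fun h => by simp [l, h.1, h.2]⟩
    · ext y
      have := LinearMap.congr_fun h (0, y)
      simpa [l, hb] using this
    · ext y
      have := LinearMap.congr_fun h (y, 0)
      simpa [l, hb] using this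
  have h4 : ∀ s, ψ (Φ s) * (∑ z, ψ (l s z)) =
      (if B s.1 = 0 then 1 else 0) * (if B s.2 = 0 then 1 else 0) *
        ((Nat.card κ : ℂ) ^ Module.finrank κ V) ^ 2 := by
    intro s
    rw [← finsum_eq_sum_of_fintype, finsum_addChar_linear hψ, Module.finrank_prod,
      Subspace.dual_finrank_eq, if_congr (h3 s) rfl rfl]
    by_cases h5 : B s.1 = 0
    · by_cases h6 : B s.2 = 0
      · simp [h5, h6, hΦ]
        ring
      · simp [h6]
    · simp [h5]
  have h7 : ∑ s : Module.Dual κ V, (if B s = 0 then (1 : ℂ) else 0) =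
      (Nat.card κ : ℂ) ^ Module.finrank κ (LinearMap.ker B) := by
    rw [Finset.sum_boole, ← Fintype.card_subtype, ← Nat.card_eq_fintype_card]
    have := Module.natCard_eq_pow_finrank (K := κ) (V := LinearMap.ker B)
    exact_mod_cast this
  calc (∑ z, ψ (Φ z)) ^ 2 = ∑ z, ∑ s, ψ (Φ z) * ψ (Φ s) := by rw [sq, Fintype.sum_mul_sum]
    _ = ∑ z, ∑ s, ψ (Φ z) * ψ (Φ (z + s)) :=
      Finset.sum_congr rfl fun z _ => (Fintype.sum_equiv (Equiv.addLeft z) _ _ fun s => rfl).symm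
    _ = ∑ s, ψ (Φ s) * ∑ z, ψ (l s z) := by
      rw [Finset.sum_comm]
      simp only [Finset.mul_sum, ← AddChar.map_add_eq_mul, h1]
    _ = _ := by
      simp only [h4]
      rw [← Finset.sum_mul, Fintype.sum_prod_type]
      refine (congrArg (· * _) (Fintype.sum_mul_sum (fun s => if B s = 0 then (1 : ℂ) else 0)
        (fun s => if B s = 0 then (1 : ℂ) else 0)).symm).trans ?_
      rw [h7, gaussExp]
      ring

/-- The norm form of a quadratic extension of finite fields. -/
def normForm (κ E : Type*) [Field κ] [Field E] [Algebra κ E] [Finite E]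
    (hE : Module.finrank κ E = 2) : QuadraticForm κ E :=
  have hpow : ∀ x : E, algebraMap κ E (Algebra.norm κ x) = x ^ (Nat.card κ + 1) := fun x => by
    have := Finite.of_injective _ (algebraMap κ E).injective
    rw [FiniteField.algebraMap_norm_eq_pow, Module.natCard_eq_pow_finrank (K := κ), hE,
      show Nat.card κ ^ 2 - 1 = (Nat.card κ + 1) * (Nat.card κ - 1) from Nat.sq_sub_sq _ 1,
      Nat.mul_div_cancel _ (Nat.sub_pos_of_lt Finite.one_lt_card)]
  have hadd : ∀ x y : E, (x + y) ^ Nat.card κ = x ^ Nat.card κ + y ^ Nat.card κ := fun x y => by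
    have := Finite.of_injective _ (algebraMap κ E).injective
    have := Fintype.ofFinite κ
    have h := map_add (FiniteField.frobeniusAlgHom κ E) x y
    simpa [← Nat.card_eq_fintype_card] using h
  have hpolar : ∀ x y : E, algebraMap κ E (QuadraticMap.polar (Algebra.norm κ) x y) =
      x ^ Nat.card κ * y + y ^ Nat.card κ * x := fun x y => by
    simp only [QuadraticMap.polar, map_sub, hpow, pow_succ, hadd]
    ring
  have hc : ∀ c : κ, algebraMap κ E c ^ Nat.card κ = algebraMap κ E c := fun c => by
    have := Finite.of_injective _ (algebraMap κ E).injective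
    have := Fintype.ofFinite κ
    rw [← map_pow, Nat.card_eq_fintype_card, FiniteField.pow_card]
  QuadraticMap.ofPolar (Algebra.norm κ)
    (fun c x => by
      rw [Algebra.smul_def, map_mul, Algebra.norm_algebraMap, hE, sq, smul_eq_mul])
    (fun x y z => (algebraMap κ E).injective (by
      rw [map_add, hpolar, hpolar, hpolar, hadd]; ring))
    (fun c x y => (algebraMap κ E).injective (by
      rw [smul_eq_mul, map_mul, hpolar, hpolar, Algebra.smul_def, mul_pow, hc]; ring))

theorem normForm_apply {κ E : Type*} [Field κ] [Field E] [Algebra κ E] [Finite E]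
    (hE : Module.finrank κ E = 2) (x : E) : normForm κ E hE x = Algebra.norm κ x := rfl

/-- In characteristic two the norm form is a binary form with nonzero middle coefficient: otherwise
the norm would be additive, hence injective. -/
theorem exists_normForm_equiv {κ E : Type*} [Field κ] [Field E] [Algebra κ E] [Finite E]
    [CharP κ 2] (hE : Module.finrank κ E = 2) :
    ∃ a b c : κ, b ≠ 0 ∧ Nonempty ((normForm κ E hE).IsometryEquiv (binaryForm a b c)) := by
  have := Finite.of_injective _ (algebraMap κ E).injective
  let v := Module.finBasisOfFinrankEq κ E hE
  have hw : ∀ x y : κ, normForm κ E hE (x • v 0 + y • v 1) =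
      x * x * normForm κ E hE (v 0) + x * y * QuadraticMap.polar (normForm κ E hE) (v 0) (v 1) +
        y * y * normForm κ E hE (v 1) := by
    intro x y
    rw [QuadraticMap.map_add (normForm κ E hE), QuadraticMap.map_smul, QuadraticMap.map_smul,
      QuadraticMap.polar_smul_left, QuadraticMap.polar_smul_right]
    simp only [smul_eq_mul]
    ring
  refine ⟨normForm κ E hE (v 0), QuadraticMap.polar (normForm κ E hE) (v 0) (v 1),
    normForm κ E hE (v 1), fun hb => ?_, ?_⟩
  · have h2 : (2 : κ) = 0 := CharTwo.two_eq_zero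
    have hinj : Function.Injective (Algebra.norm κ : E → κ) := by
      intro x y hxy
      rw [← sub_eq_zero, ← Algebra.norm_eq_zero_iff (R := κ)]
      rw [← normForm_apply hE, ← normForm_apply hE, ← v.sum_repr x, ← v.sum_repr y] at hxy
      rw [← normForm_apply hE]
      conv_lhs => rw [← v.sum_repr x, ← v.sum_repr y]
      simp only [Fin.sum_univ_two] at hxy ⊢
      rw [add_sub_add_comm, ← sub_smul, ← sub_smul]
      rw [hw, hw] at hxy
      rw [hw]
      rw [hb] at hxy ⊢
      linear_combination hxy + (-(v.repr x 0) * v.repr y 0 * normForm κ E hE (v 0)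
        - (v.repr x 1) * v.repr y 1 * normForm κ E hE (v 1) +
        v.repr y 0 * v.repr y 0 * normForm κ E hE (v 0) +
        v.repr y 1 * v.repr y 1 * normForm κ E hE (v 1)) * h2
    have h3 := Nat.card_le_card_of_injective _ hinj
    rw [Module.natCard_eq_pow_finrank (K := κ) (V := E), hE] at h3
    have h4 : 1 < Nat.card κ := Finite.one_lt_card
    nlinarith
  · refine ⟨⟨v.equivFun.trans (LinearEquiv.finTwoArrow κ κ), fun x => ?_⟩⟩
    conv_rhs => rw [← v.sum_repr x, Fin.sum_univ_two]
    change binaryForm _ _ _ (v.repr x 0, v.repr x 1) = _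
    have := hw (v.repr x 0) (v.repr x 1)
    refine Eq.trans ?_ this.symm
    simp [binaryForm]
    ring

/-- In characteristic two the norm form of the quadratic extension has sign `-1`. Its Gauss sum is a
square root of `q ^ (2 e)`, and it is congruent to `1` modulo `q + 1`, because the group of norm one
elements, which has `q + 1` elements, acts freely on the nonzero linear maps. -/
theorem exists_gaussType_neg_two {κ : Type u} [Field κ] [Finite κ] {ψ : AddChar κ ℂ}
    (hκ : ringChar κ = 2) (hψ : ψ.IsPrimitive) :
    ∃ w : QuadraticForm κ (Fin (2 * 1 + 0) → κ), GaussType ψ w 0 1 (-1) := by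
  have hc : CharP κ 2 := hκ ▸ ringChar.charP κ
  have hp : Fact (Nat.Prime 2) := ⟨Nat.prime_two⟩
  let E := FiniteField.Extension κ 2 2
  have hE : Module.finrank κ E = 2 := FiniteField.finrank_extension κ 2 2
  refine GaussType.exists_fin (w := normForm κ E hE) ⟨hE, fun V _ _ _ τ => ?_⟩
  obtain ⟨f, hf⟩ := exists_int_addChar ψ
  have := finite_linearMap κ V E
  have := Fintype.ofFinite (V →ₗ[κ] E)
  classical
  let G : Subgroup Eˣ := (Units.map (Algebra.norm κ : E →* κ)).ker
  have hG : Nat.card G = Nat.card κ + 1 := by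
    have h1 := G.card_mul_index
    rw [Subgroup.index_ker, MonoidHom.range_eq_top.2 (FiniteField.unitsMap_norm_surjective κ E),
      Subgroup.card_top, Nat.card_units, Nat.card_units,
      Module.natCard_eq_pow_finrank (K := κ) (V := E), hE,
      show Nat.card κ ^ 2 - 1 = (Nat.card κ + 1) * (Nat.card κ - 1) from Nat.sq_sub_sq _ 1] at h1
    exact Nat.eq_of_mul_eq_mul_right (Nat.sub_pos_of_lt Finite.one_lt_card) h1
  let X := {φ : V →ₗ[κ] E // φ ≠ 0}
  have hG1 : ∀ g : G, Algebra.norm κ ((g : Eˣ) : E) = 1 := fun g => by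
    have := MonoidHom.mem_ker.1 g.2
    exact congrArg Units.val this
  let act : MulAction G X :=
    { smul := fun g φ => ⟨((g : Eˣ) : E) • φ.1, smul_ne_zero (g : Eˣ).ne_zero φ.2⟩
      one_smul := fun φ => Subtype.ext (one_smul E φ.1)
      mul_smul := fun g g' φ => Subtype.ext (mul_smul ((g : Eˣ) : E) ((g' : Eˣ) : E) φ.1) }
  have hsm : ∀ (g : G) (φ : X), (g • φ).1 = ((g : Eˣ) : E) • φ.1 := fun g φ => rfl
  have hfree : ∀ φ : X, MulAction.stabilizer G φ = ⊥ := by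
    intro φ
    rw [eq_bot_iff]
    intro g hg
    have h1 : ((g : Eˣ) : E) • φ.1 = φ.1 := by
      rw [← hsm, MulAction.mem_stabilizer_iff.1 hg]
    obtain ⟨x, hx⟩ : ∃ x, φ.1 x ≠ 0 := by
      by_contra! h
      exact φ.2 (LinearMap.ext h)
    have h3 : ((g : Eˣ) : E) = 1 :=
      mul_right_cancel₀ hx ((LinearMap.congr_fun h1 x).trans (one_mul _).symm)
    exact Subgroup.mem_bot.2 (Subtype.ext (Units.ext h3))
  have hdvd := card_dvd_sum_of_free hfree (fun φ => f (τ ((normForm κ E hE).comp φ.1))) (by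
    intro g φ
    congr 2
    ext x
    simp only [QuadraticMap.comp_apply, normForm_apply, hsm, LinearMap.smul_apply, smul_eq_mul,
      map_mul, hG1, one_mul])
  rw [hG] at hdvd
  -- `t` is the sum over orbits of nonzero maps, and the zero map contributes `1`
  obtain ⟨t, ht⟩ := hdvd
  set q := Nat.card κ with hq
  set e := gaussExp τ with he
  have hsum : formGauss ψ (normForm κ E hE) τ = ((1 + (q + 1 : ℕ) * t : ℤ) : ℂ) := by
    rw [formGauss, finsum_eq_sum_of_fintype, ← ht]
    simp only [hf]
    rw [← Int.cast_sum, ← Fintype.sum_subtype_add_sum_subtype (fun φ : V →ₗ[κ] E => φ ≠ 0)]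
    rw [add_comm]
    congr 2
    have h1 : f 0 = 1 := by
      have := hf 0
      rw [AddChar.map_zero_eq_one] at this
      exact_mod_cast this.symm
    have : Unique {φ : V →ₗ[κ] E // ¬ φ ≠ 0} :=
      ⟨⟨⟨0, by simp⟩⟩, fun φ => Subtype.ext (not_not.1 φ.2)⟩
    rw [Fintype.sum_unique]
    have h2 : (normForm κ E hE).comp (default : {φ : V →ₗ[κ] E // ¬ φ ≠ 0}).1 = 0 := by
      have : (default : {φ : V →ₗ[κ] E // ¬ φ ≠ 0}).1 = 0 :=
        not_not.1 (default : {φ : V →ₗ[κ] E // ¬ φ ≠ 0}).2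
      rw [this]
      ext x
      simp
    rw [h2, map_zero, h1]
  obtain ⟨a, b, c, hb, ⟨iso⟩⟩ := exists_normForm_equiv hE
  have hsq := formGauss_binaryForm_sq hψ a hb c τ
  rw [← formGauss_congr iso, hsum, ← hq, ← he] at hsq
  have hsq' : (1 + ((q + 1 : ℕ) : ℤ) * t) ^ 2 = ((q : ℤ) ^ e) ^ 2 := by exact_mod_cast hsq
  have hq1 : 1 < q := Finite.one_lt_card
  have hmod : (q : ℤ) ^ e ≡ (-1) ^ e [ZMOD ((q + 1 : ℕ) : ℤ)] :=
    Int.ModEq.pow _ (Int.modEq_iff_dvd.2 ⟨-1, by push_cast; ring⟩)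
  have hmod1 : 1 + ((q + 1 : ℕ) : ℤ) * t ≡ 1 [ZMOD ((q + 1 : ℕ) : ℤ)] :=
    Int.modEq_iff_dvd.2 ⟨-t, by ring⟩
  -- the square determines the Gauss sum up to sign; `q ≡ -1` modulo `q + 1`, which does not divide
  -- `2`, so the congruence to `1` determines the sign
  have hfin : 1 + ((q + 1 : ℕ) : ℤ) * t = (-1) ^ e * (q : ℤ) ^ e := by
    have hbad : ¬ ((q + 1 : ℕ) : ℤ) ∣ 2 := fun h => by
      have := Int.le_of_dvd two_pos h
      lia
    obtain h | h := sq_eq_sq_iff_eq_or_eq_neg.1 hsq' <;> obtain h1 | h1 := neg_one_pow_eq_or ℤ e <;>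
      rw [h1] at hmod ⊢
    · rw [h, one_mul]
    · rw [h] at hmod1
      exact absurd ((hmod.symm.trans hmod1).dvd) (by norm_num; exact_mod_cast hbad)
    · rw [h] at hmod1
      have h3 := ((hmod.neg.symm.trans hmod1).dvd)
      exact absurd h3 (by norm_num; exact_mod_cast hbad)
    · rw [h]; ring
  rw [hsum, hfin]
  push_cast
  simp

end CharacteristicTwo


/-! ### Counting isometric embeddings over a finite field -/

section Moebius

variable {κ V : Type*} [Field κ] [Finite κ] [AddCommGroup V] [Module κ V] [Module.Finite κ V]

theorem finite_submodule (κ V : Type*) [Field κ] [Finite κ] [AddCommGroup V] [Module κ V]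
    [Module.Finite κ V] : Finite (Submodule κ V) :=
  have := finite_of_module κ V
  Finite.of_injective _ SetLike.coe_injective

/-- The Möbius function `μ (⊥, K)` of the lattice of subspaces of a finite vector space. -/
def moebius (K : Submodule κ V) : ℤ :=
  have := finite_submodule κ V
  have := Fintype.ofFinite (Submodule κ V)
  open scoped Classical in
  have : LocallyFiniteOrder (Submodule κ V) := Fintype.toLocallyFiniteOrder
  IncidenceAlgebra.mu ℤ ⊥ K

theorem sum_moebius [Fintype (Submodule κ V)] [DecidableEq (Submodule κ V)]
    [DecidableLE (Submodule κ V)] (U : Submodule κ V) :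
    ∑ K : Submodule κ V, (if K ≤ U then moebius K else 0) = if U = ⊥ then 1 else 0 := by
  classical
  let : LocallyFiniteOrder (Submodule κ V) := Fintype.toLocallyFiniteOrder
  have h := IncidenceAlgebra.sum_Icc_mu_right (𝕜 := ℤ) (⊥ : Submodule κ V) U
  rw [← Finset.sum_filter]
  have h1 : Finset.univ.filter (fun K => K ≤ U) = Finset.Icc ⊥ U := by
    ext K
    simp
  rw [h1]
  simp only [eq_comm (a := U)]
  rw [← h]
  refine Finset.sum_congr rfl fun K _ => ?_
  unfold moebius
  dsimp only
  congr!

theorem moebius_bot : moebius (⊥ : Submodule κ V) = 1 := by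
  classical
  have := finite_submodule κ V
  have := Fintype.ofFinite (Submodule κ V)
  have h := sum_moebius (⊥ : Submodule κ V)
  simpa using h

end Moebius

section Counting

universe u

variable {κ : Type u} [Field κ] [Finite κ] {ψ : AddChar κ ℂ}
  {V : Type u} [AddCommGroup V] [Module κ V] [Module.Finite κ V]
  {W : Type*} [AddCommGroup W] [Module κ W] [Module.Finite κ W]

/-- The functional on quadratic forms on `V / K` induced by one on quadratic forms on `V`. -/
def quotDual (K : Submodule κ V) (τ : Module.Dual κ (QuadraticForm κ V)) :
    Module.Dual κ (QuadraticForm κ (V ⧸ K)) where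
  toFun R := τ (R.comp K.mkQ)
  map_add' R R' := by rw [← map_add]; congr 1
  map_smul' c R := by rw [RingHom.id_apply, ← map_smul]; congr 1

/-- The isometric maps that vanish on `K`, counted by Fourier inversion on the space of quadratic
forms on `V`. -/
theorem card_isometry_ker (hψ : ψ.IsPrimitive) (w : QuadraticForm κ W) (Q : QuadraticForm κ V)
    (K : Submodule κ V) :
    (Nat.card κ : ℂ) ^ Module.finrank κ (QuadraticForm κ V) *
      Nat.card {φ : V →ₗ[κ] W // K ≤ LinearMap.ker φ ∧ w.comp φ = Q} =
    ∑ᶠ τ : Module.Dual κ (QuadraticForm κ V), ψ (-τ Q) * formGauss ψ w (quotDual K τ) := by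
  classical
  have := finite_linearMap κ V W
  have := finite_linearMap κ (V ⧸ K) W
  have := Fintype.ofFinite (V →ₗ[κ] W)
  have := Fintype.ofFinite ((V ⧸ K) →ₗ[κ] W)
  have := finite_linearMap κ (QuadraticForm κ V) κ
  have : Fintype (Module.Dual κ (QuadraticForm κ V)) :=
    Fintype.ofFinite (QuadraticForm κ V →ₗ[κ] κ)
  simp only [formGauss, finsum_eq_sum_of_fintype]
  have h1 : ∀ R : QuadraticForm κ V, ∑ τ : Module.Dual κ (QuadraticForm κ V), ψ (τ R) =
      if R = 0 then (Nat.card κ : ℂ) ^ Module.finrank κ (QuadraticForm κ V) else 0 := fun R => by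
    rw [← finsum_eq_sum_of_fintype]
    have h := finsum_addChar_linear hψ (Module.Dual.eval κ (QuadraticForm κ V) R)
    rw [Subspace.dual_finrank_eq] at h
    refine h.trans (if_congr ?_ rfl rfl)
    exact Module.eval_apply_eq_zero_iff κ R
  have h2 : ∀ τ : Module.Dual κ (QuadraticForm κ V),
      ψ (-τ Q) * ∑ φ : (V ⧸ K) →ₗ[κ] W, ψ (quotDual K τ (w.comp φ)) =
      ∑ φ : {φ : V →ₗ[κ] W // K ≤ LinearMap.ker φ}, ψ (τ (w.comp φ.1 - Q)) := fun τ => by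
    rw [Finset.mul_sum]
    symm
    let e : {φ : V →ₗ[κ] W // K ≤ LinearMap.ker φ} ≃ ((V ⧸ K) →ₗ[κ] W) :=
      { toFun := fun φ => K.liftQ φ.1 φ.2
        invFun := fun φ => ⟨φ ∘ₗ K.mkQ, fun x hx => by simp [(Submodule.Quotient.mk_eq_zero K).2 hx]⟩
        left_inv := fun φ => Subtype.ext (LinearMap.ext fun x => rfl)
        right_inv := fun φ => Submodule.linearMap_qext K (LinearMap.ext fun x => rfl) }
    refine Fintype.sum_equiv e _ _ fun φ => ?_
    rw [← AddChar.map_add_eq_mul, sub_eq_add_neg, map_add, map_neg, add_comm]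
    rfl
  simp only [h2]
  rw [Finset.sum_comm]
  simp only [h1, sub_eq_zero]
  rw [← Finset.sum_filter, Finset.sum_const, nsmul_eq_mul, mul_comm]
  congr 2
  rw [← Fintype.card_subtype, ← Nat.card_eq_fintype_card]
  exact Nat.card_congr (Equiv.subtypeSubtypeEquivSubtypeInter _ _).symm

/-- The polynomial, in the variable `η q ^ (-j)`, which counts the isometric embeddings of `(V, Q)`
into the spaces of Gauss type `(b, j, η)`, up to a power of `q`. -/
def isoPoly (ψ : AddChar κ ℂ) (Q : QuadraticForm κ V) (b : ℕ) : ℝ[X] :=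
  ∑ᶠ K : Submodule κ V, ∑ᶠ τ : Module.Dual κ (QuadraticForm κ V),
    C ((moebius K : ℝ) * (ψ (-τ Q) *
      formGauss ψ (QuadraticMap.sq : QuadraticForm κ κ) (quotDual K τ) ^ b).re) *
      X ^ (2 * Module.finrank κ V - gaussExp (quotDual K τ))

/-- The number of isometric embeddings depends on the target only through its Gauss type. -/
theorem card_injective_isometry (hψ : ψ.IsPrimitive) {w : QuadraticForm κ W}
    (Q : QuadraticForm κ V) {b j : ℕ} {η : ℤˣ} (hw : GaussType ψ w b j η) :
    (Nat.card κ : ℝ) ^ Module.finrank κ (QuadraticForm κ V) *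
      Nat.card {φ : V →ₗ[κ] W // Function.Injective φ ∧ w.comp φ = Q} =
    (Nat.card κ : ℝ) ^ (2 * Module.finrank κ V * j) *
      (isoPoly ψ Q b).eval ((η : ℤ) * ((Nat.card κ : ℝ) ^ j)⁻¹) := by
  classical
  have := finite_linearMap κ V W
  have := Fintype.ofFinite (V →ₗ[κ] W)
  have := finite_linearMap κ (QuadraticForm κ V) κ
  have : Fintype (Module.Dual κ (QuadraticForm κ V)) :=
    Fintype.ofFinite (QuadraticForm κ V →ₗ[κ] κ)
  have := finite_submodule κ V
  have := Fintype.ofFinite (Submodule κ V)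
  -- Möbius inversion: `∑ K ≤ ker φ, μ (⊥, K)` is `1` if `φ` is injective and `0` otherwise
  have h1 : (Nat.card {φ : V →ₗ[κ] W // Function.Injective φ ∧ w.comp φ = Q} : ℤ) =
      ∑ K : Submodule κ V, moebius K *
        Nat.card {φ : V →ₗ[κ] W // K ≤ LinearMap.ker φ ∧ w.comp φ = Q} := by
    have h2 : ∀ K : Submodule κ V,
        (Nat.card {φ : V →ₗ[κ] W // K ≤ LinearMap.ker φ ∧ w.comp φ = Q} : ℤ) =
        ∑ φ : V →ₗ[κ] W, if w.comp φ = Q then (if K ≤ LinearMap.ker φ then 1 else 0) else 0 := by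
      intro K
      rw [Nat.card_eq_fintype_card, Fintype.card_subtype, Finset.card_filter]
      push_cast
      refine Finset.sum_congr rfl fun φ _ => ?_
      split_ifs <;> simp_all
    simp only [h2, Finset.mul_sum]
    rw [Finset.sum_comm, Nat.card_eq_fintype_card, Fintype.card_subtype, Finset.card_filter]
    push_cast
    refine Finset.sum_congr rfl fun φ _ => ?_
    have h3 := sum_moebius (LinearMap.ker φ)
    by_cases h4 : w.comp φ = Q
    · simp only [h4, if_true, mul_ite, mul_one, mul_zero, h3, and_true, LinearMap.ker_eq_bot]
    · simp [h4]
  have hq : (Nat.card κ : ℝ) ≠ 0 := by exact_mod_cast (Nat.card_pos (α := κ)).ne'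
  have hη : ((η : ℤ) : ℝ) ^ 2 = 1 := by
    obtain h | h := Int.units_eq_one_or η <;> simp [h]
  -- the Gauss sum at `τ` contributes the power `(η q ^ j) ^ gaussExp`, and `η ^ 2 = 1` turns it into
  -- `q ^ (2 n j)` times a power of `η q ^ (-j)`, where `n` is the dimension of `V`
  have h5 : ∀ (K : Submodule κ V) (τ : Module.Dual κ (QuadraticForm κ V)),
      (ψ (-τ Q) * formGauss ψ w (quotDual K τ)).re =
        (Nat.card κ : ℝ) ^ (2 * Module.finrank κ V * j) * ((ψ (-τ Q) *
          formGauss ψ (QuadraticMap.sq : QuadraticForm κ κ) (quotDual K τ) ^ b).re *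
          (((η : ℤ) : ℝ) * ((Nat.card κ : ℝ) ^ j)⁻¹) ^
            (2 * Module.finrank κ V - gaussExp (quotDual K τ))) := by
    intro K τ
    have h6 : gaussExp (quotDual K τ) ≤ 2 * Module.finrank κ V :=
      (gaussExp_le _).trans (Nat.mul_le_mul_left _ (Submodule.finrank_quotient_le K))
    have h7 : (((η : ℤ) : ℝ) * (Nat.card κ : ℝ) ^ j) ^ gaussExp (quotDual K τ) =
        (Nat.card κ : ℝ) ^ (2 * Module.finrank κ V * j) *
        (((η : ℤ) : ℝ) * ((Nat.card κ : ℝ) ^ j)⁻¹) ^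
            (2 * Module.finrank κ V - gaussExp (quotDual K τ)) := by
      obtain ⟨c, hc⟩ := Nat.exists_eq_add_of_le h6
      have h8 : ((η : ℤ) : ℝ) * ((Nat.card κ : ℝ) ^ j)⁻¹ =
          (((η : ℤ) : ℝ) * (Nat.card κ : ℝ) ^ j)⁻¹ := by
        have : ((η : ℤ) : ℝ)⁻¹ = (η : ℤ) := by
          obtain h | h := Int.units_eq_one_or η <;> simp [h]
        rw [mul_inv, this]
      have h9 : (((η : ℤ) : ℝ) * (Nat.card κ : ℝ) ^ j) ^ (2 * Module.finrank κ V) =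
          (Nat.card κ : ℝ) ^ (2 * Module.finrank κ V * j) := by
        rw [mul_pow, pow_mul, hη, one_pow, one_mul, ← pow_mul, mul_comm j]
      have h10 : ((η : ℤ) : ℝ) * (Nat.card κ : ℝ) ^ j ≠ 0 :=
        mul_ne_zero (fun h => by rw [h] at hη; norm_num at hη) (pow_ne_zero _ hq)
      rw [h8, ← h9, hc, Nat.add_sub_cancel_left, pow_add, inv_pow, mul_assoc,
        mul_inv_cancel₀ (pow_ne_zero _ h10), mul_one]
    have h11 : ψ (-τ Q) * formGauss ψ w (quotDual K τ) =
        (((((η : ℤ) : ℝ) * (Nat.card κ : ℝ) ^ j) ^ gaussExp (quotDual K τ) : ℝ) : ℂ) * (ψ (-τ Q) *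
          formGauss ψ (QuadraticMap.sq : QuadraticForm κ κ) (quotDual K τ) ^ b) := by
      rw [hw.2]
      push_cast
      ring
    rw [h11, Complex.re_ofReal_mul, h7]
    ring
  have h12 : ∀ K : Submodule κ V, (Nat.card κ : ℝ) ^ Module.finrank κ (QuadraticForm κ V) *
      Nat.card {φ : V →ₗ[κ] W // K ≤ LinearMap.ker φ ∧ w.comp φ = Q} =
      ∑ τ : Module.Dual κ (QuadraticForm κ V), (ψ (-τ Q) * formGauss ψ w (quotDual K τ)).re := by
    intro K
    have h := congrArg Complex.re (card_isometry_ker hψ w Q K)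
    rw [finsum_eq_sum_of_fintype, Complex.re_sum] at h
    rw [← h]
    norm_cast
  have h13 : (Nat.card {φ : V →ₗ[κ] W // Function.Injective φ ∧ w.comp φ = Q} : ℝ) =
      ∑ K : Submodule κ V, (moebius K : ℝ) *
        Nat.card {φ : V →ₗ[κ] W // K ≤ LinearMap.ker φ ∧ w.comp φ = Q} := by exact_mod_cast h1
  rw [h13, Finset.mul_sum, isoPoly]
  simp only [finsum_eq_sum_of_fintype, eval_finsetSum, eval_mul, eval_C, eval_pow, eval_X]
  rw [Finset.mul_sum]
  refine Finset.sum_congr rfl fun K _ => ?_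
  rw [mul_left_comm, h12, Finset.mul_sum, Finset.mul_sum]
  refine Finset.sum_congr rfl fun τ _ => ?_
  rw [h5]
  ring

/-- The counting polynomial vanishes at the spaces whose dimension is too small. -/
theorem isoPoly_eval_eq_zero (hψ : ψ.IsPrimitive) (Q : QuadraticForm κ V) {b j : ℕ} {η : ℤˣ}
    (hw : ∃ w : QuadraticForm κ (Fin (2 * j + b) → κ), GaussType ψ w b j η)
    (h : 2 * j + b < Module.finrank κ V) :
    (isoPoly ψ Q b).eval ((η : ℤ) * ((Nat.card κ : ℝ) ^ j)⁻¹) = 0 := by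
  obtain ⟨w, hw⟩ := hw
  have h1 := card_injective_isometry hψ Q hw
  have : IsEmpty {φ : V →ₗ[κ] (Fin (2 * j + b) → κ) // Function.Injective φ ∧ w.comp φ = Q} := by
    refine ⟨fun φ => ?_⟩
    have := LinearMap.finrank_le_finrank_of_injective φ.2.1
    simp at this
    lia
  have h0 : Nat.card {φ : V →ₗ[κ] (Fin (2 * j + b) → κ) // Function.Injective φ ∧
    w.comp φ = Q} = 0 := Nat.card_of_isEmpty
  rw [h0] at h1
  have hq : (Nat.card κ : ℝ) ≠ 0 := by exact_mod_cast (Nat.card_pos (α := κ)).ne'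
  rw [Nat.cast_zero, mul_zero] at h1
  exact (mul_eq_zero.1 h1.symm).resolve_left (pow_ne_zero _ hq)

theorem exists_gaussType_zero :
    ∃ w : QuadraticForm κ (Fin (2 * 0 + 0) → κ), GaussType ψ w 0 0 1 :=
  have : Subsingleton (Fin (2 * 0 + 0) → κ) := inferInstanceAs (Subsingleton (Fin 0 → κ))
  ⟨0, gaussType_of_subsingleton _⟩

theorem exists_quadChar (hp : ringChar κ ≠ 2) (η : ℤˣ) : ∃ a : κ, a ≠ 0 ∧ quadChar a = η := by
  classical
  cases nonempty_fintype κ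
  obtain h | h := Int.units_eq_one_or η
  · exact ⟨1, one_ne_zero, by simp [quadChar_one, h]⟩
  · obtain ⟨a, ha⟩ := FiniteField.exists_nonsquare hp
    refine ⟨a, fun h0 => ha (by simp [h0]), ?_⟩
    rw [quadChar_eq, h, quadraticChar_neg_one_iff_not_isSquare.2 ha]
    rfl

theorem exists_gaussType_even (hψ : ψ.IsPrimitive) {j : ℕ} (hj : 1 ≤ j) (η : ℤˣ) :
    ∃ w : QuadraticForm κ (Fin (2 * j + 0) → κ), GaussType ψ w 0 j η := by
  obtain ⟨i, rfl⟩ := Nat.exists_eq_add_of_le hj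
  refine exists_gaussType_add hψ ?_ i
  by_cases hp : ringChar κ = 2
  · obtain rfl | rfl := Int.units_eq_one_or η
    · exact (gaussType_hyperbolicPlane hψ).exists_fin
    · exact exists_gaussType_neg_two hp hψ
  · obtain ⟨a, ha, hη⟩ := exists_quadChar hp η
    refine ⟨_, gaussType_diagonal hp hψ rfl ![-1, a] ?_ zero_le_one ?_⟩
    · intro i
      fin_cases i <;> simp [ha]
    · rw [← hη]
      simp

theorem exists_gaussType_odd (hp : ringChar κ ≠ 2) (hψ : ψ.IsPrimitive) (j : ℕ) (η : ℤˣ) :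
    ∃ w : QuadraticForm κ (Fin (2 * j + 1) → κ), GaussType ψ w 1 j η := by
  have := exists_gaussType_add hψ (b := 1) (j := 0) (η := η) ?_ j
  · rwa [zero_add] at this
  obtain ⟨a, ha, hη⟩ := exists_quadChar hp η
  exact ⟨_, gaussType_diagonal hp hψ rfl (fun _ => a) (fun _ => ha) le_rfl (by simp [hη])⟩

/-- The functional `R ↦ t R (1)` on the quadratic forms on `κ`. -/
def evalDual (t : κ) : Module.Dual κ (QuadraticForm κ κ) where
  toFun R := t * R 1
  map_add' R R' := by simp [mul_add]
  map_smul' c R := by simp [mul_left_comm]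

theorem evalDual_apply (t : κ) (R : QuadraticForm κ κ) : evalDual t R = t * R 1 := rfl

theorem gaussExp_evalDual {t : κ} (ht : t ≠ 0) : gaussExp (evalDual t) = 1 := by
  have h : LinearMap.ker (dualBilin (evalDual t)) = ⊥ := by
    rw [LinearMap.ker_eq_bot']
    intro l hl
    have h1 := LinearMap.congr_fun hl LinearMap.id
    rw [dualBilin_apply, evalDual_apply] at h1
    ext
    simpa [ht] using h1
  rw [gaussExp, h]
  simp

theorem gaussExp_evalDual_zero : gaussExp (evalDual (0 : κ)) = 2 := by
  have h : LinearMap.ker (dualBilin (evalDual (0 : κ))) = ⊤ := by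
    rw [LinearMap.ker_eq_top]
    ext
    simp [dualBilin_apply, evalDual_apply]
  rw [gaussExp, h, finrank_top, Subspace.dual_finrank_eq]
  simp

theorem formGauss_evalDual (w : QuadraticForm κ W) (t : κ) :
    formGauss ψ w (evalDual t) = ∑ᶠ x : W, ψ (t * w x) := by
  refine finsum_eq_of_bijective (fun φ => φ 1) (LinearMap.ringLmapEquivSelf κ κ W).bijective
    fun φ => rfl

theorem card_norm_eq (hψ : ψ.IsPrimitive) (w : QuadraticForm κ W) (N : κ) [Fintype κ] :
    (Nat.card κ : ℂ) * Nat.card {x : W // w x = N} =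
      ∑ t : κ, ψ (-(t * N)) * formGauss ψ w (evalDual t) := by
  classical
  have := finite_of_module κ W
  have := Fintype.ofFinite W
  have h : ∀ t : κ, ψ (-(t * N)) * formGauss ψ w (evalDual t) =
      ∑ x : W, ψ (t * (w x - N)) := fun t => by
    rw [formGauss_evalDual, finsum_eq_sum_of_fintype, Finset.mul_sum]
    refine Finset.sum_congr rfl fun x _ => ?_
    rw [← AddChar.map_add_eq_mul]
    congr 1
    ring
  simp only [h]
  rw [Finset.sum_comm]
  simp only [AddChar.sum_mulShift _ hψ, sub_eq_zero, Nat.cast_ite, Nat.cast_zero]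
  rw [← Finset.sum_filter, Finset.sum_const, nsmul_eq_mul, mul_comm, ← Fintype.card_subtype,
    ← Nat.card_eq_fintype_card, ← Nat.card_eq_fintype_card]

theorem GaussType.card_norm_eq (hψ : ψ.IsPrimitive) {w : QuadraticForm κ W} {b j : ℕ} {η : ℤˣ}
    (hw : GaussType ψ w b j η) (N : κ) [Fintype κ] [DecidableEq κ] :
    (Nat.card κ : ℂ) * Nat.card {x : W // w x = N} = (Nat.card κ : ℂ) ^ (2 * j + b) +
      (η : ℤ) * (Nat.card κ : ℂ) ^ j * ∑ t ∈ {(0 : κ)}ᶜ, ψ (-(t * N)) *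
        formGauss ψ (QuadraticMap.sq : QuadraticForm κ κ) (evalDual t) ^ b := by
  have hη : ((η : ℤ) : ℂ) ^ 2 = 1 := by
    obtain h | h := Int.units_eq_one_or η <;> simp [h]
  rw [LocalDensity.card_norm_eq hψ, Fintype.sum_eq_add_sum_compl (0 : κ), hw.2, formGauss_evalDual,
    gaussExp_evalDual_zero, hη, Finset.mul_sum]
  congr 1
  · rw [finsum_eq_sum_of_fintype]
    simp
    ring
  · refine Finset.sum_congr rfl fun t ht => ?_
    rw [hw.2, gaussExp_evalDual (by simpa using ht)]
    ring

/-- The number of vectors of given norm in a quadratic space of even dimension. -/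
theorem GaussType.card_norm_eq_even (hψ : ψ.IsPrimitive) {w : QuadraticForm κ W} {j : ℕ} {η : ℤˣ}
    (hw : GaussType ψ w 0 j η) (N : κ) [Decidable (N = 0)] :
    (Nat.card κ : ℝ) * Nat.card {x : W // w x = N} = (Nat.card κ : ℝ) ^ (2 * j) +
      (η : ℤ) * (Nat.card κ : ℝ) ^ j * ((if N = 0 then (Nat.card κ : ℝ) else 0) - 1) := by
  classical
  cases nonempty_fintype κ
  have h := hw.card_norm_eq hψ N
  have h1 : ∑ t ∈ {(0 : κ)}ᶜ, ψ (-(t * N)) =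
      (if N = 0 then (Nat.card κ : ℂ) else 0) - 1 := by
    have h2 := AddChar.sum_mulShift (-N) hψ
    simp only [mul_neg, neg_eq_zero, Nat.cast_ite, Nat.cast_zero] at h2
    rw [Nat.card_eq_fintype_card, ← h2, Fintype.sum_eq_add_sum_compl (0 : κ)]
    simp
  simp only [pow_zero, mul_one, h1, add_zero] at h
  exact_mod_cast h

/-- The number of vectors of given norm in a quadratic space of odd dimension. -/
theorem GaussType.card_norm_eq_odd (hp : ringChar κ ≠ 2) (hψ : ψ.IsPrimitive)
    {w : QuadraticForm κ W} {j : ℕ} {η : ℤˣ} (hw : GaussType ψ w 1 j η) (N : κ) :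
    (Nat.card κ : ℝ) * Nat.card {x : W // w x = N} = (Nat.card κ : ℝ) ^ (2 * j + 1) +
      (η : ℤ) * (Nat.card κ : ℝ) ^ j * (Nat.card κ * quadChar N) := by
  classical
  cases nonempty_fintype κ
  have h := hw.card_norm_eq hψ N
  have h1 : ∑ t ∈ {(0 : κ)}ᶜ, ψ (-(t * N)) *
      formGauss ψ (QuadraticMap.sq : QuadraticForm κ κ) (evalDual t) =
      Nat.card κ * quadChar N := by
    have h2 := LocalDensity.card_norm_eq hψ (QuadraticMap.sq : QuadraticForm κ κ) N
    rw [Fintype.sum_eq_add_sum_compl (0 : κ), formGauss_evalDual, finsum_eq_sum_of_fintype] at h2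
    have h3 := quadraticChar_card_sqrts hp N
    have h4 : ({x : κ | x ^ 2 = N} : Set κ).toFinset.card =
        Nat.card {x : κ // QuadraticMap.sq (R := κ) x = N} := by
      rw [Nat.card_eq_fintype_card, Fintype.card_subtype]
      congr 1
      ext
      simp [sq]
    rw [h4, ← quadChar_eq] at h3
    have h5 : (Nat.card {x : κ // QuadraticMap.sq (R := κ) x = N} : ℂ) = quadChar N + 1 := by
      exact_mod_cast h3
    rw [h5] at h2
    simp only [zero_mul, neg_zero, AddChar.map_zero_eq_one, one_mul, Finset.sum_const,
      Finset.card_univ, nsmul_eq_mul, mul_one, ← Nat.card_eq_fintype_card] at h2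
    linear_combination -h2
  simp only [pow_one, h1] at h
  exact_mod_cast h

end Counting

section NormalizingFactor

variable {q : ℝ}

theorem isCoprime_one_sub_C {a b : ℝ} (hab : a ≠ b) (f : ℝ[X]) :
    IsCoprime (1 - C a * f) (1 - C b * f) := by
  have h : a - b ≠ 0 := sub_ne_zero.2 hab
  refine ⟨C (-b / (a - b)), C (a / (a - b)), ?_⟩
  have h1 : -b / (a - b) + a / (a - b) = 1 := by field_simp; ring
  have h2 : -b / (a - b) * a + a / (a - b) * b = 0 := by ring
  calc _ = C (-b / (a - b) + a / (a - b)) - C (-b / (a - b) * a + a / (a - b) * b) * f := by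
        simp only [C_add, C_mul]; ring
    _ = 1 := by rw [h1, h2]; simp

theorem one_sub_C_mul_X_dvd {c : ℝ} (hc : c ≠ 0) {p : ℝ[X]} (h : p.eval c⁻¹ = 0) :
    1 - C c * X ∣ p := by
  have h1 : 1 - C c * X = C (-c) * (X - C c⁻¹) := by
    rw [mul_sub, ← C_mul, neg_mul, mul_inv_cancel₀ hc]
    simp
    ring
  rw [h1]
  exact ((isUnit_C.2 (neg_ne_zero.2 hc).isUnit).mul_left_dvd).2 (dvd_iff_isRoot.2 h)

/-- Zeros of a polynomial which make it divisible by the normalizing factor. -/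
theorem nor_dvd (O : Type*) [CommRing O] [IsLocalRing O] (hq : 1 < residueCard O) (ε : ℤˣ) (n : ℕ)
    {p : ℝ[X]} (h0 : Odd n → p.eval ((ε : ℤ) * residueCard O ^ ((n + 1) / 2)) = 0)
    (h1 : ∀ i, 1 ≤ i → 2 * i < n + 1 → ∀ η : ℤˣ, p.eval ((η : ℤ) * residueCard O ^ i) = 0) :
    nor O ε n ∣ p := by
  have hε : ((ε : ℤ) : ℝ) * (ε : ℤ) = 1 := by
    obtain h | h := Int.units_eq_one_or ε <;> simp [h]
  have hpos : ∀ i, residueCard O ^ i ≠ 0 := fun i => (pow_pos (by linarith) i).ne'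
  have hfac : ∀ i, (1 : ℝ[X]) - C (residueCard O ^ (2 * i))⁻¹ * X ^ 2 =
      (1 - C (residueCard O ^ i)⁻¹ * X) * (1 - C (-(residueCard O ^ i)⁻¹) * X) := fun i => by
    have : (residueCard O ^ (2 * i))⁻¹ = (residueCard O ^ i)⁻¹ * (residueCard O ^ i)⁻¹ := by
      rw [two_mul, pow_add, mul_inv]
    rw [this, C_neg, C_mul]
    ring
  have hinj : ∀ i j, i ≠ j → (residueCard O ^ (2 * i))⁻¹ ≠ (residueCard O ^ (2 * j))⁻¹ := by
    intro i j hij h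
    have := pow_right_injective₀ (by linarith) hq.ne' (inv_injective h)
    lia
  have hcop : ∀ i j, i ≠ j → IsCoprime ((1 : ℝ[X]) - C (residueCard O ^ (2 * i))⁻¹ * X ^ 2)
      (1 - C (residueCard O ^ (2 * j))⁻¹ * X ^ 2) := fun i j hij =>
    isCoprime_one_sub_C (hinj i j hij) _
  have hprod : ∏ i ∈ (Finset.Icc 1 n).filter (fun i => 2 * i < n + 1),
      ((1 : ℝ[X]) - C (residueCard O ^ (2 * i))⁻¹ * X ^ 2) ∣ p := by
    refine Finset.prod_dvd_of_coprime (fun i _ j _ hij => hcop i j hij) fun i hi => ?_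
    rw [Finset.mem_filter, Finset.mem_Icc] at hi
    rw [hfac]
    refine IsCoprime.mul_dvd (isCoprime_one_sub_C ?_ _)
      (one_sub_C_mul_X_dvd (inv_ne_zero (hpos i)) ?_)
      (one_sub_C_mul_X_dvd (neg_ne_zero.2 (inv_ne_zero (hpos i))) ?_)
    · intro h
      have : (residueCard O ^ i)⁻¹ = 0 := by linarith
      exact inv_ne_zero (hpos i) this
    · simpa using h1 i hi.1.1 hi.2 1
    · simpa using h1 i hi.1.1 hi.2 (-1)
  unfold nor
  split_ifs with hn
  · refine IsCoprime.mul_dvd ?_ (one_sub_C_mul_X_dvd ?_ ?_) hprod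
    · refine IsCoprime.prod_right fun i hi => ?_
      rw [Finset.mem_filter, Finset.mem_Icc] at hi
      have h2 : i ≠ (n + 1) / 2 := by
        obtain ⟨t, rfl⟩ := hn
        lia
      have h3 := hcop _ _ h2.symm
      rw [hfac ((n + 1) / 2)] at h3
      obtain h | h := Int.units_eq_one_or ε
      · simpa [h] using h3.of_mul_left_left
      · simpa [h] using h3.of_mul_left_right
    · exact mul_ne_zero (left_ne_zero_of_mul_eq_one hε) (inv_ne_zero (hpos _))
    · rw [mul_inv, inv_inv, ← eq_inv_of_mul_eq_one_left hε]
      exact h0 hn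
  · simpa using hprod

end NormalizingFactor


/-! ### Reduction of lattices to the residue field -/

section Reductions

open IsLocalRing

variable {O : Type*} [CommRing O] [IsDomain O] [IsDiscreteValuationRing O]
  {ϖ : O}
  {H : Type*} [AddCommGroup H] [Module O H] {L : Type*} [AddCommGroup L] [Module O L]
  {V : Type*} [AddCommGroup V] [Module (ResidueField O) V]
  {W : Type*} [AddCommGroup W] [Module (ResidueField O) W]

/-- A map `r` from a lattice `H` to a vector space over the residue field identifies the latter with
`H / ϖ H`. -/
structure IsReduction (ϖ : O) (r : H →ₛₗ[residue O] W) : Prop where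
  surjective : Function.Surjective r
  exists_smul : ∀ x, r x = 0 → ∃ y, x = ϖ • y
  finrank_eq : Module.finrank (ResidueField O) W = Module.finrank O H

/-- The product of two reductions. -/
def prodRed {H' W' : Type*} [AddCommGroup H'] [Module O H'] [AddCommGroup W']
    [Module (ResidueField O) W'] (r : H →ₛₗ[residue O] W) (r' : H' →ₛₗ[residue O] W') :
    (H × H') →ₛₗ[residue O] (W × W') where
  toFun x := (r x.1, r' x.2)
  map_add' x y := by simp
  map_smul' a x := by simp

theorem IsReduction.prod {H' W' : Type*} [AddCommGroup H'] [Module O H'] [AddCommGroup W']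
    [Module (ResidueField O) W'] [Module.Finite O H] [Module.Finite O H'] [Module.Free O H]
    [Module.Free O H'] [Module.Finite (ResidueField O) W] [Module.Finite (ResidueField O) W']
    {r : H →ₛₗ[residue O] W} {r' : H' →ₛₗ[residue O] W'}
    (hr : IsReduction ϖ r) (hr' : IsReduction ϖ r') : IsReduction ϖ (prodRed r r') where
  surjective := by
    rintro ⟨x, y⟩
    obtain ⟨x, rfl⟩ := hr.surjective x
    obtain ⟨y, rfl⟩ := hr'.surjective y
    exact ⟨(x, y), rfl⟩
  exists_smul := by
    rintro ⟨x, y⟩ h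
    obtain ⟨x', rfl⟩ := hr.exists_smul x (congrArg Prod.fst h)
    obtain ⟨y', rfl⟩ := hr'.exists_smul y (congrArg Prod.snd h)
    exact ⟨(x', y'), rfl⟩
  finrank_eq := by
    rw [Module.finrank_prod, Module.finrank_prod, hr.finrank_eq, hr'.finrank_eq]

theorem residue_uniformizer (hϖ : Irreducible ϖ) : residue O ϖ = 0 :=
  (residue_eq_zero_iff _).2 ((mem_maximalIdeal _).2 hϖ.not_isUnit)

/-- Reduction of coordinates. -/
def coordRed (O : Type*) [CommRing O] [IsLocalRing O] (ι : Type*) :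
    (ι → O) →ₛₗ[residue O] (ι → ResidueField O) where
  toFun x i := residue O (x i)
  map_add' x y := by ext; simp
  map_smul' a x := by ext; simp

theorem residue_eq_zero_dvd (hϖ : Irreducible ϖ) {a : O} (h : residue O a = 0) : ∃ b, a = ϖ * b := by
  rw [residue_eq_zero_iff, hϖ.maximalIdeal_eq, Ideal.mem_span_singleton] at h
  exact h

theorem isReduction_coordRed (hϖ : Irreducible ϖ) (ι : Type*) [Fintype ι] :
    IsReduction ϖ (coordRed O ι) where
  surjective x := by
    choose y hy using fun i => residue_surjective (x i)
    exact ⟨y, funext hy⟩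
  exists_smul x h := by
    choose y hy using fun i => residue_eq_zero_dvd hϖ (congrFun h i)
    exact ⟨y, funext hy⟩
  finrank_eq := by simp

/-- A reduction followed by an isomorphism of lattices. -/
theorem IsReduction.comp_equiv {r : H →ₛₗ[residue O] W} (hr : IsReduction ϖ r) (e : L ≃ₗ[O] H) :
    IsReduction ϖ (r.comp e.toLinearMap) where
  surjective := hr.surjective.comp e.surjective
  exists_smul x h := by
    obtain ⟨y, hy⟩ := hr.exists_smul _ h
    exact ⟨e.symm y, by rw [← map_smul, ← hy]; simp⟩
  finrank_eq := hr.finrank_eq.trans e.finrank_eq.symm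

variable (hϖ : Irreducible ϖ) {rL : L →ₛₗ[residue O] V} {rH : H →ₛₗ[residue O] W}
  (hL : IsReduction ϖ rL) (hH : IsReduction ϖ rH)

include hϖ

theorem red_smul (r : H →ₛₗ[residue O] W) (x : H) : r (ϖ • x) = 0 := by
  rw [map_smulₛₗ, residue_uniformizer hϖ, zero_smul]

include hL

theorem exists_redMap (φ : L →ₗ[O] H) (rH : H →ₛₗ[residue O] W) :
    ∃ g : V →ₗ[ResidueField O] W, ∀ x, g (rL x) = rH (φ x) := by
  have hwd : ∀ x y, rL x = rL y → rH (φ x) = rH (φ y) := by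
    intro x y h
    obtain ⟨z, hz⟩ := hL.exists_smul (x - y) (by rw [map_sub, h, sub_self])
    rw [← sub_eq_zero, ← map_sub, ← map_sub, hz, map_smul, red_smul hϖ]
  choose s hs using hL.surjective
  refine ⟨{ toFun := fun v => rH (φ (s v)), map_add' := fun v v' => ?_, map_smul' := fun c v => ?_ },
    fun x => hwd _ _ (hs _)⟩
  · rw [← map_add, ← map_add]
    exact hwd _ _ (by rw [hs, map_add, hs, hs])
  · obtain ⟨a, rfl⟩ := residue_surjective c
    rw [RingHom.id_apply, ← map_smulₛₗ, ← map_smul]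
    exact hwd _ _ (by rw [hs, map_smulₛₗ, hs])

/-- The linear map `V → W` induced by a linear map `L → H`. -/
def redHom (rH : H →ₛₗ[residue O] W) : (L →ₗ[O] H) →+ (V →ₗ[ResidueField O] W) where
  toFun φ := (exists_redMap hϖ hL φ rH).choose
  map_zero' := by
    ext v
    obtain ⟨x, rfl⟩ := hL.surjective v
    rw [(exists_redMap hϖ hL 0 rH).choose_spec]
    simp
  map_add' φ φ' := by
    ext v
    obtain ⟨x, rfl⟩ := hL.surjective v
    rw [(exists_redMap hϖ hL _ rH).choose_spec, LinearMap.add_apply, LinearMap.add_apply,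
      (exists_redMap hϖ hL _ rH).choose_spec, (exists_redMap hϖ hL _ rH).choose_spec, map_add]

theorem redHom_apply (rH : H →ₛₗ[residue O] W) (φ : L →ₗ[O] H) (x : L) :
    redHom hϖ hL rH φ (rL x) = rH (φ x) :=
  (exists_redMap hϖ hL φ rH).choose_spec x

theorem redHom_smul (rH : H →ₛₗ[residue O] W) (φ : L →ₗ[O] H) :
    redHom hϖ hL rH (ϖ ^ 1 • φ) = 0 := by
  ext v
  obtain ⟨x, rfl⟩ := hL.surjective v
  rw [redHom_apply, pow_one, LinearMap.smul_apply, red_smul hϖ, LinearMap.zero_apply]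

include hH

theorem redHom_surjective [Module.Finite O L] [Module.Free O L] :
    Function.Surjective (redHom hϖ hL rH) := by
  intro g
  let b := Module.finBasis O L
  choose s hs using hH.surjective
  refine ⟨b.constr O fun i => s (g (rL (b i))), ?_⟩
  ext v
  obtain ⟨x, rfl⟩ := hL.surjective v
  rw [redHom_apply]
  have h : rH.comp (b.constr O fun i => s (g (rL (b i)))) = g.comp rL := by
    refine b.ext fun i => ?_
    simp [hs]
  exact LinearMap.congr_fun h x

omit hH

theorem card_linearMap_red [Finite (ResidueField O)] [Module.Finite (ResidueField O) V]
    [Module.Finite (ResidueField O) W] (hH : IsReduction ϖ rH) :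
    (Nat.card (V →ₗ[ResidueField O] W) : ℝ) =
      residueCard O ^ (Module.finrank O L * Module.finrank O H) := by
  rw [Module.natCard_eq_pow_finrank (K := ResidueField O), Module.finrank_linearMap,
    hL.finrank_eq, hH.finrank_eq]
  simp [residueCard]

/-- The sublattice of `L` above a subspace `K` of its reduction is the image of an endomorphism `B`,
which has an inverse `A` up to `ϖ`. -/
theorem exists_sublattice [Module.Finite O L] [Module.Free O L]
    (K : Submodule (ResidueField O) V) :
    ∃ A B : L →ₗ[O] L, (∀ x, A (B x) = ϖ • x) ∧ (∀ x, B (A x) = ϖ • x) ∧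
      ∀ x, rL x ∈ K ↔ ∃ y, B y = x := by
  let Λ : Submodule O L := K.comap rL
  let f : L →ₗ[O] Λ := (ϖ • LinearMap.id : L →ₗ[O] L).codRestrict Λ fun x => by
    change rL (ϖ • x) ∈ K
    rw [red_smul hϖ]
    exact K.zero_mem
  have hf : Function.Injective f := by
    intro x y h
    have h1 : ϖ • x = ϖ • y := congrArg Subtype.val h
    exact smul_right_injective L hϖ.ne_zero h1
  have hrank : Module.finrank O L = Module.finrank O Λ :=
    le_antisymm (LinearMap.finrank_le_finrank_of_injective hf) (Submodule.finrank_le Λ)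
  let e := LinearEquiv.ofFinrankEq L Λ hrank
  refine ⟨e.symm ∘ₗ f, Λ.subtype ∘ₗ e, fun x => ?_, fun x => ?_, fun x => ⟨fun h => ?_, ?_⟩⟩
  · apply e.injective
    apply Subtype.ext
    simp [f]
  · simp [f]
  · exact ⟨e.symm ⟨x, h⟩, by simp⟩
  · rintro ⟨y, rfl⟩
    exact (e y).2

end Reductions

section Primitive

open IsLocalRing

variable {O : Type*} [CommRing O] [IsDomain O] [IsDiscreteValuationRing O]
  [Finite (ResidueField O)] [TopologicalSpace O] [IsTopologicalRing O] [CompactSpace O]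
  [T2Space O] {F : Type*} [Field F] [Algebra O F] [FaithfulSMul O F]
  {H : Type*} [AddCommGroup H] [Module O H] [Module.Finite O H] [Module.Free O H]
  {L : Type*} [AddCommGroup L] [Module O L] [Module.Finite O L] [Module.Free O L]
  {V : Type*} [AddCommGroup V] [Module (ResidueField O) V] [Module.Finite (ResidueField O) V]
  {W : Type*} [AddCommGroup W] [Module (ResidueField O) W] [Module.Finite (ResidueField O) W]
  {ϖ : O} (hϖ : Irreducible ϖ) {rL : L →ₛₗ[residue O] V} {rH : H →ₛₗ[residue O] W}
  (hL : IsReduction ϖ rL) (hH : IsReduction ϖ rH)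

include hϖ hL hH

/-- The primitive representations, those with injective reduction, are counted over the residue
field. -/
theorem vol_primitive_inter_repSet {qH : QuadraticForm O H} (hsd : IsSelfDual qH)
    {w : QuadraticForm (ResidueField O) W} (hw : ∀ x, w (rH x) = residue O (qH x))
    {R : QuadraticForm O L} {Rbar : QuadraticForm (ResidueField O) V}
    (hR : ∀ x, Rbar (rL x) = residue O (R x)) {d : ℕ} (hd : 1 ≤ d) :
    vol O ({φ : L →ₗ[O] H | Function.Injective (redHom hϖ hL rH φ)} ∩ repSet ϖ qH (toF F R) d) =
      residueCard O ^ (Module.finrank O L + 1).choose 2 *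
        (Nat.card {φ : V →ₗ[ResidueField O] W // Function.Injective φ ∧ w.comp φ = Rbar} /
        residueCard O ^ (Module.finrank O L * Module.finrank O H)) *
        (residueCard O ^ (d * (Module.finrank O L + 1).choose 2))⁻¹ := by
  have hq := (residueCard_pos O).ne'
  have := finite_linearMap (ResidueField O) V W
  have hsmul : ∀ x, redHom hϖ hL rH (ϖ ^ 1 • x) = 0 := redHom_smul hϖ hL rH
  have hD : PerMod ϖ 1 {φ : L →ₗ[O] H | Function.Injective (redHom hϖ hL rH φ)} := by
    intro φ hφ φ'
    rw [Set.mem_ofPred_eq, map_add, hsmul, add_zero]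
    exact hφ
  induction d, hd using Nat.le_induction with
  | base =>
    have h1 : {φ : L →ₗ[O] H | Function.Injective (redHom hϖ hL rH φ)} ∩
        repSet ϖ qH (toF F R) 1 = redHom hϖ hL rH ⁻¹' {φ | Function.Injective φ ∧
          w.comp φ = Rbar} := by
      ext φ
      simp only [Set.mem_inter_iff, Set.mem_ofPred_eq, Set.mem_preimage]
      refine and_congr_right fun _ => ⟨fun h => ?_, fun h x => ?_⟩
      · ext v
        obtain ⟨x, rfl⟩ := hL.surjective v
        obtain ⟨a, ha⟩ := h x
        rw [toF_apply, ← map_sub, pow_one] at ha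
        have ha := FaithfulSMul.algebraMap_injective O F ha
        rw [QuadraticMap.comp_apply, redHom_apply, hw, hR, ← sub_eq_zero, ← map_sub, ha, map_mul,
          residue_uniformizer hϖ, zero_mul]
      · have h2 := congrArg (fun Q => Q (rL x)) h
        simp only [QuadraticMap.comp_apply, redHom_apply, hw, hR] at h2
        obtain ⟨b, hb⟩ := residue_eq_zero_dvd hϖ (a := qH (φ x) - R x)
          (by rw [map_sub, h2, sub_self])
        exact ⟨b, by rw [toF_apply, ← map_sub, hb, pow_one]⟩
    rw [h1, vol_preimage hϖ _ (redHom_surjective hϖ hL hH) hsmul, card_linearMap_red hϖ hL hH,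
      one_mul, mul_right_comm, mul_inv_cancel₀ (pow_ne_zero _ hq), one_mul]
    rfl
  | succ d hd ih =>
    have h := vol_inter_repSet_eq (F := F) hϖ hsd hD (c := 0) (d := d) (fun φ hφ => ?_)
      (by lia) (by lia) (toF F R)
    · rw [ih] at h
      have h2 : (d + 1) * (Module.finrank O L + 1).choose 2 =
        (Module.finrank O L + 1).choose 2 + d * (Module.finrank O L + 1).choose 2 := by ring
      rw [h2, pow_add]
      field_simp at h ⊢
      linear_combination -h
    · refine exists_leftInverse_up_to hϖ ?_
      rintro x ⟨y, hy⟩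
      refine hL.exists_smul x (hφ ?_)
      rw [map_zero, redHom_apply, hy, zero_add, pow_one, red_smul hϖ]

end Primitive


/-! ### The density polynomial -/

section Recursion

open IsLocalRing

variable {O : Type*} [CommRing O] [IsDomain O] [IsDiscreteValuationRing O]
  [Finite (ResidueField O)] [TopologicalSpace O] [IsTopologicalRing O] [CompactSpace O]
  [T2Space O] {F : Type*} [Field F] [Algebra O F] [IsFractionRing O F]
  {H : Type*} [AddCommGroup H] [Module O H] [Module.Finite O H] [Module.Free O H]
  {L : Type*} [AddCommGroup L] [Module O L] [Module.Finite O L] [Module.Free O L]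
  {V : Type*} [AddCommGroup V] [Module (ResidueField O) V] [Module.Finite (ResidueField O) V]
  {W : Type*} [AddCommGroup W] [Module (ResidueField O) W] [Module.Finite (ResidueField O) W]
  {ϖ : O} (hϖ : Irreducible ϖ) {rL : L →ₛₗ[residue O] V} {rH : H →ₛₗ[residue O] W}
  (hL : IsReduction ϖ rL) (hH : IsReduction ϖ rH)

include hϖ

theorem range_comp_eq {A B : L →ₗ[O] L} (hAB : ∀ x, A (B x) = ϖ • x) (hBA : ∀ x, B (A x) = ϖ • x)
    {K : Submodule (ResidueField O) V} (hK : ∀ x, rL x ∈ K ↔ ∃ y, B y = x)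
    (hH : IsReduction ϖ rH) :
    {φ : L →ₗ[O] H | ∃ φ' : L →ₗ[O] H, φ'.comp A = φ} =
      {φ | K ≤ LinearMap.ker (redHom hϖ hL rH φ)} := by
  have hinj := smul_right_injective H hϖ.ne_zero
  ext φ
  constructor
  · rintro ⟨φ', rfl⟩ v hv
    obtain ⟨x, rfl⟩ := hL.surjective v
    obtain ⟨y, rfl⟩ := (hK x).1 hv
    rw [LinearMap.mem_ker, redHom_apply, LinearMap.comp_apply, hAB, map_smul, red_smul hϖ]
  · intro h
    have h1 : ∀ x, ∃ z, φ (B x) = ϖ • z := fun x => by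
      refine hH.exists_smul _ ?_
      rw [← redHom_apply hϖ hL]
      exact h ((hK _).2 ⟨x, rfl⟩)
    choose f hf using h1
    refine ⟨{ toFun := f, map_add' := fun x y => hinj ?_, map_smul' := fun c x => hinj ?_ }, ?_⟩
    · simp only [smul_add, ← hf, map_add]
    · simp only [RingHom.id_apply, smul_comm ϖ c, ← hf, map_smul]
    · ext x
      apply hinj
      simp only [LinearMap.comp_apply, LinearMap.coe_mk, AddHom.coe_mk, ← hf, hBA, map_smul]

include hL hH

theorem vol_le_ker_redHom (K : Submodule (ResidueField O) V) :
    vol O {φ : L →ₗ[O] H | K ≤ LinearMap.ker (redHom hϖ hL rH φ)} =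
      (residueCard O ^ (Module.finrank (ResidueField O) K * Module.finrank O H))⁻¹ := by
  have hq := (residueCard_pos O).ne'
  have := finite_linearMap (ResidueField O) V W
  have h := vol_preimage hϖ _ (redHom_surjective hϖ hL hH) (redHom_smul hϖ hL rH)
    {g : V →ₗ[ResidueField O] W | K ≤ LinearMap.ker g}
  refine h.trans ?_
  rw [card_linearMap_red hϖ hL hH]
  let e : {φ : V →ₗ[ResidueField O] W // K ≤ LinearMap.ker φ} ≃ ((V ⧸ K) →ₗ[ResidueField O] W) :=
      { toFun := fun φ => K.liftQ φ.1 φ.2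
        invFun := fun φ => ⟨φ ∘ₗ K.mkQ, fun x hx => by simp [(Submodule.Quotient.mk_eq_zero K).2 hx]⟩
        left_inv := fun φ => Subtype.ext (LinearMap.ext fun x => rfl)
        right_inv := fun φ => Submodule.linearMap_qext K (LinearMap.ext fun x => rfl) }
  have h1 : Nat.card {g : V →ₗ[ResidueField O] W | K ≤ LinearMap.ker g} =
      Nat.card (ResidueField O) ^ (Module.finrank (ResidueField O) (V ⧸ K) *
        Module.finrank O H) := by
    rw [← hH.finrank_eq, ← Module.finrank_linearMap (ResidueField O) (ResidueField O),
      ← Module.natCard_eq_pow_finrank (K := ResidueField O)]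
    exact Nat.card_congr e
  have h2 := K.finrank_quotient_add_finrank
  rw [hL.finrank_eq] at h2
  rw [h1, ← h2, add_mul, pow_add, residueCard]
  rw [residueCard] at hq
  push_cast
  field_simp

/-- Möbius inversion over the subspaces on which the reduction of a representation vanishes. -/
theorem vol_primitive_inter_eq_sum [Fintype (Submodule (ResidueField O) V)]
    {S : Set (L →ₗ[O] H)} {d : ℕ} (hS : PerMod ϖ d S) :
    vol O ({φ : L →ₗ[O] H | Function.Injective (redHom hϖ hL rH φ)} ∩ S) =
      ∑ K : Submodule (ResidueField O) V, (moebius K : ℝ) *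
        vol O ({φ : L →ₗ[O] H | K ≤ LinearMap.ker (redHom hϖ hL rH φ)} ∩ S) := by
  classical
  have := finite_linearMap (ResidueField O) V W
  have := Fintype.ofFinite (V →ₗ[ResidueField O] W)
  have hper : ∀ x y, redHom hϖ hL rH (x + ϖ ^ 1 • y) = redHom hϖ hL rH x := fun x y => by
    rw [map_add, redHom_smul hϖ hL rH, add_zero]
  have key : ∀ B : Set (V →ₗ[ResidueField O] W), vol O (redHom hϖ hL rH ⁻¹' B ∩ S) =
      ∑ g, if g ∈ B then vol O (S ∩ redHom hϖ hL rH ⁻¹' {g}) else 0 := by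
    intro B
    have hB : PerMod ϖ (max d 1) (redHom hϖ hL rH ⁻¹' B ∩ S) := by
      refine PerMod.inter ?_ (hS.mono (le_max_left _ _))
      refine PerMod.mono (le_max_right _ _) fun x hx y => ?_
      rw [Set.mem_preimage, hper]
      exact hx
    rw [vol_eq_sum_fiber hϖ (redHom hϖ hL rH) hper hB]
    refine Finset.sum_congr rfl fun g _ => ?_
    split_ifs with hg
    · congr 1
      ext φ
      simp only [Set.mem_inter_iff, Set.mem_preimage, Set.mem_singleton_iff]
      constructor
      · rintro ⟨⟨_, h⟩, h'⟩
        exact ⟨h, h'⟩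
      · rintro ⟨h, h'⟩
        exact ⟨⟨h' ▸ hg, h⟩, h'⟩
    · rw [← vol_empty O (X := L →ₗ[O] H)]
      congr 1
      rw [Set.eq_empty_iff_forall_notMem]
      rintro φ ⟨⟨h, _⟩, h'⟩
      exact hg (h' ▸ h)
  have h1 := key {g | Function.Injective g}
  have h2 : ∀ K, vol O ({φ : L →ₗ[O] H | K ≤ LinearMap.ker (redHom hϖ hL rH φ)} ∩ S) = _ :=
    fun K => key {g | K ≤ LinearMap.ker g}
  refine h1.trans ?_
  simp only [h2, Finset.mul_sum]
  rw [Finset.sum_comm]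
  refine Finset.sum_congr rfl fun g _ => ?_
  have h3 := sum_moebius (LinearMap.ker g)
  have h4 : (if Function.Injective g then (1 : ℝ) else 0) =
      ∑ K : Submodule (ResidueField O) V,
        (if K ≤ LinearMap.ker g then (moebius K : ℝ) else 0) := by
    rw [← LinearMap.ker_eq_bot]
    exact_mod_cast h3.symm
  have h5 := congrArg (· * vol O (S ∩ redHom hϖ hL rH ⁻¹' {g})) h4
  simp only [ite_mul, one_mul, zero_mul, Finset.sum_mul] at h5
  simp only [Set.mem_ofPred_eq, mul_ite, mul_zero]
  exact h5

omit hL hH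

/-- The form `ϖ ^ (-2) Q (B x)`, where `B` is an inverse of `A` up to `ϖ`, has composition `Q` with
`A`. -/
theorem smul_comp_comp {A B : L →ₗ[O] L} (hBA : ∀ x, B (A x) = ϖ • x) (Q : QuadraticMap O L F) :
    (((algebraMap O F ϖ ^ 2)⁻¹ : F) • Q.comp B).comp A = Q := by
  have h0 : algebraMap O F ϖ ≠ 0 := fun h =>
    hϖ.ne_zero (FaithfulSMul.algebraMap_injective O F (by rw [h, map_zero]))
  ext x
  simp only [QuadraticMap.comp_apply, smul_apply, hBA, QuadraticMap.map_smul, smul_eq_mul]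
  rw [Algebra.smul_def, map_mul]
  field_simp

theorem IsNonsingular.smul_comp {A B : L →ₗ[O] L} (hAB : ∀ x, A (B x) = ϖ • x)
    (hBA : ∀ x, B (A x) = ϖ • x) {Q : QuadraticMap O L F} (hQ : IsNonsingular Q) {c : F}
    (hc : c ≠ 0) : IsNonsingular (c • Q.comp B) := by
  have hinj := smul_right_injective L hϖ.ne_zero
  have h0 : algebraMap O F ϖ ≠ 0 := fun h =>
    hϖ.ne_zero (FaithfulSMul.algebraMap_injective O F (by rw [h, map_zero]))
  intro x h1 h2
  have h3 : ∀ z, QuadraticMap.polar Q (B x) z = 0 := fun z => by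
    have h4 := h1 (A z)
    have h5 : QuadraticMap.polar (c • Q.comp B) x (A z) =
        c * (algebraMap O F ϖ * QuadraticMap.polar Q (B x) z) := by
      rw [← Algebra.smul_def, ← QuadraticMap.polar_smul_right, ← hBA z]
      simp only [QuadraticMap.polar, smul_apply, QuadraticMap.comp_apply, map_add, smul_eq_mul]
      ring
    rw [h5] at h4
    simpa [hc, h0] using h4
  have h6 : B x = 0 := by
    refine hQ _ h3 ?_
    simpa [hc] using h2
  apply hinj
  simp only
  rw [← hAB, h6, map_zero, smul_zero]

/-- The densities of a form and of its rescalings to the overlattices inside `ϖ ^ (-1) L` are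
linearly related. -/
theorem IsDensity.primitive_eq [Fintype (Submodule (ResidueField O) V)]
    [DecidableEq (Submodule (ResidueField O) V)] (hL : IsReduction ϖ rL) (hH : IsReduction ϖ rH)
    {qH : QuadraticForm O H} {Q : QuadraticMap O L F}
    {A B : Submodule (ResidueField O) V → L →ₗ[O] L}
    (hAB : ∀ K x, A K (B K x) = ϖ • x) (hBA : ∀ K x, B K (A K x) = ϖ • x)
    (hB : ∀ K x, rL x ∈ K ↔ ∃ y, B K y = x) {v v₀ : ℝ} (hv : IsDensity ϖ qH Q v)
    {vK : Submodule (ResidueField O) V → ℝ}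
    (hvK : ∀ K, IsDensity ϖ qH (((algebraMap O F ϖ ^ 2)⁻¹ : F) • Q.comp (B K)) (vK K))
    (hv₀ : ∀ d, 1 ≤ d →
      vol O ({φ : L →ₗ[O] H | Function.Injective (redHom hϖ hL rH φ)} ∩ repSet ϖ qH Q d) =
        v₀ * (residueCard O ^ (d * (Module.finrank O L + 1).choose 2))⁻¹) :
    v = v₀ - ∑ K ∈ Finset.univ.erase (⊥ : Submodule (ResidueField O) V), (moebius K : ℝ) *
      ((residueCard O ^ (Module.finrank (ResidueField O) K * Module.finrank O H))⁻¹ *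
        overIndex F (A K) * vK K) := by
  choose e he using fun K => (hvK K).vol_range_inter hϖ (c := 1) (A := A K) (B := B K)
    (by simpa using hAB K) (by simpa using hBA K)
  obtain ⟨e₀, he₀⟩ := hv
  have h1 : ∃ d, 1 ≤ d ∧ e₀ ≤ d ∧ ∀ K, e K ≤ d :=
    ⟨max 1 (max e₀ (Finset.univ.sup e)), le_max_left _ _,
      (le_max_left _ _).trans (le_max_right _ _), fun K =>
      (Finset.le_sup (Finset.mem_univ K)).trans ((le_max_right _ _).trans (le_max_right _ _))⟩
  obtain ⟨d, hd1, hd0, hdK⟩ := h1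
  have h2 := vol_primitive_inter_eq_sum hϖ hL hH (perMod_repSet ϖ qH Q d)
  rw [hv₀ d hd1, ← Finset.add_sum_erase _ _ (Finset.mem_univ ⊥)] at h2
  have h3 := he₀ d hd0 0
  rw [smul_zero, show toF F (0 : QuadraticForm O L) = 0 by ext; simp, add_zero] at h3
  have h4 : {φ : L →ₗ[O] H | ⊥ ≤ LinearMap.ker (redHom hϖ hL rH φ)} ∩ repSet ϖ qH Q d =
      repSet ϖ qH Q d := by
    ext φ
    simp
  have h5 : ∀ K, vol O ({φ : L →ₗ[O] H | K ≤ LinearMap.ker (redHom hϖ hL rH φ)} ∩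
      repSet ϖ qH Q d) = ((residueCard O ^ (Module.finrank (ResidueField O) K *
        Module.finrank O H))⁻¹ * overIndex F (A K) * vK K) *
          (residueCard O ^ (d * (Module.finrank O L + 1).choose 2))⁻¹ := by
    intro K
    rw [← vol_le_ker_redHom hϖ hL hH K, ← range_comp_eq hϖ hL (hAB K) (hBA K) (hB K) hH]
    have h6 := he K d (hdK K)
    rw [smul_comp_comp hϖ (hBA K)] at h6
    exact h6
  rw [h4, h3, moebius_bot] at h2
  simp only [h5] at h2
  refine mul_right_cancel₀ (inv_ne_zero (pow_ne_zero (d * (Module.finrank O L + 1).choose 2)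
    (residueCard_pos O).ne')) ?_
  rw [sub_mul, h2, Finset.sum_mul]
  simp only [mul_assoc]
  push_cast
  ring

end Recursion

section DensityPolynomial

open IsLocalRing

universe u

/-- A quadratic lattice has a Gauss type if its reduction, a quadratic space over the residue field,
has that type. -/
def HasGaussType {O : Type u} [CommRing O] [IsDomain O] [IsDiscreteValuationRing O]
    [Finite (ResidueField O)] (ψ : AddChar (ResidueField O) ℂ) (ϖ : O)
    {H : Type*} [AddCommGroup H] [Module O H] (qH : QuadraticForm O H) (b j : ℕ) (η : ℤˣ) : Prop :=
  ∃ (W : Type u) (_ : AddCommGroup W) (_ : Module (ResidueField O) W)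
    (_ : Module.Finite (ResidueField O) W) (r : H →ₛₗ[residue O] W)
    (w : QuadraticForm (ResidueField O) W), IsReduction ϖ r ∧ (∀ x, w (r x) = residue O (qH x)) ∧
      GaussType ψ w b j η

variable {O : Type u} [CommRing O] [IsDomain O] [IsDiscreteValuationRing O]
  [Finite (ResidueField O)] [TopologicalSpace O] [IsTopologicalRing O] [CompactSpace O]
  [T2Space O] {F : Type*} [Field F] [Algebra O F] [IsFractionRing O F]
  {L : Type*} [AddCommGroup L] [Module O L] [Module.Finite O L] [Module.Free O L]
  {V : Type u} [AddCommGroup V] [Module (ResidueField O) V] [Module.Finite (ResidueField O) V]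
  {ϖ : O} (hϖ : Irreducible ϖ) {rL : L →ₛₗ[residue O] V}
  {ψ : AddChar (ResidueField O) ℂ}

include hϖ

/-- The reduction of a quadratic form. -/
theorem exists_form_red (hL : IsReduction ϖ rL) (R : QuadraticForm O L) :
    ∃ Rbar : QuadraticForm (ResidueField O) V, ∀ x, Rbar (rL x) = residue O (R x) := by
  have hwd : ∀ x y, rL x = rL y → residue O (R x) = residue O (R y) := by
    intro x y h
    obtain ⟨z, hz⟩ := hL.exists_smul (x - y) (by rw [map_sub, h, sub_self])
    rw [show x = y + ϖ ^ 1 • z by rw [pow_one, ← hz]; abel, map_add_smul_form, map_add, map_mul,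
      pow_one, residue_uniformizer hϖ, zero_mul, add_zero]
  choose s hs using hL.surjective
  have hf : ∀ x, residue O (R (s (rL x))) = residue O (R x) := fun x => hwd _ _ (hs _)
  have hpolar : ∀ x y, QuadraticMap.polar (fun v => residue O (R (s v))) (rL x) (rL y) =
      residue O (QuadraticMap.polar R x y) := by
    intro x y
    simp only [QuadraticMap.polar, ← map_add, hf, map_sub]
  refine ⟨QuadraticMap.ofPolar (fun v => residue O (R (s v))) ?_ ?_ ?_, hf⟩
  · intro c v
    obtain ⟨a, rfl⟩ := residue_surjective c
    obtain ⟨x, rfl⟩ := hL.surjective v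
    rw [← map_smulₛₗ, hf, hf, QuadraticMap.map_smul]
    simp
  · intro v v' v''
    obtain ⟨x, rfl⟩ := hL.surjective v
    obtain ⟨y, rfl⟩ := hL.surjective v'
    obtain ⟨z, rfl⟩ := hL.surjective v''
    rw [← map_add, hpolar, hpolar, hpolar, QuadraticMap.polar_add_left, map_add]
  · intro c v v'
    obtain ⟨a, rfl⟩ := residue_surjective c
    obtain ⟨x, rfl⟩ := hL.surjective v
    obtain ⟨y, rfl⟩ := hL.surjective v'
    rw [← map_smulₛₗ, hpolar, hpolar, QuadraticMap.polar_smul_left]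
    simp

/-- The isometric embeddings over the residue field are counted by a polynomial which is divisible
by the normalizing factor, because there are none into a space of smaller dimension. -/
theorem nor_dvd_isoPoly (hψ : ψ.IsPrimitive) (Q : QuadraticForm (ResidueField O) V) {n : ℕ}
    (hV : Module.finrank (ResidueField O) V = n)
    (hcase : Odd n ∨ ringChar (ResidueField O) ≠ 2) (ε : ℤˣ) :
    nor O ε n ∣ (isoPoly ψ Q ((n + 1) % 2)).comp
      (C (((ε : ℤ) : ℝ) * (residueCard O ^ ((n + 1) / 2))⁻¹) * X) := by
  have hε : ((ε : ℤ) : ℝ) * (ε : ℤ) = 1 := by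
    obtain h | h := Int.units_eq_one_or ε <;> simp [h]
  have hq := (residueCard_pos O).ne'
  refine nor_dvd O (one_lt_residueCard O) ε n (fun hn => ?_) fun i hi1 hi2 η => ?_
  · have h := isoPoly_eval_eq_zero hψ Q (b := 0) (j := 0) (η := 1) exists_gaussType_zero
      (by rw [hV]; obtain ⟨t, rfl⟩ := hn; lia)
    simp only [eval_comp, eval_mul, eval_C, eval_X]
    rw [show (n + 1) % 2 = 0 by obtain ⟨t, rfl⟩ := hn; lia,
      mul_mul_mul_comm, hε, inv_mul_cancel₀ (pow_ne_zero _ hq)]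
    simpa using h
  · simp only [eval_comp, eval_mul, eval_C, eval_X]
    have h1 : ((ε : ℤ) : ℝ) * (residueCard O ^ ((n + 1) / 2))⁻¹ * (((η : ℤ) : ℝ) *
        residueCard O ^ i) = ((ε * η : ℤˣ) : ℤ) *
          ((Nat.card (ResidueField O) : ℝ) ^ ((n + 1) / 2 - i))⁻¹ := by
      have h2 : residueCard O ^ ((n + 1) / 2) =
          residueCard O ^ ((n + 1) / 2 - i) * residueCard O ^ i := by
        rw [← pow_add]
        congr 1
        lia
      rw [h2, ← residueCard]
      push_cast
      field_simp
    rw [h1]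
    apply isoPoly_eval_eq_zero hψ Q
    · obtain hn | hn := Nat.even_or_odd n
      · rw [show (n + 1) % 2 = 1 by obtain ⟨t, rfl⟩ := hn; lia]
        refine exists_gaussType_odd (hcase.resolve_left fun h => ?_) hψ _ _
        exact (Nat.not_even_iff_odd.2 h) hn
      · rw [show (n + 1) % 2 = 0 by obtain ⟨t, rfl⟩ := hn; lia]
        refine exists_gaussType_even hψ ?_ _
        obtain ⟨t, rfl⟩ := hn
        lia
    · rw [hV]
      obtain hn | hn := Nat.even_or_odd n <;> obtain ⟨t, rfl⟩ := hn <;> lia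

end DensityPolynomial


section DensityPolynomialExistence

open IsLocalRing

universe u

variable {O : Type u} [CommRing O] [IsDomain O] [IsDiscreteValuationRing O]
  [Finite (ResidueField O)] [TopologicalSpace O] [IsTopologicalRing O] [CompactSpace O]
  [T2Space O] {F : Type*} [Field F] [Algebra O F] [IsFractionRing O F]
  {L : Type*} [AddCommGroup L] [Module O L] [Module.Finite O L] [Module.Free O L]
  {V : Type u} [AddCommGroup V] [Module (ResidueField O) V] [Module.Finite (ResidueField O) V]
  {ϖ : O} (hϖ : Irreducible ϖ) {rL : L →ₛₗ[residue O] V}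
  {ψ : AddChar (ResidueField O) ℂ}

/-- Whenever `Q` is the restriction of an integral form on an overlattice of `L`, the index of `L` in
it is less than `q ^ B`. The overlattice is identified with `L`, which makes the inclusion an
endomorphism `A` of `L`, and the index is `q` to the valuation of its determinant. -/
def IndexBound (ϖ : O) (Q : QuadraticMap O L F) (B : ℕ) : Prop :=
  ∀ (A : L →ₗ[O] L) (R : QuadraticForm O L), (toF F R).comp A = Q → LinearMap.det A * ϖ ∣ ϖ ^ B

include hϖ

/-- A vector of `L` that is highly divisible in an integral overlattice is nearly singular, so the
integral overlattices have bounded index. -/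
theorem IsNonsingular.exists_indexBound {Q : QuadraticMap O L F} (hQ : IsNonsingular Q) :
    ∃ B, IndexBound ϖ Q B := by
  obtain ⟨c, hc⟩ := hQ.exists_bound hϖ
  refine ⟨c * Module.finrank O L + 1, fun A R hA => ?_⟩
  obtain ⟨ρ, hρ⟩ := exists_leftInverse_up_to hϖ (φ := A) (c := c) (by
    rintro x ⟨y, hy⟩
    refine hc x (fun z => ⟨ϖ * QuadraticMap.polar R y (A z), ?_⟩)
      ⟨ϖ ^ (c + 2) * R y, ?_⟩
    · have h : QuadraticMap.polar Q x z = algebraMap O F (QuadraticMap.polar R (A x) (A z)) := by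
        rw [← hA]
        simp [QuadraticMap.polar]
      rw [h, hy, QuadraticMap.polar_smul_left, smul_eq_mul]
      congr 1
      ring
    · rw [← hA, QuadraticMap.comp_apply, toF_apply, hy, QuadraticMap.map_smul, smul_eq_mul]
      congr 1
      ring)
  have h : ρ ∘ₗ A = ϖ ^ c • LinearMap.id := by
    ext x
    simp [hρ]
  have h1 := congrArg LinearMap.det h
  rw [LinearMap.det_comp, LinearMap.det_smul, LinearMap.det_id, mul_one, ← pow_mul] at h1
  rw [pow_succ, ← h1]
  exact mul_dvd_mul_right (dvd_mul_left _ _) _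

/-- The density of `Q` in a self-dual lattice of rank `2 k + n + 1` and sign `ε` is the product of
the normalizing factor and the value of a polynomial, both at `q ^ (-k)`. -/
theorem exists_densityPoly (hψ : ψ.IsPrimitive) (hL : IsReduction ϖ rL)
    (hcase : Odd (Module.finrank O L) ∨ ringChar (ResidueField O) ≠ 2) (ε : ℤˣ) (B : ℕ)
    {Q : QuadraticMap O L F} (hQ : IsNonsingular Q) (hB : IndexBound ϖ Q B) :
    ∃ P : ℝ[X], ∀ (k : ℕ) (H : Type u) [AddCommGroup H] [Module O H] [Module.Finite O H]
      [Module.Free O H] (qH : QuadraticForm O H), IsSelfDual qH →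
      HasGaussType ψ ϖ qH ((Module.finrank O L + 1) % 2) (k + (Module.finrank O L + 1) / 2) ε →
      ∀ v, IsDensity ϖ qH Q v → v = P.eval (residueCard O ^ k)⁻¹ *
        (nor O ε (Module.finrank O L)).eval (residueCard O ^ k)⁻¹ := by
  classical
  have hq := (residueCard_pos O).ne'
  have h0 : algebraMap O F ϖ ≠ 0 := fun h =>
    hϖ.ne_zero (FaithfulSMul.algebraMap_injective O F (by rw [h, map_zero]))
  have := finite_submodule (ResidueField O) V
  have := Fintype.ofFinite (Submodule (ResidueField O) V)
  have hnonint : ∀ Q : QuadraticMap O L F, (¬ ∃ R : QuadraticForm O L, toF F R = Q) →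
      ∀ (H : Type u) [AddCommGroup H] [Module O H] [Module.Finite O H]
      [Module.Free O H] (qH : QuadraticForm O H) (v : ℝ), IsDensity ϖ qH Q v → v = 0 := by
    intro Q hint H _ _ _ _ qH v hv
    exact hv.unique (isDensity_zero hϖ fun h => hint (exists_toF_eq Q h))
  induction B generalizing Q with
  | zero =>
    -- `L` has index `1` in itself, so `Q` is not integral
    refine ⟨0, fun k H _ _ _ _ qH _ _ v hv => ?_⟩
    rw [eval_zero, zero_mul]
    refine hnonint Q (fun ⟨R, hR⟩ => ?_) H qH v hv
    have h := hB LinearMap.id R (by rw [← hR]; rfl)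
    rw [LinearMap.det_id, one_mul, pow_zero] at h
    exact hϖ.not_isUnit (isUnit_of_dvd_one h)
  | succ B ih =>
    by_cases hint : ∃ R : QuadraticForm O L, toF F R = Q
    swap
    · refine ⟨0, fun k H _ _ _ _ qH _ _ v hv => ?_⟩
      rw [eval_zero, zero_mul]
      exact hnonint Q hint H qH v hv
    obtain ⟨R, hR⟩ := hint
    choose A D hAD hDA hD using exists_sublattice (O := O) (L := L) hϖ hL
    -- the overlattice attached to `K ≠ ⊥` is strictly larger than `L`, so its bound is smaller
    have hrec : ∀ K : Submodule (ResidueField O) V, K ≠ ⊥ →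
        IndexBound ϖ (((algebraMap O F ϖ ^ 2)⁻¹ : F) • Q.comp (D K)) B := by
      intro K hK A' R' hA'
      have h1 : (toF F R').comp (A' ∘ₗ A K) = Q := by
        rw [← smul_comp_comp hϖ (hDA K) Q, ← hA']
        rfl
      have h2 := hB _ _ h1
      have h3 : ϖ ∣ LinearMap.det (A K) := by
        by_contra hdvd
        have hu : IsUnit (LinearMap.det (A K)) := by
          have hm : LinearMap.det (A K) ∉ maximalIdeal O := by
            rwa [hϖ.maximalIdeal_eq, Ideal.mem_span_singleton]
          simpa using hm
        apply hK
        rw [eq_bot_iff]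
        intro v hv
        obtain ⟨x, rfl⟩ := hL.surjective v
        obtain ⟨y, rfl⟩ := (hD K x).1 hv
        obtain ⟨z, rfl⟩ := ((Module.End.isUnit_iff _).1
          ((LinearMap.isUnit_iff_isUnit_det _).2 hu)).2 y
        rw [hDA, red_smul hϖ]
        exact Submodule.zero_mem _
      obtain ⟨t, ht⟩ := h3
      rw [LinearMap.det_comp, ht, pow_succ] at h2
      refine (mul_dvd_mul_iff_right hϖ.ne_zero).1 (Dvd.dvd.trans ⟨t, ?_⟩ h2)
      ring
    have hns : ∀ K : Submodule (ResidueField O) V,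
        IsNonsingular (((algebraMap O F ϖ ^ 2)⁻¹ : F) • Q.comp (D K)) := fun K =>
      hQ.smul_comp hϖ (hAD K) (hDA K) (inv_ne_zero (pow_ne_zero _ h0))
    have hP : ∀ K : Submodule (ResidueField O) V, ∃ P : ℝ[X], K ≠ ⊥ →
        ∀ (k : ℕ) (H : Type u) [AddCommGroup H] [Module O H] [Module.Finite O H]
      [Module.Free O H] (qH : QuadraticForm O H), IsSelfDual qH →
      HasGaussType ψ ϖ qH ((Module.finrank O L + 1) % 2) (k + (Module.finrank O L + 1) / 2) ε →
      ∀ v, IsDensity ϖ qH (((algebraMap O F ϖ ^ 2)⁻¹ : F) • Q.comp (D K)) v →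
        v = P.eval (residueCard O ^ k)⁻¹ *
        (nor O ε (Module.finrank O L)).eval (residueCard O ^ k)⁻¹ := by
      intro K
      by_cases hK : K = ⊥
      · exact ⟨0, fun h => absurd hK h⟩
      · obtain ⟨P, hP⟩ := ih (hns K) (hrec K hK)
        exact ⟨P, fun _ => hP⟩
    choose P hP using hP
    obtain ⟨Rbar, hRbar⟩ := exists_form_red hϖ hL R
    obtain ⟨P₀, hP₀⟩ := nor_dvd_isoPoly hϖ hψ Rbar hL.finrank_eq hcase ε
    -- the `K`-summand of `IsDensity.primitive_eq` carries `q ^ (-dim K * (2 k + n + 1))`, the source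
    -- of the factor `X ^ (2 * dim K)`
    refine ⟨C (residueCard O ^ (Module.finrank O L * ((Module.finrank O L + 1) % 2)))⁻¹ * P₀ -
      ∑ K ∈ Finset.univ.erase (⊥ : Submodule (ResidueField O) V),
        C ((moebius K : ℝ) * overIndex F (A K) * (residueCard O ^
          (Module.finrank (ResidueField O) K * (Module.finrank O L + 1)))⁻¹) *
          X ^ (2 * Module.finrank (ResidueField O) K) * P K, ?_⟩
    intro k H _ _ _ _ qH hsd hgt v hv
    have hgt' := hgt
    obtain ⟨W, _, _, _, r, w, hr, hw, hwt⟩ := hgt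
    choose vK hvK using fun K => exists_isDensity hϖ hsd (hns K)
    have hm : Module.finrank O H = 2 * k + (Module.finrank O L + 1) := by
      rw [← hr.finrank_eq, hwt.1]
      lia
    have h1 := hv.primitive_eq hϖ hL hr hAD hDA hD hvK (v₀ := residueCard O ^
      (Module.finrank O L + 1).choose 2 *
        (Nat.card {φ : V →ₗ[ResidueField O] W // Function.Injective φ ∧ w.comp φ = Rbar} /
        residueCard O ^ (Module.finrank O L * Module.finrank O H))) (fun d hd => by
          rw [← hR]
          exact vol_primitive_inter_repSet (F := F) hϖ hL hr hsd hw hRbar hd)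
    have h2 := card_injective_isometry hψ Rbar hwt
    have h3 := congrArg (Polynomial.eval (residueCard O ^ k)⁻¹) hP₀
    simp only [eval_comp, eval_mul, eval_C, eval_X] at h3
    have h4 : ((ε : ℤ) : ℝ) * (residueCard O ^ ((Module.finrank O L + 1) / 2))⁻¹ *
        (residueCard O ^ k)⁻¹ = (ε : ℤ) * ((Nat.card (ResidueField O) : ℝ) ^
          (k + (Module.finrank O L + 1) / 2))⁻¹ := by
      rw [← residueCard, pow_add]
      field_simp
    rw [h4] at h3
    rw [h3, ← residueCard, finrank_form, hL.finrank_eq] at h2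
    rw [h1, eval_sub, sub_mul]
    congr 1
    · rw [← mul_div_assoc, h2, eval_mul, eval_C, hm]
      have h5 : 2 * k + (Module.finrank O L + 1) =
          2 * (k + (Module.finrank O L + 1) / 2) + (Module.finrank O L + 1) % 2 := by lia
      have h6 : residueCard O ^ (Module.finrank O L *
          (2 * (k + (Module.finrank O L + 1) / 2) + (Module.finrank O L + 1) % 2)) =
          residueCard O ^ (2 * Module.finrank O L * (k + (Module.finrank O L + 1) / 2)) *
            residueCard O ^ (Module.finrank O L * ((Module.finrank O L + 1) % 2)) := by
        rw [← pow_add]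
        congr 1
        ring
      have h7 := pow_ne_zero (2 * Module.finrank O L * (k + (Module.finrank O L + 1) / 2)) hq
      rw [h5, h6, mul_div_mul_left _ _ h7]
      ring
    · rw [eval_finsetSum, Finset.sum_mul]
      refine Finset.sum_congr rfl fun K hK => ?_
      rw [hP K (Finset.ne_of_mem_erase hK) k H qH hsd hgt' _ (hvK K)]
      simp only [eval_mul, eval_C, eval_pow, eval_X]
      rw [hm, mul_add (Module.finrank (ResidueField O) K), pow_add, mul_inv]
      have h6 : (residueCard O ^ (Module.finrank (ResidueField O) K * (2 * k)))⁻¹ =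
          (residueCard O ^ k)⁻¹ ^ (2 * Module.finrank (ResidueField O) K) := by
        rw [inv_pow, ← pow_mul]
        congr 2
        ring
      rw [h6]
      ring

end DensityPolynomialExistence


/-! ### The character `χ_F` on units -/

section HilbertSymbol

open IsLocalRing

variable {O : Type*} [CommRing O] [IsDomain O] [IsDiscreteValuationRing O]
  [Finite (ResidueField O)] [TopologicalSpace O] [IsTopologicalRing O] [CompactSpace O]
  [T2Space O] {F : Type*} [Field F] [Algebra O F] [IsFractionRing O F]
  {ϖ : O} (hϖ : Irreducible ϖ)

theorem exists_two_mul_eq_one (h2 : ringChar (ResidueField O) ≠ 2) : ∃ c : O, 2 * c = 1 := by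
  have h : residue O 2 ≠ 0 := by
    rw [map_ofNat]
    exact Ring.two_ne_zero h2
  have hu : IsUnit (2 : O) := by
    have : (2 : O) ∉ maximalIdeal O := fun hm => h ((residue_eq_zero_iff _).2 hm)
    simpa using this
  exact hu.exists_right_inv

include hϖ

/-- Hensel's lemma for squares. -/
theorem exists_sq_eq (h2 : ringChar (ResidueField O) ≠ 2) {d s : O} (hs : residue O s ≠ 0)
    (h : residue O s ^ 2 = residue O d) : ∃ t, t ^ 2 = d := by
  obtain ⟨c, hc⟩ := exists_two_mul_eq_one h2
  let S : ℕ → Set O := fun n => {t | ϖ ^ (n + 1) ∣ t ^ 2 - d ∧ residue O t = residue O s}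
  have hne : ∀ n, (S n).Nonempty := by
    intro n
    induction n with
    | zero =>
      refine ⟨s, ?_, rfl⟩
      obtain ⟨b, hb⟩ := residue_eq_zero_dvd hϖ (a := s ^ 2 - d) (by rw [map_sub, map_pow, h, sub_self])
      exact ⟨b, by rw [hb, zero_add, pow_one]⟩
    | succ n ih =>
      obtain ⟨t, ⟨a, ha⟩, ht⟩ := ih
      have hu : IsUnit t := by
        have : t ∉ maximalIdeal O := fun hm => hs (by rw [← ht]; exact (residue_eq_zero_iff _).2 hm)
        simpa using this
      obtain ⟨t', ht'⟩ := hu.exists_right_inv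
      refine ⟨t - ϖ ^ (n + 1) * (a * c * t'), ⟨ϖ ^ n * (a * c * t') ^ 2, ?_⟩, ?_⟩
      · have h1 : t ^ 2 = d + ϖ ^ (n + 1) * a := by linear_combination ha
        have h3 : (t - ϖ ^ (n + 1) * (a * c * t')) ^ 2 - d = t ^ 2 - d -
          ϖ ^ (n + 1) * a * (2 * c) * (t * t') + (ϖ ^ (n + 1) * (a * c * t')) ^ 2 := by ring
        rw [h3, hc, ht', h1]
        ring
      · rw [map_sub, map_mul, map_pow, residue_uniformizer hϖ]
        simp [ht]
  have hper : ∀ n, PerMod ϖ (n + 1) (S n) := by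
    rintro n t ⟨⟨a, ha⟩, ht⟩ y
    refine ⟨⟨a + 2 * t * y + ϖ ^ (n + 1) * y ^ 2, ?_⟩, ?_⟩
    · rw [smul_eq_mul]
      linear_combination ha
    · rw [smul_eq_mul, map_add, map_mul, map_pow, residue_uniformizer hϖ]
      simp [ht]
  obtain ⟨t, ht⟩ := nonempty_iInter_of_perMod hϖ S _ hper
    (fun n t ht => ⟨(pow_dvd_pow _ (Nat.le_succ _)).trans ht.1, ht.2⟩) hne
  refine ⟨t, sub_eq_zero.1 (eq_zero_of_forall_pow_dvd hϖ fun n => ?_)⟩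
  exact (pow_dvd_pow _ (Nat.le_succ _)).trans (Set.mem_iInter.1 ht n).1

/-- The conic `z ^ 2 = d x ^ 2 + ϖ y ^ 2` has no nontrivial point if `d` is not a square modulo `ϖ`,
by infinite descent. -/
theorem conic_eq_zero {d : O} (hd : ¬ IsSquare (residue O d)) (n : ℕ) {x y z : O}
    (h : z ^ 2 = d * x ^ 2 + ϖ * y ^ 2) : ϖ ^ n ∣ x ∧ ϖ ^ n ∣ y ∧ ϖ ^ n ∣ z := by
  induction n generalizing x y z with
  | zero => simp
  | succ n ih =>
    have h1 : residue O z ^ 2 = residue O d * residue O x ^ 2 := by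
      have := congrArg (residue O) h
      simpa [residue_uniformizer hϖ] using this
    have hx : residue O x = 0 := by
      by_contra hx
      refine hd ⟨residue O z / residue O x, ?_⟩
      field_simp
      exact h1.symm
    have hz : residue O z = 0 := by
      rw [hx] at h1
      simpa using h1
    obtain ⟨x', rfl⟩ := residue_eq_zero_dvd hϖ hx
    obtain ⟨z', rfl⟩ := residue_eq_zero_dvd hϖ hz
    have h2 : ϖ * z' ^ 2 = ϖ * (d * x' ^ 2) + y ^ 2 := by
      apply mul_left_cancel₀ hϖ.ne_zero
      linear_combination h
    have hy : residue O y = 0 := by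
      have := congrArg (residue O) h2
      simpa [residue_uniformizer hϖ] using this.symm
    obtain ⟨y', rfl⟩ := residue_eq_zero_dvd hϖ hy
    have h3 : z' ^ 2 = d * x' ^ 2 + ϖ * y' ^ 2 := by
      apply mul_left_cancel₀ hϖ.ne_zero
      linear_combination h2
    obtain ⟨h4, h5, h6⟩ := ih h3
    simp only [pow_succ']
    exact ⟨mul_dvd_mul_left _ h4, mul_dvd_mul_left _ h5, mul_dvd_mul_left _ h6⟩

theorem chi_unit (h2 : ringChar (ResidueField O) ≠ 2) {d : O} (hd : residue O d ≠ 0) :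
    chi ϖ (algebraMap O F d) = quadChar (residue O d) := by
  classical
  have := Fintype.ofFinite (ResidueField O)
  have hinj := FaithfulSMul.algebraMap_injective O F
  have hu : IsUnit d := by
    have : d ∉ maximalIdeal O := fun hm => hd ((residue_eq_zero_iff _).2 hm)
    simpa using this
  have hcond : ∃ (a : ℤ) (u : Oˣ), algebraMap O F d =
      algebraMap O F u * algebraMap O F ϖ ^ (2 * a) := ⟨0, hu.unit, by simp⟩
  rw [chi, if_pos hcond, hilbertSymbol, quadChar_eq]
  by_cases hsq : IsSquare (residue O d)
  · rw [(quadraticChar_one_iff_isSquare hd).2 hsq, if_pos]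
    obtain ⟨s, hs⟩ := hsq
    obtain ⟨s, rfl⟩ := residue_surjective s
    have hs0 : residue O s ≠ 0 := fun h => hd (by rw [hs, h, mul_zero])
    obtain ⟨t, ht⟩ := exists_sq_eq hϖ h2 hs0 (by rw [hs, sq])
    refine ⟨1, 0, algebraMap O F t, by simp, ?_⟩
    rw [← map_pow, ht]
    simp
  · rw [quadraticChar_neg_one_iff_not_isSquare.2 hsq, if_neg]
    rintro ⟨x, y, z, hne, h⟩
    apply hne
    obtain ⟨⟨a, ha⟩, hint⟩ := IsLocalization.exist_integer_multiples_of_finite (nonZeroDivisors O)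
      ![x, y, z]
    have ha0 : algebraMap O F a ≠ 0 := fun h0 =>
      nonZeroDivisors.ne_zero ha (hinj (by rw [h0, map_zero]))
    obtain ⟨x', hx'⟩ := hint 0
    obtain ⟨y', hy'⟩ := hint 1
    obtain ⟨z', hz'⟩ := hint 2
    simp only [Matrix.cons_val, Algebra.smul_def] at hx' hy' hz'
    have h' : z' ^ 2 = d * x' ^ 2 + ϖ * y' ^ 2 := by
      apply hinj
      simp only [map_pow, map_add, map_mul, hx', hy', hz', mul_pow, h]
      ring
    have h3 := fun n => conic_eq_zero hϖ hsq n h'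
    have hx0 := eq_zero_of_forall_pow_dvd hϖ fun n => (h3 n).1
    have hy0 := eq_zero_of_forall_pow_dvd hϖ fun n => (h3 n).2.1
    have hz0 := eq_zero_of_forall_pow_dvd hϖ fun n => (h3 n).2.2
    rw [hx0, map_zero] at hx'
    rw [hy0, map_zero] at hy'
    rw [hz0, map_zero] at hz'
    simp only [(mul_eq_zero.1 hx'.symm).resolve_left ha0,
      (mul_eq_zero.1 hy'.symm).resolve_left ha0, (mul_eq_zero.1 hz'.symm).resolve_left ha0]
    rfl

end HilbertSymbol

/-! ### Gauss types of the standard lattices -/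

section Standard

open IsLocalRing

universe u

section General

variable {O : Type*} [CommRing O] {H H' : Type*} [AddCommGroup H] [Module O H]
  [AddCommGroup H'] [Module O H']

theorem isSelfDual_congr {q : QuadraticForm O H} {q' : QuadraticForm O H'}
    (e : q.IsometryEquiv q') (h : IsSelfDual q) : IsSelfDual q' := by
  have h1 : ∀ x y, QuadraticMap.polarBilin q' x y =
      QuadraticMap.polarBilin q (e.symm x) (e.symm y) := fun x y => by
    simp only [QuadraticMap.polarBilin_apply_apply, QuadraticMap.polar, ← map_add,
      QuadraticMap.IsometryEquiv.map_app]
  constructor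
  · intro x y hxy
    apply e.symm.toLinearEquiv.injective
    refine h.1 (LinearMap.ext fun z => ?_)
    have h2 := LinearMap.congr_fun hxy (e z)
    rw [h1, h1, e.symm_apply_apply] at h2
    exact h2
  · intro l
    obtain ⟨x, hx⟩ := h.2 (l ∘ₗ e.toLinearEquiv.toLinearMap)
    refine ⟨e x, LinearMap.ext fun z => ?_⟩
    have h2 := LinearMap.congr_fun hx (e.symm z)
    rw [h1, e.symm_apply_apply, h2]
    exact congrArg l (e.apply_symm_apply z)

theorem isSelfDual_prod {q : QuadraticForm O H} {q' : QuadraticForm O H'} (h : IsSelfDual q)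
    (h' : IsSelfDual q') : IsSelfDual (q.prod q') := by
  have hp : ∀ x y, QuadraticMap.polar (q.prod q') x y =
      QuadraticMap.polar q x.1 y.1 + QuadraticMap.polar q' x.2 y.2 := fun x y => by
    simp only [QuadraticMap.polar, QuadraticMap.prod_apply, Prod.fst_add, Prod.snd_add]
    ring
  constructor
  · intro x y hxy
    have h1 := fun z => LinearMap.congr_fun hxy z
    simp only [QuadraticMap.polarBilin_apply_apply, hp] at h1
    ext
    · refine h.1 (LinearMap.ext fun z => ?_)
      simpa using h1 (z, 0)
    · refine h'.1 (LinearMap.ext fun z => ?_)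
      simpa using h1 (0, z)
  · intro l
    obtain ⟨x, hx⟩ := h.2 (l ∘ₗ LinearMap.inl O H H')
    obtain ⟨y, hy⟩ := h'.2 (l ∘ₗ LinearMap.inr O H H')
    refine ⟨(x, y), LinearMap.ext fun z => ?_⟩
    have h1 := LinearMap.congr_fun hx z.1
    have h2 := LinearMap.congr_fun hy z.2
    simp only [QuadraticMap.polarBilin_apply_apply, LinearMap.comp_apply] at h1 h2
    rw [QuadraticMap.polarBilin_apply_apply, hp, h1, h2, ← map_add]
    simp

theorem isSelfDual_hyperbolicPlane : IsSelfDual (hyperbolicPlane O) := by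
  have hp : ∀ x y, QuadraticMap.polar (hyperbolicPlane O) x y = x.1 * y.2 + x.2 * y.1 :=
    fun x y => by simp [QuadraticMap.polar, hyperbolicPlane]; ring
  constructor
  · intro x y hxy
    have h1 := fun z => LinearMap.congr_fun hxy z
    simp only [QuadraticMap.polarBilin_apply_apply, hp] at h1
    ext
    · simpa using h1 (0, 1)
    · simpa using h1 (1, 0)
  · intro l
    refine ⟨(l (0, 1), l (1, 0)), LinearMap.ext fun z => ?_⟩
    rw [QuadraticMap.polarBilin_apply_apply, hp]
    have : z = z.1 • (1, 0) + z.2 • (0, 1) := by ext <;> simp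
    conv_rhs => rw [this, map_add, map_smul, map_smul]
    simp only [smul_eq_mul]
    ring

theorem isSelfDual_of_subsingleton [Subsingleton H] (q : QuadraticForm O H) : IsSelfDual q :=
  ⟨fun _ _ _ => Subsingleton.elim _ _, fun l => ⟨0, LinearMap.ext fun x => by
    rw [Subsingleton.elim x 0, map_zero, map_zero]⟩⟩

/-- A sum of `j + 1` hyperbolic planes. -/
def piSuccIsometry (j : ℕ) :
    ((hyperbolicPlane O).prod (QuadraticMap.pi fun _ : Fin j => hyperbolicPlane O)).IsometryEquiv
      (QuadraticMap.pi fun _ : Fin (j + 1) => hyperbolicPlane O) where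
  toLinearEquiv := Fin.consLinearEquiv O (fun _ : Fin (j + 1) => O × O)
  map_app' x := by
    simp [QuadraticMap.pi_apply, Fin.sum_univ_succ]

theorem isSelfDual_pi_hyperbolicPlane (j : ℕ) :
    IsSelfDual (QuadraticMap.pi fun _ : Fin j => hyperbolicPlane O) := by
  induction j with
  | zero => exact isSelfDual_of_subsingleton _
  | succ j ih =>
    exact isSelfDual_congr (piSuccIsometry j) (isSelfDual_prod isSelfDual_hyperbolicPlane ih)

end General

variable {O : Type u} [CommRing O] [IsDomain O] [IsDiscreteValuationRing O]
  [Finite (ResidueField O)] {ϖ : O} (hϖ : Irreducible ϖ) {ψ : AddChar (ResidueField O) ℂ}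
  {H H' : Type*} [AddCommGroup H] [Module O H] [AddCommGroup H'] [Module O H']

theorem HasGaussType.congr {q : QuadraticForm O H} {q' : QuadraticForm O H'} {b j : ℕ} {η : ℤˣ}
    (h : HasGaussType ψ ϖ q b j η) (e : q.IsometryEquiv q') : HasGaussType ψ ϖ q' b j η := by
  obtain ⟨W, _, _, _, r, w, hr, hw, hg⟩ := h
  refine ⟨W, _, _, ‹_›, r.comp e.symm.toLinearEquiv.toLinearMap, w, hr.comp_equiv _,
    fun x => ?_, hg⟩
  refine (hw _).trans ?_
  congr 1
  exact e.symm.map_app x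

theorem HasGaussType.prod [Module.Finite O H] [Module.Free O H] [Module.Finite O H']
    [Module.Free O H'] {q : QuadraticForm O H} {q' : QuadraticForm O H'} {b j j' : ℕ} {η η' : ℤˣ}
    (h : HasGaussType ψ ϖ q 0 j η) (h' : HasGaussType ψ ϖ q' b j' η') :
    HasGaussType ψ ϖ (q.prod q') b (j + j') (η * η') := by
  obtain ⟨W, _, _, _, r, w, hr, hw, hg⟩ := h
  obtain ⟨W', _, _, _, r', w', hr', hw', hg'⟩ := h'
  refine ⟨W × W', inferInstance, inferInstance, inferInstance, prodRed r r', w.prod w',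
    hr.prod hr', fun x => ?_, hg.prod hg'⟩
  rw [QuadraticMap.prod_apply, QuadraticMap.prod_apply, map_add, ← hw, ← hw']
  rfl

include hϖ

theorem hasGaussType_hyperbolicPlane (hψ : ψ.IsPrimitive) :
    HasGaussType ψ ϖ (hyperbolicPlane O) 0 1 1 := by
  let e : (O × O) ≃ₗ[O] (Fin 2 → O) := (LinearEquiv.finTwoArrow O O).symm
  let e' : (Fin 2 → ResidueField O) ≃ₗ[ResidueField O] (ResidueField O × ResidueField O) :=
    LinearEquiv.finTwoArrow (ResidueField O) (ResidueField O)
  refine ⟨Fin 2 → ResidueField O, inferInstance, inferInstance, inferInstance,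
    (coordRed O (Fin 2)).comp e.toLinearMap, (hyperbolicPlane (ResidueField O)).comp e'.toLinearMap,
    (isReduction_coordRed hϖ (Fin 2)).comp_equiv e, fun x => ?_,
    (gaussType_hyperbolicPlane hψ).congr ⟨e'.symm, fun x => by simp⟩⟩
  simp [hyperbolicPlane, coordRed, e, e', LinearEquiv.finTwoArrow]

theorem hasGaussType_of_subsingleton [Subsingleton H] (q : QuadraticForm O H) :
    HasGaussType ψ ϖ q 0 0 1 := by
  have e : H ≃ₗ[O] (Fin 0 → O) := ⟨0, 0, fun _ => Subsingleton.elim _ _, fun _ => Subsingleton.elim _ _⟩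
  refine ⟨Fin 0 → ResidueField O, inferInstance, inferInstance, inferInstance,
    (coordRed O (Fin 0)).comp e.toLinearMap, 0, (isReduction_coordRed hϖ (Fin 0)).comp_equiv e,
    fun x => ?_, gaussType_of_subsingleton _⟩
  rw [Subsingleton.elim x 0]
  simp

theorem hasGaussType_pi_hyperbolicPlane (hψ : ψ.IsPrimitive) (j : ℕ) :
    HasGaussType ψ ϖ (QuadraticMap.pi fun _ : Fin j => hyperbolicPlane O) 0 j 1 := by
  induction j with
  | zero => exact hasGaussType_of_subsingleton hϖ _
  | succ j ih =>
    have := ((hasGaussType_hyperbolicPlane hϖ hψ).prod ih).congr (piSuccIsometry j)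
    rwa [one_mul, Nat.add_comm 1 j] at this

end Standard


/-! ### Existence and Gauss type of the lattices `H_k^ε` -/

section StandardOdd

open IsLocalRing

universe u

theorem polar_weightedSumSquares {R : Type*} [CommRing R] {k : ℕ} (a : Fin k → R)
    (x y : Fin k → R) : QuadraticMap.polar (QuadraticMap.weightedSumSquares R a) x y =
      ∑ i, 2 * (a i * x i * y i) := by
  simp only [QuadraticMap.polar, QuadraticMap.weightedSumSquares_apply, Pi.add_apply,
    ← Finset.sum_sub_distrib, smul_eq_mul]
  exact Finset.sum_congr rfl fun i _ => by ring

/-- The Gram matrix of half the polar form of a diagonal form is diagonal; here `c` is the inverse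
of `2`. -/
theorem det_polar_weightedSumSquares {R : Type*} [CommRing R] {c : R} (hc : 2 * c = 1) {k : ℕ}
    (a : Fin k → R) : Matrix.det (Matrix.of fun i j : Fin k => c * QuadraticMap.polar
      (QuadraticMap.weightedSumSquares R a) (Pi.single i 1) (Pi.single j 1)) = ∏ i, a i := by
  have : (Matrix.of fun i j : Fin k => c * QuadraticMap.polar
      (QuadraticMap.weightedSumSquares R a) (Pi.single i 1) (Pi.single j 1)) =
      Matrix.diagonal a := by
    ext i j
    rw [Matrix.of_apply, polar_weightedSumSquares, Matrix.diagonal_apply,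
      Finset.sum_eq_single i (fun b _ hb => by simp [Pi.single_eq_of_ne hb]) (by simp)]
    split_ifs with hij
    · subst hij
      simp only [Pi.single_eq_same]
      linear_combination a i * hc
    · simp [Pi.single_eq_of_ne hij]
  rw [this, Matrix.det_diagonal]

theorem det_polar_comp {R : Type*} [CommRing R] {c : R} (hc : 2 * c = 1) {k : ℕ}
    (w : QuadraticForm R (Fin k → R)) (f : (Fin k → R) →ₗ[R] (Fin k → R)) :
    Matrix.det (Matrix.of fun i j : Fin k => c * QuadraticMap.polar
      (w.comp f) (Pi.single i 1) (Pi.single j 1)) =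
    (LinearMap.toMatrix' f).det ^ 2 * Matrix.det (Matrix.of fun i j : Fin k => c * QuadraticMap.polar
      w (Pi.single i 1) (Pi.single j 1)) := by
  let : Invertible (2 : R) := ⟨c, by rw [mul_comm, hc], hc⟩
  have h : ∀ Q : QuadraticForm R (Fin k → R), Matrix.det (Matrix.of fun i j : Fin k =>
      c * QuadraticMap.polar Q (Pi.single i 1) (Pi.single j 1)) = Q.discr' := fun Q => by
    rw [QuadraticForm.discr', QuadraticForm.toMatrix']
    congr 1
  rw [h, h, QuadraticForm.discr'_comp, sq]

/-- In a self-dual lattice, a vector whose products are all divisible by `ϖ` is divisible by `ϖ`. -/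
theorem exists_smul_of_polar_dvd {O : Type*} [CommRing O] [IsDomain O] {ϖ : O} (hϖ0 : ϖ ≠ 0)
    {H : Type*} [AddCommGroup H] [Module O H]
    {h : QuadraticForm O H} (hsd : IsSelfDual h) {x : H}
    (hp : ∀ y, ∃ b, QuadraticMap.polar h x y = ϖ * b) : ∃ x', x = ϖ • x' := by
  choose l hl using hp
  let l' : H →ₗ[O] O :=
    { toFun := l
      map_add' := fun y z => mul_left_cancel₀ hϖ0 (by
        rw [← hl, QuadraticMap.polar_add_right, hl, hl, mul_add])
      map_smul' := fun a y => mul_left_cancel₀ hϖ0 (by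
        rw [← hl, QuadraticMap.polar_smul_right, hl, smul_eq_mul, smul_eq_mul, RingHom.id_apply]
        ring) }
  obtain ⟨x', hx'⟩ := hsd.2 l'
  refine ⟨x', hsd.1 (LinearMap.ext fun y => ?_)⟩
  rw [map_smul, hx', QuadraticMap.polarBilin_apply_apply, hl]
  rfl

variable {O : Type u} [CommRing O] [IsDomain O] [IsDiscreteValuationRing O]
  [Finite (ResidueField O)] [TopologicalSpace O] [IsTopologicalRing O] [CompactSpace O]
  [T2Space O] {F : Type*} [Field F] [Algebra O F] [IsFractionRing O F]
  {ϖ : O} (hϖ : Irreducible ϖ) {ψ : AddChar (ResidueField O) ℂ}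

theorem disc_eq {c : O} (hc : 2 * c = 1) {k : ℕ} (h : QuadraticForm O (Fin k → O)) :
    disc F h = algebraMap O F ((-1) ^ (k.choose 2) * Matrix.det (Matrix.of fun i j : Fin k =>
      c * QuadraticMap.polar h (Pi.single i 1) (Pi.single j 1))) := by
  have hc' : (2 : F) * algebraMap O F c = 1 := by
    rw [← map_ofNat (algebraMap O F), ← map_mul, hc, map_one]
  have h2 : (2 : F) ≠ 0 := left_ne_zero_of_mul (by rw [hc']; exact one_ne_zero)
  rw [disc, map_mul, RingHom.map_det, map_pow, map_neg, map_one]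
  congr 2
  ext i j
  simp only [Matrix.of_apply, RingHom.mapMatrix_apply, Matrix.map_apply, map_mul]
  rw [div_eq_iff h2]
  linear_combination (-algebraMap O F (QuadraticMap.polar h (Pi.single i 1) (Pi.single j 1))) * hc'

theorem exists_isStandard_of_ringChar_eq_two (h2 : ringChar (ResidueField O) = 2) (j : ℕ) :
    ∃ h : QuadraticForm O (Fin (2 * j) → O), IsStandard F ϖ 1 h := by
  have e : (Fin j → O × O) ≃ₗ[O] (Fin (2 * j) → O) := LinearEquiv.ofFinrankEq _ _ (by
    rw [Module.finrank_pi_fintype]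
    simp [mul_comm])
  refine ⟨(QuadraticMap.pi fun _ : Fin j => hyperbolicPlane O).comp e.symm.toLinearMap,
    fun h => absurd h2 h, fun _ => ⟨rfl, j, ⟨⟨e.symm, fun x => rfl⟩⟩⟩⟩

include hϖ

/-- A self-dual form has nondegenerate reduction. -/
theorem separatingLeft_of_isSelfDual {k : ℕ} {h : QuadraticForm O (Fin k → O)} (hsd : IsSelfDual h)
    [Invertible (2 : ResidueField O)] {w : QuadraticForm (ResidueField O) (Fin k → ResidueField O)}
    (hw : ∀ x, w (coordRed O (Fin k) x) = residue O (h x)) :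
    (QuadraticMap.associated (R := ResidueField O) w).SeparatingLeft := by
  have hr := isReduction_coordRed (O := O) hϖ (Fin k)
  intro x hx
  obtain ⟨x, rfl⟩ := hr.surjective x
  obtain ⟨x', rfl⟩ := exists_smul_of_polar_dvd hϖ.ne_zero hsd (x := x) fun y => by
    apply residue_eq_zero_dvd hϖ
    have h1 := hx (coordRed O (Fin k) y)
    have h2 := congrArg (fun B => B (coordRed O (Fin k) x) (coordRed O (Fin k) y))
      (QuadraticMap.two_nsmul_associated (ResidueField O) w)
    simp only [LinearMap.smul_apply, h1, smul_zero, QuadraticMap.polarBilin_apply_apply,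
      QuadraticMap.polar, ← map_add, hw] at h2
    rw [QuadraticMap.polar, map_sub, map_sub, h2]
  rw [red_smul hϖ]

/-- The sign of the reduction of a self-dual lattice is the quadratic character of its discriminant,
which is `χ_F` of the discriminant. -/
theorem hasGaussType_of_isSelfDual (hψ : ψ.IsPrimitive) (h2 : ringChar (ResidueField O) ≠ 2) {k : ℕ}
    {h : QuadraticForm O (Fin k → O)} (hsd : IsSelfDual h) {ε : ℤˣ}
    (hε : chi ϖ (disc F h) = (ε : ℤ)) : HasGaussType ψ ϖ h (k % 2) (k / 2) ε := by
  have hr := isReduction_coordRed (O := O) hϖ (Fin k)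
  obtain ⟨w, hw⟩ := exists_form_red hϖ hr h
  refine ⟨_, _, _, inferInstance, coordRed O (Fin k), w, hr, hw, ?_⟩
  obtain ⟨c, hc⟩ := exists_two_mul_eq_one (O := O) h2
  have hc' : (2 : ResidueField O) * residue O c = 1 := by
    rw [← map_ofNat (residue O), ← map_mul, hc, map_one]
  let : Invertible (2 : ResidueField O) := ⟨residue O c, by rw [mul_comm, hc'], hc'⟩
  have hnd := separatingLeft_of_isSelfDual hϖ hsd hw
  have hdiag := QuadraticForm.equivalent_weightedSumSquares_units_of_nondegenerate' w hnd
  rw [Module.finrank_fin_fun] at hdiag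
  obtain ⟨a, ⟨e⟩⟩ := hdiag
  have ha : QuadraticMap.weightedSumSquares (ResidueField O) a =
      QuadraticMap.weightedSumSquares (ResidueField O) (fun i => (a i : ResidueField O)) := by
    ext x
    simp [QuadraticMap.weightedSumSquares_apply, Units.smul_def]
  rw [ha] at e
  refine (gaussType_diagonal h2 hψ (Nat.div_add_mod k 2).symm (fun i => (a i : ResidueField O))
    (fun i => (a i).ne_zero) (by omega) ?_).congr e.symm
  set D := (-1) ^ (k.choose 2) * Matrix.det (Matrix.of fun i j : Fin k =>
      c * QuadraticMap.polar h (Pi.single i 1) (Pi.single j 1)) with hD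
  have hdet : residue O D = (-1) ^ (k.choose 2) *
      (((LinearMap.toMatrix' e.toLinearEquiv.toLinearMap).det) ^ 2 *
        ∏ i, (a i : ResidueField O)) := by
    have h3 : w = (QuadraticMap.weightedSumSquares (ResidueField O)
        (fun i => (a i : ResidueField O))).comp e.toLinearEquiv.toLinearMap := by
      ext x
      exact (e.map_app x).symm
    have h4 := det_polar_comp hc' (QuadraticMap.weightedSumSquares (ResidueField O)
        (fun i => (a i : ResidueField O))) e.toLinearEquiv.toLinearMap
    rw [← h3, det_polar_weightedSumSquares hc'] at h4
    rw [hD, map_mul, RingHom.map_det, map_pow, map_neg, map_one, ← h4]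
    congr 2
    ext i j
    have hs : ∀ i, coordRed O (Fin k) (Pi.single i 1) = Pi.single i 1 := fun i => by
      ext j
      obtain rfl | hij := eq_or_ne j i
      · simp [coordRed]
      · simp [coordRed, Pi.single_eq_of_ne hij]
    simp only [RingHom.mapMatrix_apply, Matrix.map_apply, Matrix.of_apply, map_mul,
      QuadraticMap.polar, map_sub, ← hw, map_add, hs]
  have hdet0 : (LinearMap.toMatrix' e.toLinearEquiv.toLinearMap).det ≠ 0 := by
    rw [LinearMap.det_toMatrix']
    exact (LinearEquiv.isUnit_det' e.toLinearEquiv).ne_zero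
  have hD0 : residue O D ≠ 0 := by
    rw [hdet]
    exact mul_ne_zero (pow_ne_zero _ (neg_ne_zero.2 one_ne_zero)) (mul_ne_zero (pow_ne_zero _ hdet0)
      (Finset.prod_ne_zero_iff.2 fun i _ => (a i).ne_zero))
  rw [disc_eq hc, ← hD, chi_unit hϖ h2 hD0, hdet, quadChar_mul, quadChar_mul, quadChar_pow _ 2,
    quadChar_sq hdet0, one_mul, ← quadChar_mul] at hε
  exact hε

theorem exists_isStandard_of_ringChar_ne_two (h2 : ringChar (ResidueField O) ≠ 2) (ε : ℤˣ) {k : ℕ}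
    (hk : 1 ≤ k) : ∃ h : QuadraticForm O (Fin k → O), IsStandard F ϖ ε h := by
  obtain ⟨k, rfl⟩ := Nat.exists_eq_add_of_le' hk
  obtain ⟨c, hc⟩ := exists_two_mul_eq_one (O := O) h2
  obtain ⟨a, ha, hε⟩ := exists_quadChar h2 ε
  obtain ⟨u, hu⟩ := residue_surjective ((-1) ^ ((k + 1).choose 2) * a)
  have h1 : ((-1 : ResidueField O) ^ ((k + 1).choose 2)) ^ 2 = 1 := by
    rw [← pow_mul, mul_comm, pow_mul]
    simp
  have hu0 : residue O u ≠ 0 := by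
    rw [hu]
    exact mul_ne_zero (pow_ne_zero _ (neg_ne_zero.2 one_ne_zero)) ha
  have huu : IsUnit u := by
    have : u ∉ maximalIdeal O := fun hm => hu0 ((residue_eq_zero_iff _).2 hm)
    simpa using this
  let b : Fin (k + 1) → O := Fin.cons u fun _ => 1
  have hb : ∀ i, IsUnit (b i) := by
    intro i
    refine Fin.cases huu (fun i => ?_) i
    exact isUnit_one
  choose b' hb' using fun i => (hb i).exists_right_inv
  refine ⟨QuadraticMap.weightedSumSquares O b, fun _ => ⟨⟨fun x y hxy => ?_, fun l => ?_⟩, ?_⟩,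
    fun h => absurd h h2⟩
  · ext i
    have := LinearMap.congr_fun hxy (Pi.single i (c * b' i))
    simp only [QuadraticMap.polarBilin_apply_apply, polar_weightedSumSquares] at this
    rw [Finset.sum_eq_single i (fun j _ hj => by simp [Pi.single_eq_of_ne hj]) (by simp),
      Finset.sum_eq_single i (fun j _ hj => by simp [Pi.single_eq_of_ne hj]) (by simp)] at this
    simp only [Pi.single_eq_same] at this
    have h3 : ∀ z, 2 * (b i * z * (c * b' i)) = z := fun z => by
      linear_combination (b i * b' i * z) * hc + z * hb' i
    rwa [h3, h3] at this
  · refine ⟨fun i => c * b' i * l (Pi.single i 1), LinearMap.pi_ext' fun i => LinearMap.ext_ring ?_⟩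
    simp only [LinearMap.comp_apply, LinearMap.coe_single, QuadraticMap.polarBilin_apply_apply,
      polar_weightedSumSquares]
    rw [Finset.sum_eq_single i (fun j _ hj => by simp [Pi.single_eq_of_ne hj]) (by simp)]
    simp only [Pi.single_eq_same]
    linear_combination (b i * b' i * l (Pi.single i 1)) * hc + l (Pi.single i 1) * hb' i
  · rw [disc_eq hc, det_polar_weightedSumSquares hc]
    have h3 : ∏ i, b i = u := by simp [b, Fin.prod_univ_succ]
    have h4 : residue O ((-1) ^ ((k + 1).choose 2) * u) = a := by
      rw [map_mul, hu, map_pow, map_neg, map_one]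
      linear_combination a * h1
    rw [h3, chi_unit hϖ h2 (by rwa [h4]), h4, hε]

theorem IsStandard.isSelfDual {ε : ℤˣ} {k : ℕ} {h : QuadraticForm O (Fin k → O)}
    (hh : IsStandard F ϖ ε h) : IsSelfDual h := by
  by_cases h2 : ringChar (ResidueField O) = 2
  · obtain ⟨-, j, ⟨e⟩⟩ := hh.2 h2
    exact isSelfDual_congr e.symm (isSelfDual_pi_hyperbolicPlane j)
  · exact (hh.1 h2).1

theorem IsStandard.hasGaussType (hψ : ψ.IsPrimitive) {ε : ℤˣ} {k : ℕ}
    {h : QuadraticForm O (Fin k → O)} (hh : IsStandard F ϖ ε h) :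
    HasGaussType ψ ϖ h (k % 2) (k / 2) ε := by
  by_cases h2 : ringChar (ResidueField O) = 2
  · obtain ⟨rfl, j, ⟨e⟩⟩ := hh.2 h2
    have hk : k = 2 * j := by
      have := e.toLinearEquiv.finrank_eq
      rw [Module.finrank_fin_fun, Module.finrank_pi_fintype] at this
      simp only [Module.finrank_prod, Module.finrank_self, Finset.sum_const, Finset.card_univ, Fintype.card_fin, smul_eq_mul] at this
      omega
    have h3 := (hasGaussType_pi_hyperbolicPlane hϖ hψ j).congr e.symm
    rwa [show k % 2 = 0 by omega, show k / 2 = j by omega]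
  · exact hasGaussType_of_isSelfDual hϖ hψ h2 (hh.1 h2).1 (hh.1 h2).2

end StandardOdd


/-! ### Primitive vectors of given norm -/

section Transitivity

open IsLocalRing

variable {O : Type*} [CommRing O] [IsDomain O] {Y : Type*} [AddCommGroup Y] [Module O Y]

theorem hyperbolicPlane_prod_apply (g : QuadraticForm O Y) (s t : O) (y : Y) :
    (hyperbolicPlane O).prod g ((s, t), y) = s * t + g y := rfl

/-- The Eichler transvection attached to `v`, an isometry of the sum of a hyperbolic plane and `g`. -/
def eichler (g : QuadraticForm O Y) (v : Y) :
    ((hyperbolicPlane O).prod g).IsometryEquiv ((hyperbolicPlane O).prod g) where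
  toFun x := ((x.1.1, x.1.2 - x.1.1 * g v - QuadraticMap.polar g x.2 v), x.2 + x.1.1 • v)
  map_add' x y := by
    ext
    · rfl
    · simp only [Prod.fst_add, Prod.snd_add, QuadraticMap.polar_add_left]
      ring
    · simp only [Prod.fst_add, Prod.snd_add, add_smul]
      abel
  map_smul' a x := by
    ext
    · rfl
    · simp only [Prod.smul_fst, Prod.smul_snd, QuadraticMap.polar_smul_left, smul_eq_mul,
        RingHom.id_apply]
      ring
    · simp only [Prod.smul_fst, Prod.smul_snd, smul_add, smul_eq_mul, mul_smul, RingHom.id_apply]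
  invFun x := ((x.1.1, x.1.2 - x.1.1 * g v + QuadraticMap.polar g x.2 v), x.2 - x.1.1 • v)
  left_inv x := by
    ext
    · rfl
    · simp only [QuadraticMap.polar_add_left, QuadraticMap.polar_smul_left,
        QuadraticMap.polar_self, smul_eq_mul]
      ring
    · simp
  right_inv x := by
    ext
    · rfl
    · simp only [QuadraticMap.polar_sub_left, QuadraticMap.polar_smul_left,
        QuadraticMap.polar_self, smul_eq_mul]
      ring
    · simp
  map_app' x := by
    change x.1.1 * (x.1.2 - x.1.1 * g v - QuadraticMap.polar g x.2 v) + g (x.2 + x.1.1 • v) =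
      x.1.1 * x.1.2 + g x.2
    rw [map_add_smul_form]
    ring

theorem eichler_apply (g : QuadraticForm O Y) (v : Y) (s t : O) (y : Y) :
    eichler g v ((s, t), y) = ((s, t - s * g v - QuadraticMap.polar g y v), y + s • v) := rfl

/-- The exchange of the two isotropic lines of the hyperbolic plane. -/
def hyperbolicSwap (g : QuadraticForm O Y) :
    ((hyperbolicPlane O).prod g).IsometryEquiv ((hyperbolicPlane O).prod g) where
  toLinearEquiv := (LinearEquiv.prodComm O O O).prodCongr (LinearEquiv.refl O Y)
  map_app' x := by
    change x.1.2 * x.1.1 + g x.2 = x.1.1 * x.1.2 + g x.2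
    ring

theorem hyperbolicSwap_apply (g : QuadraticForm O Y) (s t : O) (y : Y) :
    hyperbolicSwap g ((s, t), y) = ((t, s), y) := rfl

/-- The isometry of the hyperbolic plane that multiplies one isotropic line by a unit. -/
def hyperbolicScale (g : QuadraticForm O Y) (u : Oˣ) :
    ((hyperbolicPlane O).prod g).IsometryEquiv ((hyperbolicPlane O).prod g) where
  toLinearEquiv := ((LinearEquiv.smulOfUnit u).prodCongr
    (LinearEquiv.smulOfUnit u⁻¹)).prodCongr (LinearEquiv.refl O Y)
  map_app' x := by
    change ((u : O) * x.1.1) * (((u⁻¹ : Oˣ) : O) * x.1.2) + g x.2 = x.1.1 * x.1.2 + g x.2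
    rw [mul_mul_mul_comm, Units.mul_inv, one_mul]

theorem hyperbolicScale_apply (g : QuadraticForm O Y) (u : Oˣ) (s t : O) (y : Y) :
    hyperbolicScale g u ((s, t), y) = ((u * s, ((u⁻¹ : Oˣ) : O) * t), y) := rfl

variable [IsDiscreteValuationRing O] {ϖ : O} (hϖ : Irreducible ϖ)

/-- A vector with a unit hyperbolic coordinate is moved to the hyperbolic plane. -/
theorem exists_isometryEquiv_of_isUnit {g : QuadraticForm O Y} {s : O} (hs : IsUnit s) (t : O)
    (y : Y) : ∃ σ : ((hyperbolicPlane O).prod g).IsometryEquiv ((hyperbolicPlane O).prod g),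
      σ ((s, t), y) = ((1, s * t + g y), 0) := by
  obtain ⟨u, rfl⟩ := hs
  refine ⟨(hyperbolicScale g u⁻¹).trans (eichler g (-y)), ?_⟩
  change eichler g (-y) (hyperbolicScale g u⁻¹ ((u, t), y)) = _
  rw [hyperbolicScale_apply, eichler_apply]
  ext
  · simp
  · simp only [Units.inv_mul, inv_inv, one_mul, QuadraticMap.map_neg, QuadraticMap.polar_neg_right,
      QuadraticMap.polar_self]
    simp only [two_smul]
    ring
  · simp

include hϖ

/-- The isometries act transitively on the primitive vectors of given norm. -/
theorem exists_isometryEquiv_of_primitive {g : QuadraticForm O Y} (hg : IsSelfDual g)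
    {x : (O × O) × Y} (hx : ¬ ∃ x', x = ϖ • x') :
    ∃ σ : ((hyperbolicPlane O).prod g).IsometryEquiv ((hyperbolicPlane O).prod g),
      σ x = ((1, (hyperbolicPlane O).prod g x), 0) := by
  obtain ⟨⟨s, t⟩, y⟩ := x
  rw [hyperbolicPlane_prod_apply]
  by_cases hs : IsUnit s
  · exact exists_isometryEquiv_of_isUnit hs t y
  by_cases ht : IsUnit t
  · obtain ⟨σ, hσ⟩ := exists_isometryEquiv_of_isUnit (g := g) ht s y
    refine ⟨(hyperbolicSwap g).trans σ, ?_⟩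
    change σ (hyperbolicSwap g ((s, t), y)) = _
    rw [hyperbolicSwap_apply, hσ, mul_comm]
  have hdvd : ∀ {a : O}, ¬ IsUnit a → ϖ ∣ a := fun {a} ha => by
    rw [← Ideal.mem_span_singleton, ← hϖ.maximalIdeal_eq]
    exact ha
  obtain ⟨v, hv⟩ : ∃ v, IsUnit (QuadraticMap.polar g y v) := by
    by_contra! hv
    obtain ⟨y', rfl⟩ := exists_smul_of_polar_dvd hϖ.ne_zero hg fun v => hdvd (hv v)
    obtain ⟨s', rfl⟩ := hdvd hs
    obtain ⟨t', rfl⟩ := hdvd ht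
    exact hx ⟨((s', t'), y'), rfl⟩
  have hu : IsUnit (s - t * g v - QuadraticMap.polar g y v) := by
    by_contra h
    have h1 : ϖ ∣ QuadraticMap.polar g y v := by
      have h2 := ((hdvd hs).sub ((hdvd ht).mul_right (g v))).sub (hdvd h)
      rwa [sub_sub_cancel] at h2
    exact hϖ.not_isUnit (isUnit_of_dvd_unit h1 hv)
  obtain ⟨σ, hσ⟩ := exists_isometryEquiv_of_isUnit (g := g) hu t (y + t • v)
  refine ⟨((hyperbolicSwap g).trans ((eichler g v).trans (hyperbolicSwap g))).trans σ, ?_⟩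
  change σ (hyperbolicSwap g (eichler g v (hyperbolicSwap g ((s, t), y)))) = _
  rw [hyperbolicSwap_apply, eichler_apply, hyperbolicSwap_apply, hσ, map_add_smul_form]
  ext
  · rfl
  · simp only
    ring
  · rfl

end Transitivity

section OrthogonalComplement

open IsLocalRing

variable {O : Type*} [CommRing O] [IsDomain O] {Z : Type*} [AddCommGroup Z] [Module O Z]

/-- The orthogonal sum of two hyperbolic planes and `h`. -/
def addPlanes (h : QuadraticForm O Z) : QuadraticForm O ((O × O) × ((O × O) × Z)) :=
  (hyperbolicPlane O).prod ((hyperbolicPlane O).prod h)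

variable (O Z) in
/-- The vector `(1, N)` of a hyperbolic plane has the norm `N`, and its orthogonal complement in a
sum of two hyperbolic planes is `δ(N)`. The first coordinate is the product with this vector. -/
def deltaCoord (N : O) :
    ((O × O) × ((O × O) × Z)) ≃ₗ[O] O × ((O × O × O) × Z) where
  toFun x := (x.1.2 + N * x.1.1, ((x.1.1, x.2.1.1, -x.2.1.2), x.2.2))
  map_add' x y := by
    ext <;> simp <;> ring
  map_smul' a x := by
    ext <;> simp
    ring
  invFun y := ((y.2.1.1, y.1 - N * y.2.1.1), ((y.2.1.2.1, -y.2.1.2.2), y.2.2))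
  left_inv x := by
    ext <;> simp
  right_inv y := by
    ext <;> simp

theorem delta_prod_deltaCoord (N : O) (h : QuadraticForm O Z) (x : (O × O) × ((O × O) × Z)) :
    addPlanes h x =
      (delta N).prod h (deltaCoord O Z N x).2 + x.1.1 * (deltaCoord O Z N x).1 := by
  obtain ⟨⟨s, t⟩, ⟨b, c⟩, z⟩ := x
  rw [addPlanes, hyperbolicPlane_prod_apply, hyperbolicPlane_prod_apply]
  change _ = delta N (s, b, -c) + h z + s * (t + N * s)
  rw [delta_apply, Matrix.det_fin_two]
  simp
  ring

theorem polar_eq_deltaCoord (N N' : O) (h : QuadraticForm O Z) (x : (O × O) × ((O × O) × Z)) :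
    QuadraticMap.polar (addPlanes h) x ((1, N'), 0) =
      (deltaCoord O Z N x).1 + (N' - N) * x.1.1 := by
  obtain ⟨⟨s, t⟩, ⟨b, c⟩, z⟩ := x
  have : ((s, t), (b, c), z) + (((1, N'), 0) : (O × O) × ((O × O) × Z)) =
    ((s + 1, t + N'), (b, c), z) := by simp
  rw [QuadraticMap.polar, this]
  simp only [addPlanes, hyperbolicPlane_prod_apply, map_zero]
  change _ = t + N * s + (N' - N) * s
  ring

theorem isSelfDual_addPlanes {h : QuadraticForm O Z} (hh : IsSelfDual h) :
    IsSelfDual (addPlanes h) :=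
  isSelfDual_prod isSelfDual_hyperbolicPlane (isSelfDual_prod isSelfDual_hyperbolicPlane hh)

theorem exists_isometryEquiv_addPlanes [IsDiscreteValuationRing O] {ϖ : O} (hϖ : Irreducible ϖ)
    {h : QuadraticForm O Z} (hh : IsSelfDual h) {x : (O × O) × ((O × O) × Z)}
    (hx : ¬ ∃ x', x = ϖ • x') : ∃ σ : (addPlanes h).IsometryEquiv (addPlanes h),
      σ x = ((1, addPlanes h x), 0) :=
  exists_isometryEquiv_of_primitive hϖ (isSelfDual_prod isSelfDual_hyperbolicPlane hh) hx

end OrthogonalComplement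


/-! ### Fibration over the primitive vectors -/

section Fibration

open IsLocalRing

variable {O : Type*} [CommRing O] [IsDomain O] [IsDiscreteValuationRing O]
  [Finite (ResidueField O)] [TopologicalSpace O] [IsTopologicalRing O] [CompactSpace O]
  [T2Space O] {F : Type*} [Field F] [Algebra O F] [FaithfulSMul O F]
  {H : Type*} [AddCommGroup H] [Module O H] [Module.Finite O H] [Module.Free O H]
  {Z : Type*} [AddCommGroup Z] [Module O Z] [Module.Finite O Z] [Module.Free O Z]
  {M : Type*} [AddCommGroup M] [Module O M] [Module.Finite O M] [Module.Free O M]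
  {ϖ : O}

theorem exists_linearMap_smul {a : O} (ha : a ≠ 0) {l : M →ₗ[O] H} (h : ∀ y, ∃ b, l y = a • b) :
    ∃ l' : M →ₗ[O] H, l = a • l' := by
  have hinj := smul_right_injective H ha
  choose f hf using h
  refine ⟨⟨⟨f, fun y z => hinj ?_⟩, fun c y => hinj ?_⟩, LinearMap.ext hf⟩
  · simp only [smul_add, ← hf, map_add]
  · simp only [RingHom.id_apply, ← hf, map_smul, smul_comm a c]

/-- A representation of `Q ⟂ ⟨N⟩` modulo `ϖ ^ d` is a pair of orthogonal representations of `Q` and of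
`⟨N⟩`. -/
theorem coprod_mem_repSet_iff {qH : QuadraticForm O H} {Q : QuadraticMap O M F} {N : O} {d : ℕ}
    {φ₁ : M →ₗ[O] H} {φ₂ : O →ₗ[O] H} :
    LinearMap.coprod φ₁ φ₂ ∈ repSet ϖ qH (Q.prod (rankOne (algebraMap O F N))) d ↔
      (∀ y, ϖ ^ d ∣ QuadraticMap.polar qH (φ₁ y) (φ₂ 1)) ∧ φ₁ ∈ repSet ϖ qH Q d ∧
        φ₂ ∈ repSet ϖ qH (toF F (N • QuadraticMap.sq)) d := by
  have hinj := FaithfulSMul.algebraMap_injective O F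
  have h2 : ∀ t, φ₂ t = t • φ₂ 1 := fun t => by rw [← map_smul, smul_eq_mul, mul_one]
  have hQ : ∀ y t, (Q.prod (rankOne (algebraMap O F N))) (y, t) =
      Q y + toF F (N • QuadraticMap.sq) t := fun y t => by
    rw [QuadraticMap.prod_apply, rankOne_apply, toF_apply, smul_apply, QuadraticMap.sq_apply,
      smul_eq_mul, map_mul, map_mul]
    ring
  have hq : ∀ y t, qH (LinearMap.coprod φ₁ φ₂ (y, t)) = qH (φ₁ y) + qH (φ₂ t) +
      t * QuadraticMap.polar qH (φ₁ y) (φ₂ 1) := fun y t => by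
    rw [LinearMap.coprod_apply, QuadraticMap.map_add qH, h2 t, QuadraticMap.polar_smul_right,
      smul_eq_mul]
  constructor
  · intro h
    have h3 : φ₁ ∈ repSet ϖ qH Q d := fun y => by
      obtain ⟨a, ha⟩ := h (y, 0)
      exact ⟨a, by rw [← ha, hq, hQ]; simp⟩
    have h4 : φ₂ ∈ repSet ϖ qH (toF F (N • QuadraticMap.sq)) d := fun t => by
      obtain ⟨a, ha⟩ := h (0, t)
      refine ⟨a, ?_⟩
      rw [← ha, hq, hQ]
      simp [QuadraticMap.polar_zero_left]
    refine ⟨fun y => ?_, h3, h4⟩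
    obtain ⟨a, ha⟩ := h (y, 1)
    obtain ⟨b, hb⟩ := h3 y
    obtain ⟨c, hc⟩ := h4 1
    refine ⟨a - b - c, hinj ?_⟩
    rw [hq, hQ] at ha
    simp only [map_add, map_mul, one_mul, map_sub] at ha hb hc ⊢
    linear_combination ha - hb - hc
  · rintro ⟨h1, h3, h4⟩ ⟨y, t⟩
    obtain ⟨a, ha⟩ := h1 y
    obtain ⟨b, hb⟩ := h3 y
    obtain ⟨c, hc⟩ := h4 t
    refine ⟨b + c + t * a, ?_⟩
    rw [hq, hQ, ha]
    simp only [map_add, map_mul] at hb hc ⊢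
    linear_combination hb + hc

variable (hϖ : Irreducible ϖ)

include hϖ

theorem vol_smul (X : Type*) [AddCommGroup X] [Module O X] [Module.Finite O X] [Module.Free O X]
    (d : ℕ) : vol O {x : X | ∃ y, x = ϖ ^ d • y} =
      (residueCard O ^ (d * Module.finrank O X))⁻¹ := by
  have hper : PerMod ϖ d {x : X | ∃ y, x = ϖ ^ d • y} := by
    rintro _ ⟨y, rfl⟩ z
    exact ⟨y + z, (smul_add _ _ _).symm⟩
  rw [vol_eq_card_div hϖ hper]
  have : (fun x => (Submodule.Quotient.mk x : Red X ϖ d)) '' {x : X | ∃ y, x = ϖ ^ d • y} = {0} := by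
    ext z
    constructor
    · rintro ⟨_, ⟨y, rfl⟩, rfl⟩
      exact red_mk_eq_zero.2 ⟨y, rfl⟩
    · rintro rfl
      exact ⟨0, ⟨0, by simp⟩, rfl⟩
  rw [this, Nat.card_unique, Nat.cast_one, one_div]

/-- The representations of `Q` orthogonal to a primitive vector `x` of norm `N` amount to the
representations of `Q` in `δ(N) ⟂ h`. -/
theorem vol_orthogonal_inter_repSet {h : QuadraticForm O Z} (hh : IsSelfDual h)
    (Q : QuadraticMap O M F) {N : O} {d : ℕ} {x : (O × O) × ((O × O) × Z)}
    (hx : ¬ ∃ x', x = ϖ • x')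
    (hN : ϖ ^ d ∣ addPlanes h x - N) :
    vol O ({φ : M →ₗ[O] (O × O) × ((O × O) × Z) | ∀ y, ϖ ^ d ∣ QuadraticMap.polar
        (addPlanes h) (φ y) x} ∩
        repSet ϖ (addPlanes h) Q d) =
      (residueCard O ^ (d * Module.finrank O M))⁻¹ *
        vol O (repSet ϖ ((delta N).prod h) Q d) := by
  obtain ⟨σ, hσ⟩ := exists_isometryEquiv_addPlanes hϖ hh hx
  let e := σ.toLinearEquiv.trans (deltaCoord O Z N)
  let E : (M →ₗ[O] (O × O) × ((O × O) × Z)) ≃ₗ[O]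
      (M →ₗ[O] O) × (M →ₗ[O] (O × O × O) × Z) :=
    (e.congrRight (M := M)).trans (LinearMap.prodEquiv O).symm
  let S : Set ((M →ₗ[O] O) × (M →ₗ[O] (O × O × O) × Z)) :=
    {p | (∃ l', p.1 = ϖ ^ d • l') ∧ p.2 ∈ repSet ϖ ((delta N).prod h) Q d}
  have hS : PerMod ϖ d S := by
    rintro ⟨_, φ⟩ ⟨⟨l', rfl⟩, hφ⟩ ⟨l, φ'⟩
    exact ⟨⟨l' + l, (smul_add _ _ _).symm⟩, perMod_repSet _ _ _ _ _ hφ _⟩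
  have hE1 : ∀ φ y, (E φ).1 y = (e (φ y)).1 := fun φ y => rfl
  have hE2 : ∀ φ y, (E φ).2 y = (e (φ y)).2 := fun φ y => rfl
  have hpolar : ∀ z, QuadraticMap.polar (addPlanes h) z x = (e z).1 + (addPlanes h x - N) * (σ z).1.1 := fun z => by
    have h1 : QuadraticMap.polar (addPlanes h) z x = QuadraticMap.polar (addPlanes h) (σ z) (σ x) := by
      simp only [QuadraticMap.polar, ← map_add, QuadraticMap.IsometryEquiv.map_app]
    rw [h1, hσ, polar_eq_deltaCoord N]
    rfl
  have hnorm : ∀ z, addPlanes h z = (delta N).prod h (e z).2 + (σ z).1.1 * (e z).1 := fun z => by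
    rw [← σ.map_app z, delta_prod_deltaCoord N]
    rfl
  have hdvd : ∀ z, ϖ ^ d ∣ QuadraticMap.polar (addPlanes h) z x ↔ ϖ ^ d ∣ (e z).1 := fun z => by
    rw [hpolar]
    exact dvd_add_left (hN.mul_right _)
  have hpre : {φ : M →ₗ[O] (O × O) × ((O × O) × Z) | ∀ y, ϖ ^ d ∣ QuadraticMap.polar (addPlanes h) (φ y) x} ∩
      repSet ϖ (addPlanes h) Q d = E ⁻¹' S := by
    ext φ
    have h1 : (∀ y, ϖ ^ d ∣ QuadraticMap.polar (addPlanes h) (φ y) x) ↔ ∃ l', (E φ).1 = ϖ ^ d • l' := by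
      simp only [hdvd]
      constructor
      · exact fun h => exists_linearMap_smul (pow_ne_zero _ hϖ.ne_zero) h
      · rintro ⟨l', hl'⟩ y
        exact ⟨l' y, (LinearMap.congr_fun hl' y)⟩
    constructor
    · rintro ⟨h2, h3⟩
      refine ⟨h1.1 h2, fun y => ?_⟩
      obtain ⟨a, ha⟩ := h3 y
      obtain ⟨b, hb⟩ := (hdvd _).1 (h2 y)
      refine ⟨a - (σ (φ y)).1.1 * b, ?_⟩
      rw [hE2]
      rw [hnorm, hb] at ha
      simp only [map_add, map_mul, map_sub] at ha ⊢
      linear_combination ha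
    · rintro ⟨h2, h3⟩
      refine ⟨h1.2 h2, fun y => ?_⟩
      obtain ⟨a, ha⟩ := h3 y
      obtain ⟨b, hb⟩ := (hdvd _).1 (h1.2 h2 y)
      refine ⟨a + (σ (φ y)).1.1 * b, ?_⟩
      rw [hE2] at ha
      rw [hnorm, hb]
      simp only [map_add, map_mul] at ha ⊢
      linear_combination ha
  rw [hpre, vol_preimage_equiv hϖ E hS, vol_prod hϖ hS (perMod_repSet _ _ _ _) (fun p hp => hp.2)
    (v := (residueCard O ^ (d * Module.finrank O M))⁻¹)]
  intro φ hφ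
  rw [← Module.finrank_linearMap_self O O M, ← vol_smul hϖ]
  congr 1
  ext l
  exact and_iff_left hφ

theorem perMod_primitive :
    PerMod ϖ 1 {φ : O →ₗ[O] H | ¬ ∃ x', φ 1 = ϖ • x'} := by
  rintro φ hφ ψ ⟨x', hx'⟩
  refine hφ ⟨x' - ψ 1, ?_⟩
  rw [smul_sub, ← hx', LinearMap.add_apply, LinearMap.smul_apply, pow_one, add_sub_cancel_right]

/-- The representations of `Q ⟂ ⟨N⟩` for which the image `x` of the generator of `⟨N⟩` is primitive
are fibred over the possible `x`, with fibres of constant volume. -/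
theorem vol_primitive_inter_repSet_prod {h : QuadraticForm O Z} (hh : IsSelfDual h)
    (Q : QuadraticMap O M F) (N : O) {d : ℕ} (hd : 1 ≤ d) :
    vol O ({φ : M × O →ₗ[O] (O × O) × ((O × O) × Z) | ¬ ∃ x', φ (0, 1) = ϖ • x'} ∩
        repSet ϖ (addPlanes h) (Q.prod (rankOne (algebraMap O F N))) d) =
      (residueCard O ^ (d * Module.finrank O M))⁻¹ *
        vol O (repSet ϖ ((delta N).prod h) Q d) *
        vol O ({φ : O →ₗ[O] (O × O) × ((O × O) × Z) | ¬ ∃ x', φ 1 = ϖ • x'} ∩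
          repSet ϖ (addPlanes h) (toF F (N • QuadraticMap.sq)) d) := by
  let E := LinearMap.coprodEquiv (R := O) (M := M) (M₂ := O) (M₃ := (O × O) × ((O × O) × Z)) O
  have hprim : PerMod ϖ d {φ : O →ₗ[O] (O × O) × ((O × O) × Z) | ¬ ∃ x', φ 1 = ϖ • x'} := by
    obtain ⟨k, rfl⟩ := Nat.exists_eq_add_of_le hd
    intro φ hφ ψ
    rw [pow_add, mul_smul]
    exact perMod_primitive hϖ φ hφ _
  have hT : PerMod ϖ d ({φ : O →ₗ[O] (O × O) × ((O × O) × Z) | ¬ ∃ x', φ 1 = ϖ • x'} ∩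
      repSet ϖ (addPlanes h) (toF F (N • QuadraticMap.sq)) d) := fun φ hφ ψ =>
    ⟨hprim φ hφ.1 ψ, perMod_repSet _ _ _ _ φ hφ.2 ψ⟩
  have h1 : ∀ p, E p (0, 1) = p.2 1 := fun p => by
    simp [E]
  have hS : PerMod ϖ d ({φ : M × O →ₗ[O] (O × O) × ((O × O) × Z) | ¬ ∃ x', φ (0, 1) = ϖ • x'} ∩
      repSet ϖ (addPlanes h) (Q.prod (rankOne (algebraMap O F N))) d) := by
    rintro φ ⟨hφ, hφ'⟩ ψ
    refine ⟨?_, perMod_repSet _ _ _ _ φ hφ' ψ⟩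
    obtain ⟨p, rfl⟩ := E.surjective φ
    obtain ⟨p', rfl⟩ := E.surjective ψ
    rw [Set.mem_ofPred_eq, h1] at hφ
    rw [Set.mem_ofPred_eq, ← map_smul, ← map_add, h1]
    exact hprim p.2 hφ p'.2
  have hS' : PerMod ϖ d (E ⁻¹' ({φ : M × O →ₗ[O] (O × O) × ((O × O) × Z) |
      ¬ ∃ x', φ (0, 1) = ϖ • x'} ∩
      repSet ϖ (addPlanes h) (Q.prod (rankOne (algebraMap O F N))) d)) := by
    intro p hp p'
    rw [Set.mem_preimage, map_add, map_smul]
    exact hS _ hp _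
  have hmem : ∀ p, p ∈ E ⁻¹' ({φ : M × O →ₗ[O] (O × O) × ((O × O) × Z) |
      ¬ ∃ x', φ (0, 1) = ϖ • x'} ∩
      repSet ϖ (addPlanes h) (Q.prod (rankOne (algebraMap O F N))) d) ↔
      (¬ ∃ x', p.2 1 = ϖ • x') ∧ ((∀ y, ϖ ^ d ∣ QuadraticMap.polar (addPlanes h) (p.1 y) (p.2 1)) ∧
        p.1 ∈ repSet ϖ (addPlanes h) Q d ∧
        p.2 ∈ repSet ϖ (addPlanes h) (toF F (N • QuadraticMap.sq)) d) := fun p => by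
    rw [Set.mem_preimage, Set.mem_inter_iff, Set.mem_ofPred_eq, h1, ← coprod_mem_repSet_iff]
    rfl
  rw [← vol_preimage_equiv hϖ E hS, vol_prod hϖ hS' hT
    (fun p hp => ⟨((hmem p).1 hp).1, ((hmem p).1 hp).2.2.2⟩)]
  rintro φ₂ ⟨hφ, hφ'⟩
  obtain ⟨a, ha⟩ := hφ' 1
  rw [← vol_orthogonal_inter_repSet (F := F) hϖ hh Q (N := N) (x := φ₂ 1) hφ ⟨a, ?_⟩]
  · congr 1
    ext φ₁
    have := hmem (φ₁, φ₂)
    exact this.trans ⟨fun h => ⟨h.2.1, h.2.2.1⟩, fun h => ⟨hφ, h.1, h.2, hφ'⟩⟩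
  · apply FaithfulSMul.algebraMap_injective O F
    rw [map_sub, ← ha, toF_apply]
    simp

end Fibration


/-! ### Rescaling of the last coordinate -/

section LastCoordinate

open IsLocalRing

variable {O : Type*} [CommRing O] {M : Type*} [AddCommGroup M] [Module O M]

/-- Multiplication of the last coordinate by `a`. -/
def scaleSnd (M : Type*) [AddCommGroup M] [Module O M] (a : O) : M × O →ₗ[O] M × O :=
  LinearMap.prodMap LinearMap.id (a • LinearMap.id)

/-- Multiplication of all the coordinates but the last by `a`. -/
def scaleFst (M : Type*) [AddCommGroup M] [Module O M] (a : O) : M × O →ₗ[O] M × O :=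
  LinearMap.prodMap (a • LinearMap.id) LinearMap.id

theorem scaleSnd_apply (a : O) (y : M) (t : O) : scaleSnd M a (y, t) = (y, a * t) := rfl

/-- The form `(y, t) ↦ a * t * l y + c * t ^ 2`, where `p = (l, c)`. -/
def mixedForm (a : O) (p : (M →ₗ[O] O) × O) : QuadraticForm O (M × O) :=
  a • QuadraticMap.linMulLin (LinearMap.snd O M O) (p.1 ∘ₗ LinearMap.fst O M O) +
    p.2 • (QuadraticMap.sq (R := O)).comp (LinearMap.snd O M O)

theorem mixedForm_apply (a : O) (p : (M →ₗ[O] O) × O) (y : M) (t : O) :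
    mixedForm a p (y, t) = a * (t * p.1 y) + p.2 * (t * t) := rfl

theorem mixedForm_add (a : O) (p p' : (M →ₗ[O] O) × O) :
    mixedForm a (p + p') = mixedForm a p + mixedForm a p' := by
  ext ⟨y, t⟩
  simp only [add_apply, mixedForm_apply, Prod.fst_add, Prod.snd_add, LinearMap.add_apply]
  ring

theorem mixedForm_scaleSnd (a : O) (p : (M →ₗ[O] O) × O) :
    (mixedForm a p).comp (scaleSnd M a) = a ^ 2 • mixedForm 1 p := by
  ext ⟨y, t⟩
  simp only [QuadraticMap.comp_apply, smul_apply, scaleSnd_apply, mixedForm_apply, smul_eq_mul]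
  ring

variable [IsDomain O] [IsDiscreteValuationRing O]
  [Finite (ResidueField O)] [TopologicalSpace O] [IsTopologicalRing O] [CompactSpace O]
  [T2Space O] {F : Type*} [Field F] [Algebra O F] [FaithfulSMul O F]
  [Module.Finite O M] [Module.Free O M] {ϖ : O} (hϖ : Irreducible ϖ)

include hϖ

/-- The forms on `M ⟂ ϖ ^ (-1) O` modulo those integral on `M ⟂ O` are counted by their mixed and
last coefficients. -/
theorem overIndex_scaleSnd :
    (overIndex F (scaleSnd M ϖ) : ℝ) = residueCard O ^ (Module.finrank O M + 2) := by
  have hinj := FaithfulSMul.algebraMap_injective O F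
  have h0 : algebraMap O F ϖ ≠ 0 := fun h => hϖ.ne_zero (hinj (by rw [h, map_zero]))
  have hfin : Finite (overForms F (scaleSnd M ϖ) ⧸
      (intForms O F (M × O)).addSubgroupOf (overForms F (scaleSnd M ϖ))) :=
    finite_overForms_quotient (F := F) hϖ (A := scaleSnd M ϖ) (B := scaleFst M ϖ) (c := 1)
      (fun x => by rw [pow_one]; rfl)
  let G : (M →ₗ[O] O) × O → QuadraticMap O (M × O) F := fun p =>
    ((algebraMap O F ϖ ^ 2)⁻¹ : F) • toF F (mixedForm ϖ p)
  have hG : ∀ p y t, G p (y, t) = (algebraMap O F ϖ ^ 2)⁻¹ * algebraMap O F (mixedForm ϖ p (y, t)) :=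
    fun p y t => rfl
  have hGmem : ∀ p, G p ∈ overForms F (scaleSnd M ϖ) := fun p => by
    refine ⟨mixedForm 1 p, ?_⟩
    ext ⟨y, t⟩
    have h1 := congrArg (fun R => R (y, t)) (mixedForm_scaleSnd ϖ p)
    simp only [QuadraticMap.comp_apply, smul_apply, smul_eq_mul] at h1
    rw [QuadraticMap.comp_apply, toF_apply]
    change _ = (algebraMap O F ϖ ^ 2)⁻¹ * algebraMap O F (mixedForm ϖ p (scaleSnd M ϖ (y, t)))
    rw [h1, map_mul, map_pow, inv_mul_cancel_left₀ (pow_ne_zero _ h0)]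
  let g : (M →ₗ[O] O) × O →+ overForms F (scaleSnd M ϖ) :=
    AddMonoidHom.mk' (fun p => ⟨G p, hGmem p⟩) fun p p' => by
      ext1
      simp only [G, mixedForm_add, toF_add, smul_add]
      rfl
  let f : (M →ₗ[O] O) × O →+ overForms F (scaleSnd M ϖ) ⧸
      (intForms O F (M × O)).addSubgroupOf (overForms F (scaleSnd M ϖ)) :=
    (QuotientAddGroup.mk' _).comp g
  -- the classes of the forms `ϖ ^ (-2) (ϖ t l y + c t ^ 2)`, with `l` modulo `ϖ` and `c` modulo
  -- `ϖ ^ 2`, make up the quotient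
  have hker : ∀ p, f p = 0 ↔ (∃ l', p.1 = ϖ ^ 1 • l') ∧ ∃ c', p.2 = ϖ ^ 2 • c' := fun p => by
    have h1 : f p = 0 ↔ G p ∈ intForms O F (M × O) := by
      change (QuotientAddGroup.mk (g p) : _ ⧸ _) = 0 ↔ _
      rw [QuotientAddGroup.eq_zero_iff, AddSubgroup.mem_addSubgroupOf]
      rfl
    rw [h1]
    constructor
    · rintro ⟨R, hR⟩
      have h2 : ∀ y t, mixedForm ϖ p (y, t) = ϖ ^ 2 * R (y, t) := fun y t => by
        apply hinj
        have h3 := congrArg (fun R => R (y, t)) hR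
        simp only [toF_apply, hG] at h3
        rw [map_mul, h3, map_pow, mul_inv_cancel_left₀ (pow_ne_zero _ h0)]
      have h4 : p.2 = ϖ ^ 2 * R (0, 1) := by
        rw [← h2, mixedForm_apply]
        simp
      refine ⟨exists_linearMap_smul (pow_ne_zero _ hϖ.ne_zero) fun y =>
        ⟨R (y, 1) - R (0, 1), ?_⟩, R (0, 1), h4⟩
      have h5 := h2 y 1
      rw [mixedForm_apply, h4] at h5
      apply mul_left_cancel₀ hϖ.ne_zero
      rw [smul_eq_mul]
      linear_combination h5
    · rintro ⟨⟨l', hl⟩, c', hc⟩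
      refine ⟨mixedForm 1 (l', c'), ?_⟩
      ext ⟨y, t⟩
      rw [toF_apply, hG, eq_inv_mul_iff_mul_eq₀ (pow_ne_zero _ h0), ← map_pow, ← map_mul]
      congr 1
      rw [mixedForm_apply, mixedForm_apply, hl, hc]
      simp only [LinearMap.smul_apply, smul_eq_mul]
      ring
  have hsurj : Function.Surjective f := by
    intro c
    obtain ⟨⟨R, S, hS⟩, rfl⟩ := QuotientAddGroup.mk_surjective c
    refine ⟨((QuadraticMap.polarBilin S (0, 1)) ∘ₗ LinearMap.inl O M O, S (0, 1)), ?_⟩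
    change (QuotientAddGroup.mk (g _) : _ ⧸ _) = _
    rw [QuotientAddGroup.eq, AddSubgroup.mem_addSubgroupOf]
    refine ⟨S.comp (LinearMap.inl O M O ∘ₗ LinearMap.fst O M O), ?_⟩
    ext ⟨y, t⟩
    change algebraMap O F (S (y, 0)) = -(G _ (y, t)) + R (y, t)
    have h1 : algebraMap O F ϖ ^ 2 * R (y, t) = algebraMap O F (S (ϖ • y, t)) := by
      have h2 := congrArg (fun R => R (ϖ • y, t)) hS
      simp only [toF_apply, QuadraticMap.comp_apply, scaleSnd_apply] at h2
      rw [h2, show ((ϖ • y, ϖ * t) : M × O) = ϖ • (y, t) from rfl, QuadraticMap.map_smul,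
        Algebra.smul_def, map_mul, sq]
    have h3 : S (ϖ • y, t) = ϖ ^ 2 * S (y, 0) + mixedForm ϖ
        ((QuadraticMap.polarBilin S (0, 1)) ∘ₗ LinearMap.inl O M O, S (0, 1)) (y, t) := by
      have h4 : ((ϖ • y, t) : M × O) = t • (0, 1) + ϖ • (y, 0) := by
        ext <;> simp
      rw [h4, map_add_smul_form, QuadraticMap.map_smul, QuadraticMap.polar_smul_left,
        mixedForm_apply]
      simp only [LinearMap.comp_apply, QuadraticMap.polarBilin_apply_apply, LinearMap.inl_apply,
        smul_eq_mul]
      ring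
    rw [hG]
    apply mul_left_cancel₀ (pow_ne_zero 2 h0)
    rw [mul_add, h1, h3, mul_neg, mul_inv_cancel_left₀ (pow_ne_zero _ h0), map_add, map_mul, map_pow]
    ring
  have h1 := vol_preimage hϖ f hsurj (d := 2) (fun x => (hker _).2
    ⟨⟨ϖ • x.1, by rw [smul_smul, pow_one, ← sq]; rfl⟩, x.2, rfl⟩) {0}
  have h2 : f ⁻¹' {0} = {p : (M →ₗ[O] O) × O | (∃ l', p.1 = ϖ ^ 1 • l') ∧ ∃ c', p.2 = ϖ ^ 2 • c'} := by
    ext p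
    exact hker p
  rw [h2, vol_prod hϖ (d := 2) (T := {c : O | ∃ c', c = ϖ ^ 2 • c'})
    (v := (residueCard O ^ (1 * Module.finrank O M))⁻¹), vol_smul hϖ] at h1
  · rw [Nat.card_unique, Module.finrank_self, mul_one, one_mul, Nat.cast_one, one_div,
      ← mul_inv, ← pow_add] at h1
    exact (inv_injective h1).symm
  · rintro ⟨_, _⟩ ⟨⟨l', rfl⟩, c', rfl⟩ ⟨l, c⟩
    exact ⟨⟨l' + ϖ • l, by rw [smul_add, smul_smul, pow_one, ← sq]; rfl⟩, c' + c, (smul_add _ _ _).symm⟩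
  · rintro _ ⟨c', rfl⟩ c
    exact ⟨c' + c, (smul_add _ _ _).symm⟩
  · exact fun x hx => hx.2
  · rintro c hc
    rw [← Module.finrank_linearMap_self O O M, ← vol_smul hϖ]
    congr 1
    ext l
    exact and_iff_left hc

end LastCoordinate


/-! ### Counting primitive vectors -/

section PrimitiveCount

open IsLocalRing

section Volumes

variable {O : Type*} [CommRing O] [IsDomain O] [IsDiscreteValuationRing O]
  [Finite (ResidueField O)] [TopologicalSpace O] [IsTopologicalRing O] [CompactSpace O]
  [T2Space O] {F : Type*} [Field F] [Algebra O F] [FaithfulSMul O F]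
  {H : Type*} [AddCommGroup H] [Module O H] [Module.Finite O H] [Module.Free O H]
  {M : Type*} [AddCommGroup M] [Module O M] [Module.Finite O M] [Module.Free O M]
  {ϖ : O} (hϖ : Irreducible ϖ)

theorem range_comp_scaleSnd :
    {φ : M × O →ₗ[O] H | ∃ φ' : M × O →ₗ[O] H, φ'.comp (scaleSnd M ϖ) = φ} =
      {φ | ∃ x', φ (0, 1) = ϖ • x'} := by
  ext φ
  constructor
  · rintro ⟨φ', rfl⟩
    refine ⟨φ' (0, 1), ?_⟩
    rw [LinearMap.comp_apply, scaleSnd_apply, ← map_smul]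
    simp
  · rintro ⟨x', hx'⟩
    refine ⟨LinearMap.coprod (φ ∘ₗ LinearMap.inl O M O) (LinearMap.toSpanSingleton O H x'), ?_⟩
    refine LinearMap.prod_ext ?_ (LinearMap.ext_ring ?_)
    · ext y
      simp [scaleSnd_apply]
    · simp only [LinearMap.comp_apply, LinearMap.inr_apply, scaleSnd_apply, hx',
        LinearMap.coprod_apply, LinearMap.toSpanSingleton_apply, LinearMap.inl_apply, mul_one]
      exact (congrArg (· + ϖ • x') (map_zero φ)).trans (zero_add _)

include hϖ

/-- The condition on `φ` is that `φ (0, 1)` lies in `ϖ H`. -/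
theorem vol_range_comp_scaleSnd :
    vol O {φ : M × O →ₗ[O] H | ∃ φ' : M × O →ₗ[O] H, φ'.comp (scaleSnd M ϖ) = φ} =
      (residueCard O ^ Module.finrank O H)⁻¹ := by
  let E := LinearMap.coprodEquiv (R := O) (M := M) (M₂ := O) (M₃ := H) O
  let T : Set (O →ₗ[O] H) := {φ | ∃ φ', φ = ϖ ^ 1 • φ'}
  have hT : PerMod ϖ 1 T := by
    rintro _ ⟨φ', rfl⟩ ψ
    exact ⟨φ' + ψ, (smul_add _ _ _).symm⟩
  let S : Set ((M →ₗ[O] H) × (O →ₗ[O] H)) := {p | p.2 ∈ T}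
  have hS : PerMod ϖ 1 S := fun p hp p' => hT _ hp _
  have h1 : {φ : M × O →ₗ[O] H | ∃ φ' : M × O →ₗ[O] H, φ'.comp (scaleSnd M ϖ) = φ} =
      E.symm ⁻¹' S := by
    rw [range_comp_scaleSnd]
    ext φ
    obtain ⟨p, rfl⟩ := E.surjective φ
    have h2 : E p (0, 1) = p.2 1 := by simp [E]
    rw [Set.mem_preimage, E.symm_apply_apply, Set.mem_ofPred_eq, h2]
    constructor
    · rintro ⟨x', hx'⟩
      refine ⟨LinearMap.toSpanSingleton O H x', LinearMap.ext_ring ?_⟩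
      simpa using hx'
    · rintro ⟨φ', hφ'⟩
      exact ⟨φ' 1, by rw [hφ', pow_one]; rfl⟩
  rw [h1, vol_preimage_equiv hϖ E.symm hS, vol_prod hϖ hS hT (fun _ h => h) (v := 1), vol_smul hϖ,
    one_mul, one_mul, Module.finrank_linearMap, Module.finrank_self, one_mul]
  intro φ hφ
  rw [← vol_univ O (X := M →ₗ[O] H)]
  congr 1
  exact Set.eq_univ_of_forall fun _ => hφ

/-- The reduction of the lattice `O`. -/
def residueRed (O : Type*) [CommRing O] [IsLocalRing O] : O →ₛₗ[residue O] ResidueField O where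
  toFun x := residue O x
  map_add' x y := map_add _ x y
  map_smul' a x := map_mul _ a x

theorem isReduction_residueRed : IsReduction ϖ (residueRed O) where
  surjective := residue_surjective
  exists_smul _ h := residue_eq_zero_dvd hϖ h
  finrank_eq := by simp

/-- The primitive vectors of norm `N` are counted over the residue field. -/
theorem vol_primitive_norm {W : Type*} [AddCommGroup W] [Module (ResidueField O) W]
    [Module.Finite (ResidueField O) W] {rH : H →ₛₗ[residue O] W} (hH : IsReduction ϖ rH)
    {qH : QuadraticForm O H} (hsd : IsSelfDual qH) {w : QuadraticForm (ResidueField O) W}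
    (hw : ∀ x, w (rH x) = residue O (qH x)) (N : O) {d : ℕ} (hd : 1 ≤ d) :
    vol O ({φ : O →ₗ[O] H | ¬ ∃ x', φ 1 = ϖ • x'} ∩
        repSet ϖ qH (toF F (N • QuadraticMap.sq)) d) =
      residueCard O * (Nat.card {x : W // w x = residue O N ∧ x ≠ 0} /
        residueCard O ^ Module.finrank O H) * (residueCard O ^ d)⁻¹ := by
  have hO := isReduction_residueRed hϖ
  have h1 := vol_primitive_inter_repSet (F := F) hϖ hO hH hsd hw
    (R := N • QuadraticMap.sq) (Rbar := residue O N • QuadraticMap.sq) (fun x => by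
      simp [residueRed]) hd
  have h2 : {φ : O →ₗ[O] H | Function.Injective (redHom hϖ hO rH φ)} =
      {φ : O →ₗ[O] H | ¬ ∃ x', φ 1 = ϖ • x'} := by
    ext φ
    have h3 : redHom hϖ hO rH φ 1 = rH (φ 1) := by
      rw [← redHom_apply hϖ hO]
      congr 1
    have h4 : rH (φ 1) = 0 ↔ ∃ x', φ 1 = ϖ • x' :=
      ⟨hH.exists_smul _, fun ⟨x', hx'⟩ => by rw [hx', red_smul hϖ]⟩
    rw [Set.mem_ofPred_eq, Set.mem_ofPred_eq, ← h4, ← h3]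
    constructor
    · exact fun h h0 => one_ne_zero (h (h0.trans (map_zero _).symm))
    · intro h
      rw [injective_iff_map_eq_zero]
      intro a ha
      rw [← mul_one a, ← smul_eq_mul, map_smul] at ha
      exact (smul_eq_zero.1 ha).resolve_right h
  have h5 : Nat.card {φ : ResidueField O →ₗ[ResidueField O] W // Function.Injective φ ∧
      w.comp φ = residue O N • QuadraticMap.sq} =
      Nat.card {x : W // w x = residue O N ∧ x ≠ 0} := by
    refine Nat.card_congr ((LinearMap.ringLmapEquivSelf (ResidueField O) (ResidueField O)
      W).toEquiv.subtypeEquiv fun φ => ?_)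
    change _ ↔ w (φ 1) = _ ∧ φ 1 ≠ 0
    have h6 : ∀ a, φ a = a • φ 1 := fun a => by rw [← map_smul, smul_eq_mul, mul_one]
    constructor
    · rintro ⟨hi, hφ⟩
      refine ⟨?_, fun h0 => one_ne_zero (hi (h0.trans (map_zero _).symm))⟩
      have := congrArg (fun R => R 1) hφ
      simpa using this
    · rintro ⟨hφ, h0⟩
      constructor
      · rw [injective_iff_map_eq_zero]
        intro a ha
        rw [h6] at ha
        exact (smul_eq_zero.1 ha).resolve_right h0
      · ext a
        rw [QuadraticMap.comp_apply, h6, QuadraticMap.map_smul, hφ, smul_apply,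
          QuadraticMap.sq_apply, smul_eq_mul, smul_eq_mul, mul_comm]
  rw [h2, h5, Module.finrank_self] at h1
  simpa using h1

end Volumes

section Nor

variable {O : Type*} [CommRing O] [IsLocalRing O]

theorem nor_index (n : ℕ) :
    (Finset.Icc 1 n).filter (fun i => 2 * i < n + 1) = Finset.Icc 1 (n / 2) := by
  ext i
  simp only [Finset.mem_filter, Finset.mem_Icc]
  lia

theorem nor_eval_even (s : ℤ) (a : ℕ) (x : ℝ) : (nor O s (2 * a)).eval x =
    ∏ i ∈ Finset.Icc 1 a, (1 - (residueCard O ^ (2 * i))⁻¹ * x ^ 2) := by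
  have h : ¬ Odd (2 * a) := by simp
  rw [nor, nor_index, if_neg h]
  simp [eval_prod]

theorem nor_eval_odd (s : ℤ) (a : ℕ) (x : ℝ) : (nor O s (2 * a + 1)).eval x =
    (1 - s * (residueCard O ^ (a + 1))⁻¹ * x) *
      ∏ i ∈ Finset.Icc 1 a, (1 - (residueCard O ^ (2 * i))⁻¹ * x ^ 2) := by
  have h : Odd (2 * a + 1) := by simp
  rw [nor, nor_index, if_pos h, show (2 * a + 1) / 2 = a by lia,
    show (2 * a + 1 + 1) / 2 = a + 1 by lia]
  simp [eval_prod]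

end Nor

theorem nor_eval_ne_zero {O : Type*} [CommRing O] [IsDomain O] [IsDiscreteValuationRing O]
    [Finite (ResidueField O)] {s : ℤ} {n : ℕ} (hs : Odd n → |s| ≤ 1) (k : ℕ) :
    (nor O s n).eval (residueCard O ^ k)⁻¹ ≠ 0 := by
  have hq := one_lt_residueCard O
  have hx0 : 0 < (residueCard O ^ k)⁻¹ := by positivity
  have hx1 : (residueCard O ^ k)⁻¹ ≤ 1 := inv_le_one_of_one_le₀ (one_le_pow₀ hq.le)
  set x := (residueCard O ^ k)⁻¹
  have hlt : ∀ i, i ≠ 0 → (residueCard O ^ i)⁻¹ < 1 := fun i hi =>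
    inv_lt_one_of_one_lt₀ (one_lt_pow₀ hq hi)
  have hpos : ∀ i, 0 < (residueCard O ^ i)⁻¹ := fun i => by positivity
  have hprod : ∀ a, ∏ i ∈ Finset.Icc 1 a, (1 - (residueCard O ^ (2 * i))⁻¹ * x ^ 2) ≠ 0 := fun a => by
    refine Finset.prod_ne_zero_iff.2 fun i hi => ?_
    have hi1 := (Finset.mem_Icc.1 hi).1
    have h1 := hlt (2 * i) (by lia)
    have h2 : x ^ 2 ≤ 1 := pow_le_one₀ hx0.le hx1
    have h3 := mul_le_mul_of_nonneg_left h2 (hpos (2 * i)).le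
    linarith
  obtain ⟨a, rfl | rfl⟩ := Nat.even_or_odd' n
  · rw [nor_eval_even]
    exact hprod a
  · rw [nor_eval_odd]
    refine mul_ne_zero ?_ (hprod a)
    have h1 := hlt (a + 1) (by lia)
    have h2 : |(s : ℝ)| ≤ 1 := by exact_mod_cast hs (by simp)
    have h3 := mul_le_mul h2 hx1 hx0.le zero_le_one
    have h4 := mul_le_mul_of_nonneg_left h3 (hpos (a + 1)).le
    have h5 : s * (residueCard O ^ (a + 1))⁻¹ * x ≤ (residueCard O ^ (a + 1))⁻¹ * (|(s : ℝ)| * x) := by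
      have h6 := mul_le_mul_of_nonneg_left (le_abs_self (s : ℝ)) (mul_pos (hpos (a + 1)) hx0).le
      linarith
    linarith

universe u

variable {O : Type u} [CommRing O] [IsDomain O] [IsDiscreteValuationRing O]
  [Finite (ResidueField O)] [TopologicalSpace O] [IsTopologicalRing O] [CompactSpace O]
  [T2Space O] {F : Type*} [Field F] [Algebra O F] [IsFractionRing O F]
  {W : Type u} [AddCommGroup W] [Module (ResidueField O) W] [Module.Finite (ResidueField O) W]
  {ϖ : O} (hϖ : Irreducible ϖ) {ψ : AddChar (ResidueField O) ℂ}

include hϖ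

/-- The zero vector is the only one that is not primitive, and it has norm `N` in the residue field
exactly if `ϖ` divides `N`. -/
theorem card_primitive_norm (w : QuadraticForm (ResidueField O) W) (N : O) [Decidable (ϖ ∣ N)] :
    (Nat.card {x : W // w x = residue O N} : ℝ) =
      Nat.card {x : W // w x = residue O N ∧ x ≠ 0} + if ϖ ∣ N then 1 else 0 := by
  classical
  have := finite_of_module (ResidueField O) W
  have := Fintype.ofFinite W
  have hN : ϖ ∣ N ↔ residue O N = 0 := by
    rw [residue_eq_zero_iff, hϖ.maximalIdeal_eq, Ideal.mem_span_singleton]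
  rw [Nat.card_eq_fintype_card, Nat.card_eq_fintype_card, Fintype.card_subtype,
    Fintype.card_subtype, ← Finset.filter_filter,
    ← Finset.card_filter_add_card_filter_not (s := Finset.univ.filter fun x => w x = residue O N)
      (fun x => x ≠ 0)]
  push_cast
  congr 1
  simp only [not_not]
  split_ifs with h
  · rw [hN] at h
    have : Finset.filter (fun x => x = 0) (Finset.univ.filter fun x => w x = residue O N) =
        ({0} : Finset W) := by
      ext x
      simp only [Finset.mem_filter, Finset.mem_univ, true_and, Finset.mem_singleton]
      refine ⟨fun hx => hx.2, fun hx => ⟨by rw [hx, h, map_zero], hx⟩⟩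
    rw [this]
    simp
  · rw [hN] at h
    rw [Nat.cast_eq_zero, Finset.card_eq_zero, Finset.filter_eq_empty_iff]
    rintro x hx rfl
    simp only [Finset.mem_filter, Finset.mem_univ, true_and, map_zero] at hx
    exact h hx.symm

/-- The proportion of primitive vectors of norm `N` is a quotient of normalizing factors. -/
theorem card_primitive_norm_mul_nor (hψ : ψ.IsPrimitive) {m r : ℕ} (hr : 1 ≤ r)
    (hcase : Odd r → ringChar (ResidueField O) ≠ 2) {w : QuadraticForm (ResidueField O) W} {ε : ℤˣ}
    (hg : GaussType ψ w (r % 2) (m + r / 2 + 1) ε) (N : O) :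
    (ϖ ∣ N → residueCard O * (Nat.card {x : W // w x = residue O N ∧ x ≠ 0} /
        residueCard O ^ (2 * m + r + 2)) * (nor O ε (r - 1)).eval (residueCard O ^ m)⁻¹ =
          (nor O ε (r + 1)).eval (residueCard O ^ m)⁻¹) ∧
    (¬ ϖ ∣ N → residueCard O * (Nat.card {x : W // w x = residue O N ∧ x ≠ 0} /
        residueCard O ^ (2 * m + r + 2)) *
          (nor O (ε * chi ϖ (algebraMap O F N)) r).eval (residueCard O ^ m)⁻¹ =
          (nor O ε (r + 1)).eval (residueCard O ^ m)⁻¹) := by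
  classical
  have hq := (residueCard_pos O).ne'
  have hN : ϖ ∣ N ↔ residue O N = 0 := by
    rw [residue_eq_zero_iff, hϖ.maximalIdeal_eq, Ideal.mem_span_singleton]
  have hcard := card_primitive_norm hϖ w N
  have hε : ((ε : ℤ) : ℝ) ^ 2 = 1 := by
    obtain h | h := Int.units_eq_one_or ε <;> simp [h]
  have ht : ∀ i j : ℕ, (residueCard O ^ i)⁻¹ * (residueCard O ^ j)⁻¹ =
      (residueCard O ^ (j + i))⁻¹ := fun i j => by rw [pow_add, mul_inv, mul_comm]
  have ht2 : ∀ i j : ℕ, (residueCard O ^ (2 * i))⁻¹ * (residueCard O ^ j)⁻¹ ^ 2 =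
      (residueCard O ^ (j + i))⁻¹ ^ 2 := fun i j => by
    rw [pow_add, mul_inv, mul_pow, ← inv_pow, ← inv_pow, ← inv_pow, pow_mul', mul_comm]
  obtain ⟨a, rfl | rfl⟩ := Nat.even_or_odd' r
  · obtain ⟨a, rfl⟩ := Nat.exists_eq_add_of_le' (show 1 ≤ a by lia)
    rw [show 2 * (a + 1) % 2 = 0 by lia, show 2 * (a + 1) / 2 = a + 1 by lia] at hg
    have h1 := hg.card_norm_eq_even hψ (residue O N)
    rw [hcard, ← residueCard] at h1
    rw [show 2 * (a + 1) - 1 = 2 * a + 1 by lia, nor_eval_odd, nor_eval_odd, nor_eval_even,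
      Finset.prod_Icc_succ_top (by lia), show 2 * m + 2 * (a + 1) + 2 = 2 * (m + (a + 1) + 1) by lia,
      mul_assoc ((ε : ℤ) : ℝ), mul_assoc ((ε : ℤ) : ℝ), ht, ht, ht2, ← add_assoc m (a + 1) 1]
    rw [pow_mul' _ 2] at h1 ⊢
    rw [pow_succ _ (m + (a + 1))] at h1 ⊢
    have ht0 : residueCard O ^ (m + (a + 1)) ≠ 0 := pow_ne_zero _ hq
    generalize residueCard O ^ (m + (a + 1)) = t at *
    generalize ∏ i ∈ Finset.Icc 1 a, (1 - (residueCard O ^ (2 * i))⁻¹ *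
      (residueCard O ^ m)⁻¹ ^ 2) = P
    generalize (Nat.card {x : W // w x = residue O N ∧ x ≠ 0} : ℝ) = c at *
    constructor
    · intro h
      rw [if_pos h, if_pos (hN.1 h)] at h1
      field_simp
      refine mul_left_cancel₀ hq ?_
      linear_combination (t - (ε : ℤ)) * P * h1 + residueCard O * P * (t - residueCard O * t) * hε
    · intro h
      rw [if_neg h, if_neg (fun h0 => h (hN.2 h0))] at h1
      field_simp
      refine mul_left_cancel₀ hq ?_
      linear_combination P * (t ^ 2 - 1) * h1
  · rw [show (2 * a + 1) % 2 = 1 by lia, show (2 * a + 1) / 2 = a by lia] at hg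
    have h1 := hg.card_norm_eq_odd (hcase (by simp)) hψ (residue O N)
    rw [hcard, ← residueCard] at h1
    rw [show 2 * a + 1 - 1 = 2 * a by lia, show 2 * a + 1 + 1 = 2 * (a + 1) by lia, nor_eval_odd,
      nor_eval_even, nor_eval_even, Finset.prod_Icc_succ_top (by lia),
      show 2 * m + (2 * a + 1) + 2 = 2 * (m + (a + 1)) + 1 by lia, mul_assoc (Int.cast _), ht, ht2]
    rw [add_assoc m a 1] at h1
    rw [pow_succ, pow_mul' _ 2] at h1 ⊢
    have ht0 : residueCard O ^ (m + (a + 1)) ≠ 0 := pow_ne_zero _ hq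
    generalize residueCard O ^ (m + (a + 1)) = t at *
    generalize ∏ i ∈ Finset.Icc 1 a, (1 - (residueCard O ^ (2 * i))⁻¹ *
      (residueCard O ^ m)⁻¹ ^ 2) = P
    generalize (Nat.card {x : W // w x = residue O N ∧ x ≠ 0} : ℝ) = c at *
    constructor
    · intro h
      rw [if_pos h, hN.1 h] at h1
      field_simp
      have h2 : quadChar (0 : ResidueField O) = 0 := by
        have := Fintype.ofFinite (ResidueField O)
        rw [quadChar_eq, MulChar.map_zero]
      rw [h2, Int.cast_zero] at h1
      refine mul_left_cancel₀ hq ?_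
      linear_combination P * h1
    · intro h
      rw [chi_unit hϖ (hcase (by simp)) (fun h0 => h (hN.2 h0))]
      rw [if_neg h] at h1
      push_cast
      field_simp
      have hχ : (quadChar (residue O N) : ℝ) ^ 2 = 1 := by
        exact_mod_cast quadChar_sq (fun h0 => h (hN.2 h0))
      refine mul_left_cancel₀ hq ?_
      linear_combination (t - (ε : ℤ) * quadChar (residue O N)) * P * h1 - residueCard O * P * t *
        ((quadChar (residue O N) : ℝ) ^ 2 * hε + hχ)

/-- The density of `M` in `δ(N) ⟂ h` is determined by the densities of `M ⟂ ⟨N⟩` and of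
`M ⟂ ⟨ϖ ^ (-2) N⟩` in the sum of `h` and two hyperbolic planes: the representations of `M ⟂ ⟨N⟩`
that are not primitive on `⟨N⟩` extend to `M ⟂ ⟨ϖ ^ (-2) N⟩`. -/
theorem hasDensity_delta {Z : Type*} [AddCommGroup Z] [Module O Z] [Module.Finite O Z]
    [Module.Free O Z] {M : Type*} [AddCommGroup M] [Module O M] [Module.Finite O M]
    [Module.Free O M] {h : QuadraticForm O Z} (hh : IsSelfDual h)
    {rH : (O × O) × ((O × O) × Z) →ₛₗ[residue O] W} (hH : IsReduction ϖ rH)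
    {w : QuadraticForm (ResidueField O) W} (hw : ∀ x, w (rH x) = residue O (addPlanes h x))
    (Q : QuadraticMap O M F) (N : O) {N' : F} (hN' : algebraMap O F ϖ ^ 2 * N' = algebraMap O F N)
    {v v' : ℝ} (hv : IsDensity ϖ (addPlanes h) (Q.prod (rankOne (algebraMap O F N))) v)
    (hv' : IsDensity ϖ (addPlanes h) (Q.prod (rankOne N')) v')
    (hc : residueCard O * (Nat.card {x : W // w x = residue O N ∧ x ≠ 0} /
        residueCard O ^ Module.finrank O ((O × O) × ((O × O) × Z))) ≠ 0) :
    HasDensity ϖ ((delta N).prod h) Q ((v -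
      (residueCard O ^ Module.finrank O ((O × O) × ((O × O) × Z)))⁻¹ *
        residueCard O ^ (Module.finrank O M + 2) * v') /
      (residueCard O * (Nat.card {x : W // w x = residue O N ∧ x ≠ 0} /
        residueCard O ^ Module.finrank O ((O × O) × ((O × O) × Z))))) := by
  have hq := (residueCard_pos O).ne'
  have hcomp : (Q.prod (rankOne N')).comp (scaleSnd M ϖ) =
      Q.prod (rankOne (algebraMap O F N)) := by
    ext ⟨y, t⟩
    rw [QuadraticMap.comp_apply, scaleSnd_apply, QuadraticMap.prod_apply, QuadraticMap.prod_apply,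
      rankOne_apply, rankOne_apply, map_mul, ← hN']
    ring
  obtain ⟨d₁, h1⟩ := hv'.vol_range_inter hϖ (A := scaleSnd M ϖ) (B := scaleFst M ϖ) (c := 1)
    (fun x => by rw [pow_one]; rfl) (fun x => by rw [pow_one]; rfl)
  obtain ⟨d₀, h0⟩ := hv
  refine tendsto_const_nhds.congr' ?_
  filter_upwards [eventually_ge_atTop (max (max d₀ d₁) 1)] with d hd
  have hd0 : d₀ ≤ d := (le_max_left _ _).trans ((le_max_left _ _).trans hd)
  have hd1 : d₁ ≤ d := (le_max_right _ _).trans ((le_max_left _ _).trans hd)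
  have hd2 : 1 ≤ d := (le_max_right _ _).trans hd
  have h0 := h0 d hd0 0
  rw [smul_zero, show toF F (0 : QuadraticForm O (M × O)) = 0 by ext; simp, add_zero] at h0
  have h1 := h1 d hd1
  rw [hcomp, overIndex_scaleSnd hϖ, vol_range_comp_scaleSnd hϖ, range_comp_scaleSnd] at h1
  have h2 := vol_primitive_inter_repSet_prod hϖ hh Q N hd2
  rw [vol_primitive_norm hϖ hH (isSelfDual_addPlanes hh) hw N hd2] at h2
  set S := repSet ϖ (addPlanes h) (Q.prod (rankOne (algebraMap O F N))) d with hS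
  set D : Set (M × O →ₗ[O] (O × O) × ((O × O) × Z)) := {φ | ∃ x', φ (0, 1) = ϖ • x'} with hD
  -- the maps in `D` are not primitive on the last coordinate and extend to `M ⟂ ⟨N'⟩`; the others
  -- fibre over the primitive vectors of norm `N`
  have hadd : vol O S = vol O (D ∩ S) +
      vol O ({φ : M × O →ₗ[O] (O × O) × ((O × O) × Z) | ¬ ∃ x', φ (0, 1) = ϖ • x'} ∩ S) := by
    classical
    have h3 := vol_eq_sum_fiber hϖ (fun φ => decide (φ ∈ D)) (d := 1) (fun φ ψ => by
      rw [decide_eq_decide, hD, Set.mem_ofPred_eq, Set.mem_ofPred_eq, LinearMap.add_apply,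
        LinearMap.smul_apply, pow_one]
      constructor
      · rintro ⟨x', hx'⟩
        exact ⟨x' - ψ (0, 1), by rw [smul_sub, ← hx', add_sub_cancel_right]⟩
      · rintro ⟨x', hx'⟩
        exact ⟨x' + ψ (0, 1), by rw [smul_add, ← hx']⟩) (perMod_repSet ϖ (addPlanes h)
          (Q.prod (rankOne (algebraMap O F N))) d)
    rw [Fintype.sum_bool] at h3
    rw [hS, h3]
    congr 2
    · ext φ
      simp [and_comm]
    · ext φ
      simp [hD, and_comm]
  rw [density_term_eq hϖ]
  rw [h0, h1, h2] at hadd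
  generalize residueCard O * (Nat.card {x : W // w x = residue O N ∧ x ≠ 0} /
        residueCard O ^ Module.finrank O ((O × O) × ((O × O) × Z)) : ℝ) = c at *
  rw [div_eq_iff hc]
  have h5 : (Module.finrank O (M × O) + 1).choose 2 =
      (Module.finrank O M + 1).choose 2 + Module.finrank O M + 1 := by
    rw [Module.finrank_prod, Module.finrank_self, Nat.choose_succ_succ, Nat.choose_one_right]
    ring
  rw [h5, mul_add, mul_add, pow_add, pow_add, mul_one] at hadd
  have hp := fun n => pow_ne_zero n hq
  generalize vol O (repSet ϖ ((delta N).prod h) Q d) = x at *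
  have e1 := hp (d * (Module.finrank O M + 1).choose 2)
  have e2 := hp (d * Module.finrank O M)
  have e3 := hp d
  generalize residueCard O ^ (d * (Module.finrank O M + 1).choose 2) = y1 at *
  generalize residueCard O ^ (d * Module.finrank O M) = y2 at *
  generalize residueCard O ^ d = y3 at *
  generalize (residueCard O ^ Module.finrank O ((O × O) × ((O × O) × Z)))⁻¹ *
        residueCard O ^ (Module.finrank O M + 2) = z at *
  field_simp at hadd
  linear_combination hadd

end PrimitiveCount


/-! ### The density polynomials -/

section DensityPolynomials

open IsLocalRing

universe u

variable {O : Type u} [CommRing O] [IsDomain O] [IsDiscreteValuationRing O]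
  [Finite (ResidueField O)] [TopologicalSpace O] [IsTopologicalRing O] [CompactSpace O]
  [T2Space O] {F : Type*} [Field F] [Algebra O F] [IsFractionRing O F]
  {L : Type*} [AddCommGroup L] [Module O L] [Module.Finite O L] [Module.Free O L]
  {M : Type*} [AddCommGroup M] [Module O M] [Module.Finite O M] [Module.Free O M]
  {ϖ : O} (hϖ : Irreducible ϖ) {ψ : AddChar (ResidueField O) ℂ}

/-- `P` gives the densities of `Q`, a form on a lattice of rank `n`, in all self-dual lattices of sign
`ε` and of rank at least `n + 1` and of the same parity as `n + 1`. Here the sign is that of the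
Gauss type of the reduction, so that these lattices need not be given as `O ^ k`. -/
def IsDensityPoly (ψ : AddChar (ResidueField O) ℂ) (ϖ : O) (ε : ℤˣ) (Q : QuadraticMap O L F)
    (P : ℝ[X]) : Prop :=
  ∀ (k : ℕ) (H : Type u) [AddCommGroup H] [Module O H] [Module.Finite O H] [Module.Free O H]
    (qH : QuadraticForm O H), IsSelfDual qH →
      HasGaussType ψ ϖ qH ((Module.finrank O L + 1) % 2) (k + (Module.finrank O L + 1) / 2) ε →
      ∀ v, IsDensity ϖ qH Q v → v = P.eval (residueCard O ^ k)⁻¹ *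
        (nor O ε (Module.finrank O L)).eval (residueCard O ^ k)⁻¹

theorem IsNondegenerate.isNonsingular_prod {q : QuadraticMap O M F} (hq : IsNondegenerate q)
    {c : F} (hc : c ≠ 0) : IsNonsingular (q.prod (rankOne c)) := by
  rintro ⟨y, t⟩ h1 h2
  have hy : y = 0 := hq y fun z => by
    have := h1 (z, 0)
    simpa [QuadraticMap.polar, QuadraticMap.prod_apply] using this
  subst hy
  rw [QuadraticMap.prod_apply, map_zero, zero_add, rankOne_apply] at h2
  have ht : algebraMap O F t = 0 := by
    have := (mul_eq_zero.1 h2).resolve_right hc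
    rwa [pow_eq_zero_iff two_ne_zero] at this
  rw [FaithfulSMul.algebraMap_injective O F (ht.trans (map_zero _).symm)]
  rfl

theorem HasDensity.unique {H : Type*} [AddCommGroup H] [Module O H] {qH : QuadraticForm O H}
    {Q : QuadraticMap O L F} {v v' : ℝ} (hv : HasDensity ϖ qH Q v) (hv' : HasDensity ϖ qH Q v') :
    v = v' :=
  tendsto_nhds_unique hv hv'

theorem eq_of_eval_inv_pow_eq {P P' : ℝ[X]} (m₀ : ℕ) (h : ∀ m, m₀ ≤ m →
    P.eval (residueCard O ^ m)⁻¹ = P'.eval (residueCard O ^ m)⁻¹) : P = P' := by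
  have hq := one_lt_residueCard O
  refine Polynomial.eq_of_infinite_eval_eq _ _ ((Set.infinite_range_of_injective
    (f := fun m : ℕ => (residueCard O ^ (m₀ + m))⁻¹) fun m m' hm => ?_).mono ?_)
  · have := pow_right_injective₀ (zero_lt_one.trans hq) hq.ne' (inv_injective hm)
    lia
  · rintro _ ⟨m, rfl⟩
    exact h _ (Nat.le_add_right _ _)

include hϖ

theorem exists_isStandard {ε : ℤˣ} {k : ℕ} (hcase : (ringChar (ResidueField O) ≠ 2 ∧ 1 ≤ k) ∨
    (ringChar (ResidueField O) = 2 ∧ Even k ∧ ε = 1)) :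
    ∃ h : QuadraticForm O (Fin k → O), IsStandard F ϖ ε h := by
  obtain ⟨h2, hk⟩ | ⟨h2, hk, rfl⟩ := hcase
  · exact exists_isStandard_of_ringChar_ne_two hϖ h2 ε hk
  · obtain ⟨j, rfl⟩ := even_iff_exists_two_mul.1 hk
    exact exists_isStandard_of_ringChar_eq_two h2 j

theorem IsDen.unique {ε : ℤˣ} {Q : QuadraticMap O L F}
    (hcase : ringChar (ResidueField O) ≠ 2 ∨
      (ringChar (ResidueField O) = 2 ∧ Odd (Module.finrank O L) ∧ ε = 1)) {P P' : ℝ[X]}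
    (hP : IsDen ϖ ε Q P) (hP' : IsDen ϖ ε Q P') : P = P' := by
  refine eq_of_eval_inv_pow_eq (O := O) 0 fun k _ => ?_
  obtain ⟨h, hh⟩ := exists_isStandard (F := F) hϖ (ε := ε) (k := 2 * k + Module.finrank O L + 1)
    (hcase.imp (fun h2 => ⟨h2, by lia⟩) fun ⟨h2, hn, hε⟩ => ⟨h2, by
      obtain ⟨a, ha⟩ := hn
      exact ⟨k + a + 1, by lia⟩, hε⟩)
  obtain ⟨ℓ, hℓ, h1⟩ := hP k h hh
  obtain ⟨ℓ', hℓ', h1'⟩ := hP' k h hh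
  rw [h1, h1', hℓ.unique hℓ']

theorem IsDenDelta.unique {ε : ℤˣ} {N : O} {q : QuadraticMap O M F}
    (hr : 1 ≤ Module.finrank O M) (hcase : ringChar (ResidueField O) ≠ 2 ∨
      (ringChar (ResidueField O) = 2 ∧ Even (Module.finrank O M) ∧ ε = 1)) {P P' : ℝ[X]}
    (hP : IsDenDelta ϖ ε N q P) (hP' : IsDenDelta ϖ ε N q P') : P = P' := by
  refine eq_of_eval_inv_pow_eq (O := O) 1 fun m hm => ?_
  obtain ⟨k, hk⟩ : ∃ k, k + 2 = 2 * m + Module.finrank O M :=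
    ⟨2 * m + Module.finrank O M - 2, by lia⟩
  obtain ⟨h, hh⟩ := exists_isStandard (F := F) hϖ (ε := ε) (k := k)
    (hcase.imp (fun h2 => ⟨h2, by lia⟩) fun ⟨h2, hn, hε⟩ => ⟨h2, by
      obtain ⟨a, ha⟩ := hn
      exact ⟨m + a - 1, by lia⟩, hε⟩)
  obtain ⟨ℓ, hℓ, h1, h2⟩ := hP m k hk h hh
  obtain ⟨ℓ', hℓ', h1', h2'⟩ := hP' m k hk h hh
  by_cases hN : ϖ ∣ N
  · rw [h1 hN, h1' hN, hℓ.unique hℓ']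
  · rw [h2 hN, h2' hN, hℓ.unique hℓ']

/-- The polynomial that gives the densities of `Q` in all self-dual lattices of sign `ε`. -/
theorem exists_isDen (hψ : ψ.IsPrimitive)
    (hcase : Odd (Module.finrank O L) ∨ ringChar (ResidueField O) ≠ 2) (ε : ℤˣ)
    {Q : QuadraticMap O L F} (hQ : IsNonsingular Q) :
    ∃ P : ℝ[X], IsDen ϖ ε Q P ∧ IsDensityPoly ψ ϖ ε Q P := by
  obtain ⟨B, hB⟩ := hQ.exists_indexBound hϖ
  obtain ⟨P, hP⟩ := exists_densityPoly hϖ hψ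
    ((isReduction_coordRed hϖ (Fin (Module.finrank O L))).comp_equiv
      (Module.finBasis O L).equivFun) hcase ε B hQ hB
  refine ⟨P, fun k h hh => ?_, fun k H _ _ _ _ qH hsd hg v hv => hP k H qH hsd hg v hv⟩
  have hsd := hh.isSelfDual hϖ
  have hg := hh.hasGaussType hϖ hψ
  rw [show (2 * k + Module.finrank O L + 1) % 2 = (Module.finrank O L + 1) % 2 by lia,
    show (2 * k + Module.finrank O L + 1) / 2 = k + (Module.finrank O L + 1) / 2 by lia] at hg
  obtain ⟨v, hv⟩ := exists_isDensity hϖ hsd hQ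
  refine ⟨v, hv.hasDensity hϖ, ?_⟩
  have hn : (nor O ε (Module.finrank O L)).eval (residueCard O ^ k)⁻¹ ≠ 0 :=
    nor_eval_ne_zero (fun _ => by obtain h | h := Int.units_eq_one_or ε <;> simp [h]) k
  rw [eq_div_iff hn, ← hP k _ h hsd hg v hv]

/-- The identity between the three density polynomials. -/
theorem isDenDelta_sub (hψ : ψ.IsPrimitive) (hr : 1 ≤ Module.finrank O M) {ε : ℤˣ}
    (hcase : Odd (Module.finrank O M) → ringChar (ResidueField O) ≠ 2)
    {q : QuadraticMap O M F} (hq : IsNondegenerate q) {N : O} (hN : N ≠ 0) {N' : F}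
    (hN' : algebraMap O F ϖ ^ 2 * N' = algebraMap O F N) {P P' : ℝ[X]}
    (hP : IsDensityPoly ψ ϖ ε (q.prod (rankOne (algebraMap O F N))) P)
    (hP' : IsDensityPoly ψ ϖ ε (q.prod (rankOne N')) P') :
    IsDenDelta ϖ ε N q (P - X ^ 2 * P') := by
  intro m k hk h hh
  have hq0 := (residueCard_pos O).ne'
  have hinj := FaithfulSMul.algebraMap_injective O F
  have hN0 : algebraMap O F N ≠ 0 := fun h0 => hN (hinj (by rw [h0, map_zero]))
  have hN0' : N' ≠ 0 := fun h0 => hN0 (by rw [← hN', h0, mul_zero])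
  have hsd := isSelfDual_addPlanes (hh.isSelfDual hϖ)
  have hr1 : Module.finrank O (M × O) = Module.finrank O M + 1 := by simp
  have hg : HasGaussType ψ ϖ (addPlanes h) (Module.finrank O M % 2)
      (m + Module.finrank O M / 2 + 1) ε := by
    have h1 := (hasGaussType_hyperbolicPlane hϖ hψ).prod
      ((hasGaussType_hyperbolicPlane hϖ hψ).prod (hh.hasGaussType hϖ hψ))
    rw [one_mul, one_mul, show k % 2 = Module.finrank O M % 2 by lia,
      show 1 + (1 + k / 2) = m + Module.finrank O M / 2 + 1 by lia] at h1
    exact h1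
  have hg' := hg
  rw [show Module.finrank O M % 2 = (Module.finrank O (M × O) + 1) % 2 by rw [hr1]; lia,
    show m + Module.finrank O M / 2 + 1 = m + (Module.finrank O (M × O) + 1) / 2 by
      rw [hr1]; lia] at hg'
  have hdim : Module.finrank O ((O × O) × ((O × O) × (Fin k → O))) =
      2 * m + Module.finrank O M + 2 := by
    simp only [Module.finrank_prod, Module.finrank_self, Module.finrank_fin_fun]
    lia
  obtain ⟨v, hv⟩ := exists_isDensity hϖ hsd (hq.isNonsingular_prod hN0)
  obtain ⟨v', hv'⟩ := exists_isDensity hϖ hsd (hq.isNonsingular_prod hN0')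
  have e1 := hP m _ _ hsd hg' v hv
  have e2 := hP' m _ _ hsd hg' v' hv'
  obtain ⟨W, _, _, _, rH, w, hrH, hw, hgw⟩ := hg
  obtain ⟨hc1, hc2⟩ := card_primitive_norm_mul_nor (F := F) hϖ hψ hr hcase hgw N
  have hnor : (nor O ε (Module.finrank O M + 1)).eval (residueCard O ^ m)⁻¹ ≠ 0 :=
    nor_eval_ne_zero (fun _ => by obtain h | h := Int.units_eq_one_or ε <;> simp [h]) m
  have hc : residueCard O * (Nat.card {x : W // w x = residue O N ∧ x ≠ 0} /
      residueCard O ^ Module.finrank O ((O × O) × ((O × O) × (Fin k → O)))) ≠ 0 := by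
    rw [hdim]
    by_cases hd : ϖ ∣ N
    · exact left_ne_zero_of_mul ((hc1 hd).trans_ne hnor)
    · exact left_ne_zero_of_mul ((hc2 hd).trans_ne hnor)
  refine ⟨_, hasDensity_delta hϖ (hh.isSelfDual hϖ) hrH hw q N hN' hv hv' hc, ?_⟩
  rw [hdim] at hc ⊢
  generalize residueCard O * (Nat.card {x : W // w x = residue O N ∧ x ≠ 0} /
      residueCard O ^ (2 * m + Module.finrank O M + 2)) = c at *
  have h3 : (residueCard O ^ (2 * m + Module.finrank O M + 2))⁻¹ *
      residueCard O ^ (Module.finrank O M + 2) = (residueCard O ^ m)⁻¹ ^ 2 := by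
    rw [add_assoc, pow_add, mul_inv, inv_mul_cancel_right₀ (pow_ne_zero _ hq0), inv_pow, ← pow_mul',]
  have key : ∀ n : ℝ, c * n = (nor O ε (Module.finrank O M + 1)).eval (residueCard O ^ m)⁻¹ →
      (P - X ^ 2 * P').eval (residueCard O ^ m)⁻¹ =
        (v - (residueCard O ^ (2 * m + Module.finrank O M + 2))⁻¹ *
          residueCard O ^ (Module.finrank O M + 2) * v') / c / n := fun n hn => by
    have hn0 : n ≠ 0 := right_ne_zero_of_mul (hn.trans_ne hnor)
    rw [h3, e1, e2, hr1, ← hn, eval_sub, eval_mul, eval_pow, eval_X]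
    field_simp
  exact ⟨fun hd => key _ (hc1 hd), fun hd => key _ (hc2 hd)⟩

/-- If `M ⟂ ⟨N⟩` does not embed into the space of a self-dual lattice of rank `r + 2`, then
`M ⟂ ⟨ϖ ^ (-2) N⟩` has density zero in it. -/
theorem eval_one_eq_zero {r : ℕ} (hr : Module.finrank O M = r) {ε : ℤˣ} (hψ : ψ.IsPrimitive)
    {q : QuadraticMap O M F} (hq : IsNondegenerate q) {N : O} (hN : N ≠ 0) {N' : F}
    (hN' : algebraMap O F ϖ ^ 2 * N' = algebraMap O F N) {P' : ℝ[X]}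
    (hP' : IsDensityPoly ψ ϖ ε (q.prod (rankOne N')) P')
    {H : QuadraticForm O (Fin (r + 2) → O)} (hH : IsStandard F ϖ ε H)
    (hemb : ¬ EmbedsInGenericFiber H (q.prod (rankOne (algebraMap O F N)))) : P'.eval 1 = 0 := by
  have hinj := FaithfulSMul.algebraMap_injective O F
  have hN0 : algebraMap O F N ≠ 0 := fun h0 => hN (hinj (by rw [h0, map_zero]))
  have hN0' : N' ≠ 0 := fun h0 => hN0 (by rw [← hN', h0, mul_zero])
  have hr1 : Module.finrank O (M × O) = r + 1 := by simp [hr]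
  have hsd := hH.isSelfDual hϖ
  have hg := hH.hasGaussType hϖ hψ
  rw [show (r + 2) % 2 = (Module.finrank O (M × O) + 1) % 2 by rw [hr1],
    show (r + 2) / 2 = 0 + (Module.finrank O (M × O) + 1) / 2 by rw [hr1]; lia] at hg
  obtain ⟨v, hv⟩ := exists_isDensity hϖ hsd (hq.isNonsingular_prod hN0')
  have h1 := hP' 0 _ _ hsd hg v hv
  have hnor : (nor O ε (Module.finrank O (M × O))).eval (residueCard O ^ 0)⁻¹ ≠ 0 :=
    nor_eval_ne_zero (fun _ => by obtain h | h := Int.units_eq_one_or ε <;> simp [h]) 0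
  by_contra h0
  obtain ⟨φ, hφ⟩ := hv.exists_rep hϖ (by
    rw [h1]
    refine mul_ne_zero ?_ hnor
    rwa [pow_zero, inv_one])
  apply hemb
  let f : M × O →ₗ[O] F ⊗[O] (Fin (r + 2) → O) :=
    (TensorProduct.mk O F (Fin (r + 2) → O) 1) ∘ₗ φ ∘ₗ scaleSnd M ϖ
  have hf : ∀ x, genericFiber F H (f x) = q.prod (rankOne (algebraMap O F N)) x := by
    rintro ⟨y, t⟩
    change genericFiber F H ((1 : F) ⊗ₜ[O] φ (y, ϖ * t)) = _
    rw [genericFiber_tmul, one_pow, one_mul, hφ, QuadraticMap.prod_apply, QuadraticMap.prod_apply,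
      rankOne_apply, rankOne_apply, map_mul, ← hN']
    ring
  refine ⟨f, ?_, hf⟩
  rw [injective_iff_map_eq_zero]
  intro x hx
  have hx0 : q.prod (rankOne (algebraMap O F N)) x = 0 := by rw [← hf, hx, map_zero]
  refine hq.isNonsingular_prod hN0 x (fun y => ?_) hx0
  rw [QuadraticMap.polar, ← hf (x + y), map_add, hx, zero_add, hf, hx0, sub_zero, sub_self]

end DensityPolynomials


end

end LocalDensity

open LocalDensity in
theorem theorem1p3p2
    (F : Type*) [Field F] [ValuativeRel F] [TopologicalSpace F] [IsNonarchimedeanLocalField F]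
    (p : ℕ) (hp : p.Prime) (hchar : CharP 𝓀[F] p)
    (ϖ : 𝒪[F]) (hϖ : Irreducible ϖ)
    (M : Type*) [AddCommGroup M] [Module 𝒪[F] M] [Module.Free 𝒪[F] M] [Module.Finite 𝒪[F] M]
    (q : QuadraticMap 𝒪[F] M F) (hq : IsNondegenerate q)
    (r : ℕ) (hr : Module.finrank 𝒪[F] M = r) (hr1 : 1 ≤ r)
    (N : 𝒪[F]) (hN : N ≠ 0)
    (ε : ℤˣ) (hcase : p ≠ 2 ∨ (p = 2 ∧ Even r ∧ ε = 1)) :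
    ((∃! P : Polynomial ℝ, IsDenDelta ϖ ε N q P) ∧
      (∃! P : Polynomial ℝ, IsDen ϖ ε (q.prod (rankOne (N : F))) P) ∧
      (∃! P : Polynomial ℝ, IsDen ϖ ε (q.prod (rankOne ((ϖ : F) ^ (-2 : ℤ) * (N : F)))) P)) ∧
    denDelta ϖ ε N q =
      den ϖ ε (q.prod (rankOne (N : F))) -
        Polynomial.X ^ 2 * den ϖ ε (q.prod (rankOne ((ϖ : F) ^ (-2 : ℤ) * (N : F)))) ∧
    ∀ H : QuadraticForm 𝒪[F] (Fin (r + 2) → 𝒪[F]), IsStandard F ϖ ε H →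
      ¬ EmbedsInGenericFiber H (q.prod (rankOne (N : F))) →
      derivedDenDelta ϖ ε N q =
        derivedDen ϖ ε (q.prod (rankOne (N : F))) -
          derivedDen ϖ ε (q.prod (rankOne ((ϖ : F) ^ (-2 : ℤ) * (N : F)))) := by
  subst hr
  have hT2 : T2Space 𝒪[F] := by
    let := IsTopologicalAddGroup.rightUniformSpace F
    have := isUniformAddGroup_of_addCommGroup (G := F)
    infer_instance
  have hring : ringChar 𝓀[F] = p := ringChar.eq _ p
  have hψ := AddChar.FiniteField.primitiveChar_to_Complex_isPrimitive 𝓀[F]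
  set ψ := AddChar.FiniteField.primitiveChar_to_Complex 𝓀[F]
  have hϖ0 : (ϖ : F) ≠ 0 := fun h => hϖ.ne_zero (Subtype.ext h)
  have hN0 : (N : F) ≠ 0 := fun h => hN (Subtype.ext h)
  have hN' : (ϖ : F) ^ 2 * ((ϖ : F) ^ (-2 : ℤ) * (N : F)) = N := by
    rw [zpow_neg, zpow_ofNat, mul_inv_cancel_left₀ (pow_ne_zero 2 hϖ0)]
  have hN0' : (ϖ : F) ^ (-2 : ℤ) * (N : F) ≠ 0 := mul_ne_zero (zpow_ne_zero _ hϖ0) hN0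
  have hr' : Module.finrank 𝒪[F] (M × 𝒪[F]) = Module.finrank 𝒪[F] M + 1 := by simp
  have hcase1 : ringChar 𝓀[F] ≠ 2 ∨
      (ringChar 𝓀[F] = 2 ∧ Even (Module.finrank 𝒪[F] M) ∧ ε = 1) := by rwa [hring]
  have hcase2 : ringChar 𝓀[F] ≠ 2 ∨
      (ringChar 𝓀[F] = 2 ∧ Odd (Module.finrank 𝒪[F] (M × 𝒪[F])) ∧ ε = 1) :=
    hcase1.imp_right fun ⟨h2, hn, hε⟩ => ⟨h2, hr' ▸ hn.add_one, hε⟩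
  have hcase3 : Odd (Module.finrank 𝒪[F] (M × 𝒪[F])) ∨ ringChar 𝓀[F] ≠ 2 :=
    hcase2.symm.imp_left fun h => h.2.1
  have hcase4 : Odd (Module.finrank 𝒪[F] M) → ringChar 𝓀[F] ≠ 2 := fun ho =>
    hcase1.resolve_right fun h => Nat.not_even_iff_odd.2 ho h.2.1
  obtain ⟨P, hP, hPd⟩ := exists_isDen hϖ hψ hcase3 ε (hq.isNonsingular_prod hN0)
  obtain ⟨P', hP', hPd'⟩ := exists_isDen hϖ hψ hcase3 ε (hq.isNonsingular_prod hN0')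
  have hD : IsDenDelta ϖ ε N q (P - X ^ 2 * P') :=
    isDenDelta_sub hϖ hψ hr1 hcase4 hq hN hN' hPd hPd'
  have e1 : den ϖ ε (q.prod (rankOne (N : F))) = P :=
    IsDen.unique hϖ hcase2 (Classical.epsilon_spec ⟨P, hP⟩) hP
  have e2 : den ϖ ε (q.prod (rankOne ((ϖ : F) ^ (-2 : ℤ) * (N : F)))) = P' :=
    IsDen.unique hϖ hcase2 (Classical.epsilon_spec ⟨P', hP'⟩) hP'
  have e3 : denDelta ϖ ε N q = P - X ^ 2 * P' :=
    IsDenDelta.unique hϖ hr1 hcase1 (Classical.epsilon_spec ⟨_, hD⟩) hD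
  refine ⟨⟨⟨_, hD, fun R hR => IsDenDelta.unique hϖ hr1 hcase1 hR hD⟩,
    ⟨P, hP, fun R hR => IsDen.unique hϖ hcase2 hR hP⟩,
    ⟨P', hP', fun R hR => IsDen.unique hϖ hcase2 hR hP'⟩⟩, by rw [e1, e2, e3], fun H hH hemb => ?_⟩
  -- The term `2 * X * P'` of the derivative vanishes at `1`.
  have h0 : P'.eval 1 = 0 := eval_one_eq_zero hϖ rfl hψ hq hN hN' hPd' hH hemb
  rw [derivedDenDelta, derivedDen, derivedDen, e1, e2, e3]
  simp only [derivative_sub, derivative_mul, derivative_X_pow, eval_sub, eval_add, eval_mul,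
    eval_pow, eval_X, h0]
  ring
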